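/- Let $\alpha\in\mathbb R$, let $\mathbb T=\mathbb R/2\pi\mathbb Z$, and let $M=(\mathbb R\setminus\{0\})\times\mathbb T$ carry the Riemannian metric $dx^2+|x|^{-2\alpha}d\theta^2$, whose volume is $d\omega=|x|^{-\alpha}\,dx\,d\theta$. Let $$\Delta=\partial_x^2+|x|^{2\alpha}\partial_\theta^2-\frac{\alpha}{x}\partial_x$$ be its Laplace–Beltrami operator, regarded as an unbounded operator on $L^2(M,d\omega)$ with domain $C_c^\infty(M)$. For $k\in\mathbb Z$ let its $k$-th Fourier component be $$\widehat\Delta_k=\partial_x^2-\frac{\alpha}{x}\partial_x-k^2|x|^{2\alpha},$$ regarded as an unbounded operator on $L^2(\mathbb R\setminus\{0\},|x|^{-\alpha}dx)$ with domain $C_c^\infty(\mathbb R\setminus\{0\})$. A densely defined operator is called essentially self-adjoint if its closure is self-adjoint. Then the following holds, both when all the function spaces consist of real-valued functions and when they consist of complex-valued functions. 1. If $\alpha\le-3$, then $\Delta$ is essentially self-adjoint, and so is $\widehat\Delta_k$ for every $k\in\mathbb Z$. 2. If $-3<\alpha\le-1$, then $\Delta$ is not essentially self-adjoint; moreover, for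 $k\in\mathbb Z$, $\widehat\Delta_k$ fails to be essentially self-adjoint if and only if $k=0$. 3. If $-1<\alpha<1$, then $\Delta$ is not essentially self-adjoint, and for every $k\in\mathbb Z$ the component $\widehat\Delta_k$ is not essentially self-adjoint. 4. If $\alpha\ge1$, then $\Delta$ is essentially self-adjoint, and so is $\widehat\Delta_k$ for every $k\in\mathbb Z$. In particular, $\Delta$ is essentially self-adjoint if and only if $\alpha\notin(-3,1)$. -/

import Mathlib

open MeasureTheory Set Filter Topology
open scoped ContDiff

namespace GrushinLaplacian

/-! ### Unbounded operators on Hilbert spaces -/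

/-- An unbounded operator is essentially self-adjoint if its closure is self-adjoint
(self-adjointness of a partially defined operator, `A† = A`, forces its domain to be dense). -/
def EssentiallySelfAdjoint {𝕜 H : Type*} [RCLike 𝕜] [NormedAddCommGroup H]
    [InnerProductSpace 𝕜 H] [CompleteSpace H] (A : H →ₗ.[𝕜] H) : Prop :=
  A.IsClosable ∧ IsSelfAdjoint A.closure

section Operator

variable {𝕜 X : Type*} [RCLike 𝕜] [MeasurableSpace X]

/-- The passage to classes of square integrable functions, for a linear map into functions. -/
noncomputable def classMap (μ : Measure X) {D : Type*} [AddCommGroup D] [Module 𝕜 D]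
    (L : D →ₗ[𝕜] (X → 𝕜)) (hL : ∀ u, MemLp (L u) 2 μ) : D →ₗ[𝕜] Lp 𝕜 2 μ where
  toFun u := (hL u).toLp (L u)
  map_add' u v := by
    rw [← MemLp.toLp_add]
    exact MemLp.toLp_congr _ _ (by rw [map_add])
  map_smul' c u := by
    rw [RingHom.id_apply, ← MemLp.toLp_const_smul]
    exact MemLp.toLp_congr _ _ (by rw [map_smul])

theorem classMap_injective (μ : Measure X) (D : Submodule 𝕜 (X → 𝕜))
    (hD : ∀ u, MemLp (D.subtype u) 2 μ)
    (hinj : ∀ u ∈ D, u =ᵐ[μ] 0 → u = 0) : Function.Injective (classMap μ D.subtype hD) := by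
  rw [← LinearMap.ker_eq_bot, LinearMap.ker_eq_bot']
  intro u hu
  have h : (u : X → 𝕜) =ᵐ[μ] 0 := (MemLp.toLp_eq_toLp_iff (hD u) MemLp.zero).1 hu
  exact Subtype.ext (hinj _ u.2 h)

/-- The unbounded operator on `L²(μ)` with domain the (classes of) functions in `D`, which sends
the class of `u ∈ D` to the class of `L u`. -/
noncomputable def operatorOn (μ : Measure X) (D : Submodule 𝕜 (X → 𝕜)) (L : D →ₗ[𝕜] (X → 𝕜))
    (hD : ∀ u, MemLp (D.subtype u) 2 μ) (hL : ∀ u, MemLp (L u) 2 μ)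
    (hinj : ∀ u ∈ D, u =ᵐ[μ] 0 → u = 0) : Lp 𝕜 2 μ →ₗ.[𝕜] Lp 𝕜 2 μ where
  domain := LinearMap.range (classMap μ D.subtype hD)
  toFun := (classMap μ L hL).comp
    (LinearEquiv.ofInjective _ (classMap_injective μ D hD hinj)).symm.toLinearMap

theorem mem_graph_operatorOn (μ : Measure X) (D : Submodule 𝕜 (X → 𝕜)) (L : D →ₗ[𝕜] (X → 𝕜))
    (hD : ∀ u, MemLp (D.subtype u) 2 μ) (hL : ∀ u, MemLp (L u) 2 μ)
    (hinj : ∀ u ∈ D, u =ᵐ[μ] 0 → u = 0) (p : Lp 𝕜 2 μ × Lp 𝕜 2 μ) :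
    p ∈ (operatorOn μ D L hD hL hinj).graph ↔
      ∃ u : D, p.1 =ᵐ[μ] (u : X → 𝕜) ∧ p.2 =ᵐ[μ] L u := by
  rw [LinearPMap.mem_graph_iff]
  have key : ∀ u : D, (LinearEquiv.ofInjective _ (classMap_injective μ D hD hinj)).symm
      ⟨classMap μ D.subtype hD u, u, rfl⟩ = u := fun u => by
    rw [LinearEquiv.symm_apply_eq]; rfl
  constructor
  · rintro ⟨⟨_, u, rfl⟩, h1, h2⟩
    refine ⟨u, ?_, ?_⟩
    · rw [← h1]; exact (hD u).coeFn_toLp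
    · rw [← h2]
      change (classMap μ L hL _ : X → 𝕜) =ᵐ[μ] _
      erw [key u]
      exact (hL u).coeFn_toLp
  · rintro ⟨u, h1, h2⟩
    refine ⟨⟨classMap μ D.subtype hD u, u, rfl⟩, ?_, ?_⟩
    · exact Lp.ext ((hD u).coeFn_toLp.trans h1.symm)
    · change classMap μ L hL _ = _
      erw [key u]
      exact Lp.ext ((hL u).coeFn_toLp.trans h2.symm)

end Operator

/-! ### The manifold `M = (ℝ \ {0}) × 𝕋` and its measure

Functions on `M` are written as functions on `ℝ × 𝕋`. For the `L²` spaces this changes nothing,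
since `{0} × 𝕋` is a null set, and compactly supported functions on `M` are extended by zero. -/

/-- The circle `𝕋 = ℝ / 2πℤ`. -/
abbrev Torus : Type := AddCircle (2 * Real.pi)

instance fact_two_pi_pos : Fact (0 < 2 * Real.pi) := ⟨Real.two_pi_pos⟩

/-- The measure `|x|^{-α} dx` on `ℝ \ {0}`. -/
noncomputable abbrev lineMeasure (α : ℝ) : Measure ℝ :=
  (volume : Measure ℝ).withDensity fun x => ENNReal.ofReal (|x| ^ (-α))

/-- The Riemannian measure `dω = |x|^{-α} dx dθ` on `M`; here `dθ` has total mass `2π`. -/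
noncomputable abbrev riemannianMeasure (α : ℝ) : Measure (ℝ × Torus) :=
  (lineMeasure α).prod (volume : Measure Torus)

theorem lineMeasure_lt_top (α : ℝ) {K : Set ℝ} (hK : IsCompact K) (h0 : K ⊆ {x | x ≠ 0}) :
    lineMeasure α K < ⊤ := by
  rw [withDensity_apply _ hK.measurableSet]
  have hc : ContinuousOn (fun x : ℝ => |x| ^ (-α)) K :=
    continuous_abs.continuousOn.rpow_const fun x hx => Or.inl (abs_ne_zero.2 (h0 hx))
  exact (hc.integrableOn_compact hK).lintegral_lt_top

theorem volume_ac_lineMeasure (α : ℝ) : (volume : Measure ℝ) ≪ lineMeasure α := by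
  refine withDensity_absolutelyContinuous' (by fun_prop) ?_
  have h : ∀ᵐ x : ℝ, x ≠ 0 := by simp [ae_iff]
  filter_upwards [h] with x hx
  simpa using Real.rpow_pos_of_pos (abs_pos.2 hx) _

theorem memLp_of_compactSupport {𝕜 X : Type*} [RCLike 𝕜] [TopologicalSpace X] [R1Space X]
    [MeasurableSpace X] [BorelSpace X] [SecondCountableTopology X]
    (μ : Measure X) {f : X → 𝕜} (hf : Continuous f) (hc : HasCompactSupport f)
    (hμ : μ (tsupport f) < ⊤) : MemLp f 2 μ := by
  have hm : MeasurableSet (tsupport f) := (isClosed_tsupport f).measurableSet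
  obtain ⟨C, hC⟩ := hf.bounded_above_of_compact_support hc
  have : IsFiniteMeasure (μ.restrict (tsupport f)) := ⟨by simpa using hμ⟩
  have h := MemLp.of_bound (μ := μ.restrict (tsupport f)) (p := 2)
    hf.aestronglyMeasurable C (Eventually.of_forall hC)
  rw [← memLp_indicator_iff_restrict hm] at h
  convert h using 1
  exact (indicator_eq_self.2 (subset_tsupport f)).symm

/-! ### Fourier components on `ℝ \ {0}` -/

section Line

variable (𝕜 : Type*) [RCLike 𝕜]

/-- `C_c^∞(ℝ \ {0})`, with values in `𝕜`. -/
def testLine : Submodule 𝕜 (ℝ → 𝕜) where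
  carrier := {u | ContDiff ℝ ∞ u ∧ HasCompactSupport u ∧ tsupport u ⊆ {x | x ≠ 0}}
  zero_mem' := ⟨contDiff_const, HasCompactSupport.zero, by simp [tsupport]⟩
  add_mem' {u v} hu hv := ⟨hu.1.add hv.1, hu.2.1.add hv.2.1,
    (tsupport_add u v).trans (union_subset hu.2.2 hv.2.2)⟩
  smul_mem' c u hu := ⟨contDiff_const.smul hu.1, hu.2.1.smul_left,
    (tsupport_smul_subset_right (fun _ => c) u).trans hu.2.2⟩

variable {𝕜}

/-- The differential expression `∂_x² u - (α / x) ∂_x u - k² |x|^{2α} u`. -/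
noncomputable def fourierExpr (α : ℝ) (k : ℤ) (u : ℝ → 𝕜) (x : ℝ) : 𝕜 :=
  deriv (deriv u) x - (α / x) • deriv u x - ((k : ℝ) ^ 2 * |x| ^ (2 * α)) • u x

theorem testLine_differentiable {u : ℝ → 𝕜} (hu : u ∈ testLine 𝕜) :
    Differentiable ℝ u ∧ Differentiable ℝ (deriv u) ∧ Continuous (deriv (deriv u)) := by
  have h1 : ContDiff ℝ ∞ (deriv u) := (contDiff_infty_iff_deriv.1 hu.1).2
  have h2 : ContDiff ℝ ∞ (deriv (deriv u)) := (contDiff_infty_iff_deriv.1 h1).2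
  exact ⟨hu.1.differentiable (by simp), h1.differentiable (by simp), h2.continuous⟩

theorem tsupport_fourierExpr (α : ℝ) (k : ℤ) (u : ℝ → 𝕜) :
    tsupport (fourierExpr α k u) ⊆ tsupport u := by
  refine closure_minimal (fun x hx => ?_) (isClosed_tsupport u)
  by_contra h
  have h1 : x ∉ tsupport (deriv u) := fun h' => h (tsupport_deriv_subset h')
  have h2 : x ∉ tsupport (deriv (deriv u)) := fun h' => h1 (tsupport_deriv_subset h')
  exact hx (by simp [fourierExpr, image_eq_zero_of_notMem_tsupport h,
    image_eq_zero_of_notMem_tsupport h1, image_eq_zero_of_notMem_tsupport h2])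

theorem continuous_fourierExpr (α : ℝ) (k : ℤ) {u : ℝ → 𝕜} (hu : u ∈ testLine 𝕜) :
    Continuous (fourierExpr α k u) := by
  obtain ⟨h0, h1, h2⟩ := testLine_differentiable hu
  rw [continuous_iff_continuousAt]
  intro x
  by_cases hx : x = 0
  · have hn : x ∉ tsupport (fourierExpr α k u) := fun h =>
      hu.2.2 (tsupport_fourierExpr α k u h) hx
    exact continuousAt_const.congr (notMem_tsupport_iff_eventuallyEq.1 hn).symm
  · have e1 : ContinuousAt (fun y : ℝ => α / y) x := continuousAt_const.div continuousAt_id hx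
    have e2 : ContinuousAt (fun y : ℝ => (k : ℝ) ^ 2 * |y| ^ (2 * α)) x :=
      continuousAt_const.mul
        (continuous_abs.continuousAt.rpow_const (Or.inl (abs_ne_zero.2 hx)))
    exact (h2.continuousAt.sub (e1.smul h1.continuous.continuousAt)).sub
      (e2.smul h0.continuous.continuousAt)

variable (𝕜)

/-- The expression of the `k`-th Fourier component as a linear map on `C_c^∞(ℝ \ {0})`. -/
noncomputable def fourierMap (α : ℝ) (k : ℤ) : testLine 𝕜 →ₗ[𝕜] (ℝ → 𝕜) where
  toFun u := fourierExpr α k u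
  map_add' u v := by
    obtain ⟨u0, u1, -⟩ := testLine_differentiable u.2
    obtain ⟨v0, v1, -⟩ := testLine_differentiable v.2
    have h : deriv ((u : ℝ → 𝕜) + (v : ℝ → 𝕜)) = deriv (u : ℝ → 𝕜) + deriv (v : ℝ → 𝕜) :=
      funext fun x => deriv_add (u0 x) (v0 x)
    funext x
    simp only [fourierExpr, Submodule.coe_add, h, deriv_add (u1 x) (v1 x), Pi.add_apply, smul_add]
    abel
  map_smul' c u := by
    have h : ∀ w : ℝ → 𝕜, deriv (c • w) = c • deriv w := fun w =>
      funext fun x => deriv_const_smul_field c w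
    funext x
    simp only [fourierExpr, Submodule.coe_smul, h, Pi.smul_apply, RingHom.id_apply, smul_sub,
      smul_comm c]

theorem testLine_memLp (α : ℝ) (u : testLine 𝕜) :
    MemLp ((testLine 𝕜).subtype u) 2 (lineMeasure α) :=
  memLp_of_compactSupport _ u.2.1.continuous u.2.2.1 (lineMeasure_lt_top α u.2.2.1 u.2.2.2)

theorem fourierMap_memLp (α : ℝ) (k : ℤ) (u : testLine 𝕜) :
    MemLp (fourierMap 𝕜 α k u) 2 (lineMeasure α) := by
  have hs := tsupport_fourierExpr α k (u : ℝ → 𝕜)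
  have hc : HasCompactSupport (fourierExpr α k (u : ℝ → 𝕜)) :=
    u.2.2.1.of_isClosed_subset (isClosed_tsupport _) hs
  exact memLp_of_compactSupport _ (continuous_fourierExpr α k u.2) hc
    (lineMeasure_lt_top α hc (hs.trans u.2.2.2))

theorem testLine_eq_zero (α : ℝ) (u : ℝ → 𝕜) (hu : u ∈ testLine 𝕜)
    (h : u =ᵐ[lineMeasure α] 0) : u = 0 :=
  (Continuous.ae_eq_iff_eq volume hu.1.continuous continuous_zero).1
    ((volume_ac_lineMeasure α).ae_eq h)

/-- The `k`-th Fourier component `Δ̂_k = ∂_x² - (α / x) ∂_x - k² |x|^{2α}`, as an unbounded operator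
on `L²(ℝ \ {0}, |x|^{-α} dx)` with domain `C_c^∞(ℝ \ {0})`. -/
noncomputable def fourierComponent (α : ℝ) (k : ℤ) :
    Lp 𝕜 2 (lineMeasure α) →ₗ.[𝕜] Lp 𝕜 2 (lineMeasure α) :=
  operatorOn (lineMeasure α) (testLine 𝕜) (fourierMap 𝕜 α k)
    (testLine_memLp 𝕜 α) (fourierMap_memLp 𝕜 α k) (testLine_eq_zero 𝕜 α)

end Line

/-! ### The Laplace–Beltrami operator on `M` -/

section Surface

variable {𝕜 : Type*} [RCLike 𝕜]

/-- The lift of a function on `ℝ × 𝕋` to the universal cover `ℝ × ℝ`. -/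
noncomputable def lift (f : ℝ × Torus → 𝕜) : ℝ × ℝ → 𝕜 := fun p => f (p.1, (p.2 : Torus))

/-- The partial derivative `∂_x`. -/
noncomputable def partialX (f : ℝ × Torus → 𝕜) (p : ℝ × Torus) : 𝕜 :=
  deriv (fun x : ℝ => f (x, p.2)) p.1

/-- The partial derivative `∂_θ`. -/
noncomputable def partialTheta (f : ℝ × Torus → 𝕜) (p : ℝ × Torus) : 𝕜 :=
  deriv (fun t : ℝ => f (p.1, p.2 + (t : Torus))) 0

/-- The differential expression `∂_x² f + |x|^{2α} ∂_θ² f - (α / x) ∂_x f`. -/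
noncomputable def laplaceExpr (α : ℝ) (f : ℝ × Torus → 𝕜) (p : ℝ × Torus) : 𝕜 :=
  partialX (partialX f) p + (|p.1| ^ (2 * α)) • partialTheta (partialTheta f) p
    - (α / p.1) • partialX f p

variable (𝕜) in
/-- `C_c^∞(M)`, with values in `𝕜`: a function on `M` is smooth when its lift to the
universal cover is. -/
noncomputable def testSurface : Submodule 𝕜 (ℝ × Torus → 𝕜) where
  carrier := {f | ContDiff ℝ ∞ (lift f) ∧ HasCompactSupport f ∧ tsupport f ⊆ {p | p.1 ≠ 0}}
  zero_mem' := ⟨contDiff_const, HasCompactSupport.zero, by simp [tsupport]⟩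
  add_mem' {u v} hu hv := ⟨hu.1.add hv.1, hu.2.1.add hv.2.1,
    (tsupport_add u v).trans (union_subset hu.2.2 hv.2.2)⟩
  smul_mem' c u hu := ⟨contDiff_const.smul hu.1, hu.2.1.smul_left,
    (tsupport_smul_subset_right (fun _ => c) u).trans hu.2.2⟩

theorem hasDerivAt_fst {f : ℝ × Torus → 𝕜} (hf : ContDiff ℝ ∞ (lift f)) (x t : ℝ) :
    HasDerivAt (fun y : ℝ => f (y, (t : Torus))) (fderiv ℝ (lift f) (x, t) (1, 0)) x := by
  have h1 := ((hf.differentiable (by simp)) (x, t)).hasFDerivAt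
  exact h1.comp_hasDerivAt x (f := fun y : ℝ => (y, t))
    ((hasDerivAt_id x).prodMk (hasDerivAt_const x t))

theorem hasDerivAt_snd {f : ℝ × Torus → 𝕜} (hf : ContDiff ℝ ∞ (lift f)) (x t : ℝ) :
    HasDerivAt (fun s : ℝ => f (x, (t : Torus) + (s : Torus)))
      (fderiv ℝ (lift f) (x, t) (0, 1)) 0 := by
  have h1 : HasFDerivAt (lift f) (fderiv ℝ (lift f) (x, t)) (x, t + 0) := by
    rw [add_zero]; exact ((hf.differentiable (by simp)) (x, t)).hasFDerivAt
  have h2 := h1.comp_hasDerivAt 0 (f := fun s : ℝ => (x, t + s))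
    ((hasDerivAt_const 0 x).prodMk ((hasDerivAt_id (0 : ℝ)).const_add t))
  exact h2

theorem hasDerivAt_partialX {f : ℝ × Torus → 𝕜} (hf : ContDiff ℝ ∞ (lift f)) (p : ℝ × Torus) :
    HasDerivAt (fun x : ℝ => f (x, p.2)) (partialX f p) p.1 := by
  obtain ⟨x, θ⟩ := p
  induction θ using QuotientAddGroup.induction_on with
  | H t => exact (hasDerivAt_fst hf x t).differentiableAt.hasDerivAt

theorem hasDerivAt_partialTheta {f : ℝ × Torus → 𝕜} (hf : ContDiff ℝ ∞ (lift f))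
    (p : ℝ × Torus) :
    HasDerivAt (fun t : ℝ => f (p.1, p.2 + (t : Torus))) (partialTheta f p) 0 := by
  obtain ⟨x, θ⟩ := p
  induction θ using QuotientAddGroup.induction_on with
  | H t => exact (hasDerivAt_snd hf x t).differentiableAt.hasDerivAt

theorem contDiff_lift_partialX {f : ℝ × Torus → 𝕜} (hf : ContDiff ℝ ∞ (lift f)) :
    ContDiff ℝ ∞ (lift (partialX f)) := by
  have h : lift (partialX f) = fun p => fderiv ℝ (lift f) p (1, 0) :=
    funext fun p => (hasDerivAt_fst hf p.1 p.2).deriv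
  rw [h]
  exact (hf.fderiv_right (m := ∞) (by simp)).clm_apply contDiff_const

theorem contDiff_lift_partialTheta {f : ℝ × Torus → 𝕜} (hf : ContDiff ℝ ∞ (lift f)) :
    ContDiff ℝ ∞ (lift (partialTheta f)) := by
  have h : lift (partialTheta f) = fun p => fderiv ℝ (lift f) p (0, 1) :=
    funext fun p => (hasDerivAt_snd hf p.1 p.2).deriv
  rw [h]
  exact (hf.fderiv_right (m := ∞) (by simp)).clm_apply contDiff_const

theorem continuous_of_lift {f : ℝ × Torus → 𝕜} (hf : Continuous (lift f)) : Continuous f := by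
  have hq : IsOpenQuotientMap (Prod.map id (fun t : ℝ => (t : Torus)) : ℝ × ℝ → ℝ × Torus) :=
    IsOpenQuotientMap.id.prodMap QuotientAddGroup.isOpenQuotientMap_mk
  exact hq.isQuotientMap.continuous_iff.2 hf

theorem tsupport_partialX (f : ℝ × Torus → 𝕜) : tsupport (partialX f) ⊆ tsupport f := by
  refine closure_minimal (fun p hp => ?_) (isClosed_tsupport f)
  by_contra h
  have h0 : f =ᶠ[𝓝 p] 0 := notMem_tsupport_iff_eventuallyEq.1 h
  have hc : Tendsto (fun x : ℝ => (x, p.2)) (𝓝 p.1) (𝓝 p) :=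
    (Continuous.tendsto (by fun_prop) p.1)
  have h1 : (fun x : ℝ => f (x, p.2)) =ᶠ[𝓝 p.1] fun _ => 0 := hc.eventually h0
  exact hp (by rw [partialX, h1.deriv_eq, deriv_const])

theorem tsupport_partialTheta (f : ℝ × Torus → 𝕜) : tsupport (partialTheta f) ⊆ tsupport f := by
  refine closure_minimal (fun p hp => ?_) (isClosed_tsupport f)
  by_contra h
  have h0 : f =ᶠ[𝓝 p] 0 := notMem_tsupport_iff_eventuallyEq.1 h
  have hq : Continuous (fun t : ℝ => (t : Torus)) := AddCircle.continuous_mk' _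
  have hc : Tendsto (fun t : ℝ => (p.1, p.2 + (t : Torus))) (𝓝 0) (𝓝 p) := by
    have := Continuous.tendsto (f := fun t : ℝ => (p.1, p.2 + (t : Torus))) (by fun_prop) 0
    simpa using this
  have h1 : (fun t : ℝ => f (p.1, p.2 + (t : Torus))) =ᶠ[𝓝 0] fun _ => 0 := hc.eventually h0
  exact hp (by rw [partialTheta, h1.deriv_eq, deriv_const])

theorem tsupport_laplaceExpr (α : ℝ) (f : ℝ × Torus → 𝕜) :
    tsupport (laplaceExpr α f) ⊆ tsupport f := by
  refine closure_minimal (fun p hp => ?_) (isClosed_tsupport f)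
  by_contra h
  have h1 : p ∉ tsupport (partialX f) := fun h' => h (tsupport_partialX f h')
  have h2 : p ∉ tsupport (partialX (partialX f)) := fun h' => h1 (tsupport_partialX _ h')
  have h3 : p ∉ tsupport (partialTheta (partialTheta f)) := fun h' =>
    h (tsupport_partialTheta f (tsupport_partialTheta _ h'))
  exact hp (by simp [laplaceExpr, image_eq_zero_of_notMem_tsupport h1,
    image_eq_zero_of_notMem_tsupport h2, image_eq_zero_of_notMem_tsupport h3])

theorem continuous_laplaceExpr (α : ℝ) {f : ℝ × Torus → 𝕜} (hf : f ∈ testSurface 𝕜) :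
    Continuous (laplaceExpr α f) := by
  have h1 := contDiff_lift_partialX hf.1
  have c1 := continuous_of_lift h1.continuous
  have c2 := continuous_of_lift (contDiff_lift_partialX h1).continuous
  have c3 := continuous_of_lift
    (contDiff_lift_partialTheta (contDiff_lift_partialTheta hf.1)).continuous
  rw [continuous_iff_continuousAt]
  intro p
  by_cases hp : p.1 = 0
  · have hn : p ∉ tsupport (laplaceExpr α f) := fun h =>
      hf.2.2 (tsupport_laplaceExpr α f h) hp
    exact continuousAt_const.congr (notMem_tsupport_iff_eventuallyEq.1 hn).symm
  · have e1 : ContinuousAt (fun q : ℝ × Torus => α / q.1) p :=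
      continuousAt_const.div continuousAt_fst hp
    have e2 : ContinuousAt (fun q : ℝ × Torus => |q.1| ^ (2 * α)) p :=
      (continuousAt_fst.abs).rpow_const (Or.inl (abs_ne_zero.2 hp))
    exact (c2.continuousAt.add (e2.smul c3.continuousAt)).sub (e1.smul c1.continuousAt)

theorem partialX_add {f g : ℝ × Torus → 𝕜} (hf : ContDiff ℝ ∞ (lift f))
    (hg : ContDiff ℝ ∞ (lift g)) : partialX (f + g) = partialX f + partialX g :=
  funext fun p => ((hasDerivAt_partialX hf p).add (hasDerivAt_partialX hg p)).deriv

theorem partialTheta_add {f g : ℝ × Torus → 𝕜} (hf : ContDiff ℝ ∞ (lift f))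
    (hg : ContDiff ℝ ∞ (lift g)) : partialTheta (f + g) = partialTheta f + partialTheta g :=
  funext fun p => ((hasDerivAt_partialTheta hf p).add (hasDerivAt_partialTheta hg p)).deriv

theorem partialX_smul (c : 𝕜) (f : ℝ × Torus → 𝕜) : partialX (c • f) = c • partialX f :=
  funext fun p => deriv_const_smul_field c (fun x : ℝ => f (x, p.2))

theorem partialTheta_smul (c : 𝕜) (f : ℝ × Torus → 𝕜) :
    partialTheta (c • f) = c • partialTheta f :=
  funext fun p => deriv_const_smul_field c (fun t : ℝ => f (p.1, p.2 + (t : Torus)))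

variable (𝕜)

/-- The Laplace–Beltrami expression as a linear map on `C_c^∞(M)`. -/
noncomputable def laplaceMap (α : ℝ) : testSurface 𝕜 →ₗ[𝕜] (ℝ × Torus → 𝕜) where
  toFun f := laplaceExpr α f
  map_add' f g := by
    have hf := f.2.1
    have hg := g.2.1
    funext p
    simp only [laplaceExpr, Submodule.coe_add, partialX_add hf hg, partialTheta_add hf hg,
      partialX_add (contDiff_lift_partialX hf) (contDiff_lift_partialX hg),
      partialTheta_add (contDiff_lift_partialTheta hf) (contDiff_lift_partialTheta hg),
      Pi.add_apply, smul_add]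
    abel
  map_smul' c f := by
    funext p
    simp only [laplaceExpr, Submodule.coe_smul, partialX_smul, partialTheta_smul, Pi.smul_apply,
      RingHom.id_apply, smul_sub, smul_add, smul_comm c]

theorem riemannianMeasure_lt_top (α : ℝ) {K : Set (ℝ × Torus)} (hK : IsCompact K)
    (h0 : K ⊆ {p | p.1 ≠ 0}) : riemannianMeasure α K < ⊤ := by
  have hs : K ⊆ (Prod.fst '' K) ×ˢ (univ : Set Torus) := fun p hp => ⟨⟨p, hp, rfl⟩, trivial⟩
  refine (measure_mono hs).trans_lt ?_
  rw [Measure.prod_prod]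
  refine ENNReal.mul_lt_top (lineMeasure_lt_top α (hK.image continuous_fst) ?_)
    (measure_lt_top _ _)
  rintro _ ⟨p, hp, rfl⟩
  exact h0 hp

theorem testSurface_memLp (α : ℝ) (f : testSurface 𝕜) :
    MemLp ((testSurface 𝕜).subtype f) 2 (riemannianMeasure α) :=
  memLp_of_compactSupport _ (continuous_of_lift f.2.1.continuous) f.2.2.1
    (riemannianMeasure_lt_top α f.2.2.1 f.2.2.2)

theorem laplaceMap_memLp (α : ℝ) (f : testSurface 𝕜) :
    MemLp (laplaceMap 𝕜 α f) 2 (riemannianMeasure α) := by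
  have hs := tsupport_laplaceExpr α (f : ℝ × Torus → 𝕜)
  have hc : HasCompactSupport (laplaceExpr α (f : ℝ × Torus → 𝕜)) :=
    f.2.2.1.of_isClosed_subset (isClosed_tsupport _) hs
  exact memLp_of_compactSupport _ (continuous_laplaceExpr α f.2) hc
    (riemannianMeasure_lt_top α hc (hs.trans f.2.2.2))

theorem testSurface_eq_zero (α : ℝ) (f : ℝ × Torus → 𝕜) (hf : f ∈ testSurface 𝕜)
    (h : f =ᵐ[riemannianMeasure α] 0) : f = 0 := by
  have hac : (volume : Measure ℝ).prod (volume : Measure Torus) ≪ riemannianMeasure α :=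
    (volume_ac_lineMeasure α).prod Measure.AbsolutelyContinuous.rfl
  exact (Continuous.ae_eq_iff_eq ((volume : Measure ℝ).prod (volume : Measure Torus))
    (continuous_of_lift hf.1.continuous) continuous_zero).1 (hac.ae_eq h)

/-- The Laplace–Beltrami operator `Δ = ∂_x² + |x|^{2α} ∂_θ² - (α / x) ∂_x` of the metric
`dx² + |x|^{-2α} dθ²`, as an unbounded operator on `L²(M, |x|^{-α} dx dθ)` with
domain `C_c^∞(M)`. -/
noncomputable def laplaceBeltrami (α : ℝ) :
    Lp 𝕜 2 (riemannianMeasure α) →ₗ.[𝕜] Lp 𝕜 2 (riemannianMeasure α) :=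
  operatorOn (riemannianMeasure α) (testSurface 𝕜) (laplaceMap 𝕜 α)
    (testSurface_memLp 𝕜 α) (laplaceMap_memLp 𝕜 α) (testSurface_eq_zero 𝕜 α)

end Surface

end GrushinLaplacian

/-! Off `x = 0` the radial part has divergence form: `|x|^{-α} (u'' - (α/x) u') = (|x|^{-α} u')'`.
Hence `Δ` and every `Δ̂_k` are symmetric and nonpositive, and everything depends on which solutions
are square integrable near `x = 0` (Weyl's limit-point/limit-circle alternative). For `k = 0` the
solutions of `Δ̂_k h = 0` on `(0, ∞)` are spanned by `1` and a primitive of `x^α`. Near `0` the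
first is in `L²(x^{-α} dx)` iff `α < 1`, the second iff `α > -3`. For `k ≠ 0` the solutions are `exp
(± k P)` with `P' = x^α`. For `-1 < α < 1` the primitive `P` is bounded near `0` and both are square
integrable; for `α ≤ -1` it is unbounded there and one of them is not.

Positive direction. A symmetric nonpositive operator is essentially self-adjoint once `A - 1` has
dense range (`essentiallySelfAdjoint_of_nonpos`). One real spectral point replaces the usual pair `±
i`, so real and complex scalars are treated together. A vector orthogonal to that range is a weak
solution of `(x^{-α} u')' = x^{-α} (1 + k² x^{2α}) u` on each half-line. It is classical by
`exists_classical_solution` and vanishes by `ode_eq_zero`. There `u · x^{-α} u'` is increasing, so a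
nonzero solution grows towards `∞` or towards `0`, and a Sturm comparison with the borderline
function `x^{-(1-α)/2}` contradicts square integrability.

Negative direction. If `A` is essentially self-adjoint, its adjoint is symmetric
(`EssentiallySelfAdjoint.inner_eq`). Two solutions, both square integrable near `0`, are cut off on
the right and extended by zero to `x < 0`. They lie in the domain of the adjoint, and the boundary
form evaluates to their nonzero Wronskian (`boundaryPair_of_solutions`).

On the surface, the modes `cos kθ` and `sin kθ` separate variables, so a vector orthogonal to the
range of `Δ - 1` has Fourier coefficients orthogonal to the ranges of `Δ̂_k - 1`. Conversely, the `k
= 0` pair, viewed as rotationally invariant functions, also defeats `Δ`. -/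

namespace GrushinLaplacian

/-! ### Criteria for essential self-adjointness in a Hilbert space. -/

section Abstract

variable {𝕜 H : Type*} [RCLike 𝕜] [NormedAddCommGroup H] [InnerProductSpace 𝕜 H] [CompleteSpace H]

/-- If the closure of `A` is self-adjoint, the weakly defined adjoint of `A` is symmetric. -/
theorem EssentiallySelfAdjoint.inner_eq {A : H →ₗ.[𝕜] H} (hA : EssentiallySelfAdjoint A)
    {u f v g : H} (hu : ∀ x : A.domain, inner 𝕜 f (x : H) = inner 𝕜 u (A x))
    (hv : ∀ x : A.domain, inner 𝕜 g (x : H) = inner 𝕜 v (A x)) :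
    inner 𝕜 f v = inner 𝕜 u g := by
  obtain ⟨hc, hs⟩ := hA
  have hd := hs.dense_domain
  have hgr : ∀ {u f : H}, (∀ x : A.domain, inner 𝕜 f (x : H) = inner 𝕜 u (A x)) →
      -- For fixed `u` and `f` the relation is closed in `H × H`, so it passes from the graph of `A`
      -- to its closure.
      ∀ x : A.closure.domain, inner 𝕜 f (x : H) = inner 𝕜 u (A.closure x) := by
    intro u f hu x
    have hx : ((x : H), A.closure x) ∈ A.graph.topologicalClosure := by
      rw [hc.graph_closure_eq_closure_graph]
      exact LinearPMap.mem_graph _ x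
    have hcl : IsClosed {z : H × H | inner 𝕜 f z.1 = inner 𝕜 u z.2} :=
      isClosed_eq (by fun_prop) (by fun_prop)
    have hsub : (A.graph : Set (H × H)) ⊆ {z : H × H | inner 𝕜 f z.1 = inner 𝕜 u z.2} := by
      rintro z hz
      obtain ⟨y, h1, h2⟩ := (LinearPMap.mem_graph_iff _).1 hz
      have := hu y
      rw [h1, h2] at this
      exact this
    exact closure_minimal hsub hcl hx
  -- The relation puts `u` in the domain of the adjoint of the closure, which is the closure itself.
  have hmem : ∀ {u f : H}, (∀ x : A.domain, inner 𝕜 f (x : H) = inner 𝕜 u (A x)) →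
      ∃ y : A.closure.domain, (y : H) = u ∧ A.closure y = f := by
    intro u f hu
    have h1 : u ∈ A.closure.adjoint.domain :=
      LinearPMap.mem_adjoint_domain_of_exists u ⟨f, hgr hu⟩
    have h2 : A.closure.adjoint ⟨u, h1⟩ = f :=
      LinearPMap.adjoint_apply_eq hd ⟨u, h1⟩ (hgr hu)
    have h3 : (u, f) ∈ A.closure.graph := by
      rw [← LinearPMap.isSelfAdjoint_def.1 hs]
      exact (LinearPMap.mem_graph_iff _).2 ⟨⟨u, h1⟩, rfl, h2⟩
    exact (LinearPMap.mem_graph_iff _).1 h3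
  obtain ⟨y, rfl, rfl⟩ := hmem hv
  exact hgr hu y

/-- A symmetric nonpositive operator `A` is essentially self-adjoint as soon as the range of `A - 1`
is dense. -/
theorem essentiallySelfAdjoint_of_nonpos {A : H →ₗ.[𝕜] H} (hd : Dense (A.domain : Set H))
    (hsymm : ∀ x y : A.domain, inner 𝕜 (A x) (y : H) = inner 𝕜 (x : H) (A y))
    (hneg : ∀ x : A.domain, RCLike.re (inner 𝕜 (A x) (x : H)) ≤ 0)
    (hker : ∀ u : H, (∀ x : A.domain, inner 𝕜 u (A x - x) = 0) → u = 0) :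
    EssentiallySelfAdjoint A := by
  -- A symmetric operator is contained in its adjoint, which is closed; hence it is closable.
  have hle : A ≤ A.adjoint := LinearPMap.IsFormalAdjoint.le_adjoint hd hsymm
  have hc : A.IsClosable := (LinearPMap.adjoint_isClosed hd).isClosable.leIsClosable hle
  refine ⟨hc, ?_⟩
  have hgc := hc.graph_closure_eq_closure_graph
  have hd' : Dense (A.closure.domain : Set H) := hd.mono A.le_closure.1
  -- Closed conditions on the graph extend to the closure; symmetry, taken one variable at a time,
  -- and nonpositivity are transferred this way.
  have hind : ∀ P : H × H → Prop, IsClosed {z | P z} → (∀ x : A.domain, P (x, A x)) →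
      ∀ x : A.closure.domain, P (x, A.closure x) := by
    intro P hP h x
    have hx : ((x : H), A.closure x) ∈ A.graph.topologicalClosure := by
      rw [hgc]; exact LinearPMap.mem_graph _ x
    refine closure_minimal (t := {z | P z}) ?_ hP hx
    rintro ⟨z, w⟩ hz
    obtain ⟨y, h1, h2⟩ := (LinearPMap.mem_graph_iff _).1 hz
    have := h y
    simp only at h1 h2
    rwa [h1, h2] at this
  have hsymm1 : ∀ (x : A.closure.domain) (y : A.domain),
      inner 𝕜 (A.closure x) (y : H) = inner 𝕜 (x : H) (A y) := fun x y =>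
    hind (fun z => inner 𝕜 z.2 (y : H) = inner 𝕜 z.1 (A y))
      (isClosed_eq (by fun_prop) (by fun_prop)) (fun x => hsymm x y) x
  have hsymm2 : ∀ x y : A.closure.domain,
      inner 𝕜 (A.closure x) (y : H) = inner 𝕜 (x : H) (A.closure y) := fun x y =>
    hind (fun z => inner 𝕜 (A.closure x) z.1 = inner 𝕜 (x : H) z.2)
      (isClosed_eq (by fun_prop) (by fun_prop)) (fun y => hsymm1 x y) y
  have hneg' : ∀ x : A.closure.domain, RCLike.re (inner 𝕜 (A.closure x) (x : H)) ≤ 0 :=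
    hind (fun z => RCLike.re (inner 𝕜 z.2 z.1) ≤ 0)
      (isClosed_le (RCLike.continuous_re.comp (by fun_prop)) continuous_const) hneg
  -- the map `x ↦ A x - x` on the closure is bounded below
  have hbound : ∀ x : A.closure.domain, ‖(x : H)‖ ≤ ‖A.closure x - x‖ := by
    intro x
    have h1 : ‖(x : H)‖ ^ 2 ≤ RCLike.re (inner 𝕜 ((x : H) - A.closure x) (x : H)) := by
      rw [inner_sub_left, map_sub, inner_self_eq_norm_sq]
      linarith [hneg' x]
    have h2 := (RCLike.re_le_norm (inner 𝕜 ((x : H) - A.closure x) (x : H))).trans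
      (norm_inner_le_norm _ _)
    rw [norm_sub_rev] at h2
    by_contra! hlt
    nlinarith [norm_nonneg (x : H), norm_nonneg (A.closure x - (x : H))]
  let R : A.closure.domain →ₗ[𝕜] H := A.closure.toFun - A.closure.domain.subtype
  have hR : ∀ x, R x = A.closure x - x := fun x => rfl
  -- The lower bound makes preimages of a convergent sequence Cauchy, and the closed graph of the
  -- closure supplies a preimage of the limit.
  have hclosed : IsClosed (LinearMap.range R : Set H) := by
    rw [← isSeqClosed_iff_isClosed]
    intro w z hw hz
    choose x hx using hw
    have hcx : CauchySeq fun n => ((x n : A.closure.domain) : H) := by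
      have := hz.cauchySeq
      rw [Metric.cauchySeq_iff] at this ⊢
      intro ε hε
      obtain ⟨N, hN⟩ := this ε hε
      refine ⟨N, fun m hm n hn => lt_of_le_of_lt ?_ (hN m hm n hn)⟩
      rw [dist_eq_norm, dist_eq_norm, ← hx m, ← hx n, ← map_sub, hR]
      exact hbound (x m - x n)
    obtain ⟨l, hl⟩ := cauchySeq_tendsto_of_complete hcx
    have hlim : Tendsto (fun n => ((x n : H), A.closure (x n))) atTop (𝓝 (l, z + l)) := by
      refine hl.prodMk_nhds ?_
      have : Tendsto (fun n => w n + (x n : H)) atTop (𝓝 (z + l)) := hz.add hl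
      refine this.congr fun n => ?_
      rw [← hx n, hR]; abel
    have hmem : (l, z + l) ∈ A.closure.graph :=
      hc.closure_isClosed.mem_of_tendsto hlim
        (Eventually.of_forall fun n => LinearPMap.mem_graph _ (x n))
    obtain ⟨y, h1, h2⟩ := (LinearPMap.mem_graph_iff _).1 hmem
    refine ⟨y, ?_⟩
    simp only at h1 h2
    rw [hR, h1, h2]; abel
  have hcomp : CompleteSpace (LinearMap.range R) := hclosed.completeSpace_coe
  -- The range is closed, and `hker` says that its orthogonal complement is trivial.
  have htop : LinearMap.range R = ⊤ := by
    rw [← Submodule.orthogonal_eq_bot_iff, Submodule.eq_bot_iff]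
    intro u hu
    refine hker u fun x => ?_
    have hx : (x : H) ∈ A.closure.domain := A.le_closure.1 x.2
    have : A x = A.closure ⟨x, hx⟩ := A.le_closure.2 rfl
    rw [this]
    exact Submodule.inner_left_of_mem_orthogonal (K := LinearMap.range R) ⟨⟨x, hx⟩, rfl⟩ hu
  rw [LinearPMap.isSelfAdjoint_def]
  refine le_antisymm ?_ (LinearPMap.IsFormalAdjoint.le_adjoint hd' hsymm2)
  rw [← LinearPMap.le_graph_iff]
  rintro ⟨v, f⟩ hv
  obtain ⟨y, rfl, rfl⟩ := (LinearPMap.mem_graph_iff _).1 hv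
  -- Surjectivity gives `x` in the domain of the closure with the same image as `y` under "adjoint
  -- minus `1`".
  obtain ⟨x, hx⟩ : A.closure.adjoint y - (y : H) ∈ LinearMap.range R := htop ▸ Submodule.mem_top
  rw [hR] at hx
  -- By symmetry of the closure, `y - x` is orthogonal to the range of `A - 1`.
  have key : (y : H) - x = 0 := by
    refine hker _ fun z => ?_
    have h1 := LinearPMap.adjoint_isFormalAdjoint hd' y ⟨z, A.le_closure.1 z.2⟩
    have h2 : A z = A.closure ⟨z, A.le_closure.1 z.2⟩ := A.le_closure.2 rfl
    have h3 := hsymm1 x z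
    have h4 : A.closure.adjoint y = A.closure x - x + y := by rw [hx]; abel
    rw [← h2, h4] at h1
    simp only [inner_sub_left, inner_sub_right, inner_add_left] at h1 h3 ⊢
    rw [← h1, ← h3]
    ring
  have hyx : (y : H) = x := sub_eq_zero.1 key
  have : A.closure.adjoint y = A.closure x := by
    rw [hyx] at hx
    exact (sub_left_injective hx).symm
  rw [this, hyx]
  exact LinearPMap.mem_graph _ x

end Abstract

/-! ### The ordinary differential equation `(x^{-α} u')' = x^{-α} (1 + κ x^{2α}) u` -/

section ODE

/-- `x ^ (-s)` with `s = (1 - α) / 2` fails to be in `L²(x^{-α} dx)` both at `0` and at `∞`. -/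
theorem rpow_mul_sq_eq_inv (α : ℝ) {x : ℝ} (hx : 0 < x) :
    x ^ (-α) * (x ^ (-((1 - α) / 2))) ^ 2 = x⁻¹ := by
  rw [← Real.rpow_natCast, ← Real.rpow_mul hx.le, ← Real.rpow_add hx, ← Real.rpow_neg_one]
  congr 1
  push_cast
  ring

/-- Squaring the lower bound and inserting the weight leaves a multiple of `x⁻¹`. This serves both
at `0` and at `∞`, where `x⁻¹` is not integrable. -/
theorem not_integrableOn_of_lower_bound {α c : ℝ} {u : ℝ → ℝ} {S : Set ℝ} (hS : S ⊆ Ioi 0)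
    (hSm : MeasurableSet S) (hc : 0 < c) (hlow : ∀ x ∈ S, c * x ^ (-((1 - α) / 2)) ≤ u x)
    (hinv : ¬ IntegrableOn (fun x : ℝ => x⁻¹) S) :
    ¬ IntegrableOn (fun x => x ^ (-α) * u x ^ 2) S := by
  intro h
  apply hinv
  have h2 : IntegrableOn (fun x => (c ^ 2)⁻¹ * (x ^ (-α) * u x ^ 2)) S := h.const_mul _
  refine Integrable.mono' h2 measurable_inv.aestronglyMeasurable ?_
  filter_upwards [ae_restrict_mem hSm] with x hx
  have hx0 : 0 < x := hS hx
  have hp : 0 < x ^ (-α) := Real.rpow_pos_of_pos hx0 _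
  have hs : 0 < x ^ (-((1 - α) / 2)) := Real.rpow_pos_of_pos hx0 _
  rw [Real.norm_of_nonneg (inv_nonneg.2 hx0.le), ← rpow_mul_sq_eq_inv α hx0,
    inv_mul_eq_div, le_div_iff₀ (by positivity)]
  have h3 : (c * x ^ (-((1 - α) / 2))) ^ 2 ≤ u x ^ 2 :=
    pow_le_pow_left₀ (by positivity) (hlow x hx) 2
  nlinarith

variable {α κ : ℝ} {u U : ℝ → ℝ}

/-- Sturm comparison of a positive solution with `x ^ (-s) + B`: the Wronskian increases. -/
theorem wronskian_monotoneOn {S : Set ℝ} (hS : S ⊆ Ioi 0) (hSc : Convex ℝ S) (B : ℝ) (hB : 0 ≤ B)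
    (hu : ∀ x > 0, HasDerivAt u (x ^ α * U x) x)
    (hU : ∀ x > 0, HasDerivAt U (x ^ (-α) * (1 + κ * x ^ (2 * α)) * u x) x)
    (hpos : ∀ x ∈ S, 0 < u x)
    (hκ : 0 ≤ κ)
    (hc : ∀ x ∈ S, 1 - ((α + 1) / 2) ^ 2 ≤ x ^ 2 * (1 + κ * x ^ (2 * α))) :
    MonotoneOn (fun x => U x * (x ^ (-((1 - α) / 2)) + B)
      - u x * (-((1 - α) / 2) * x ^ (-(α + 3) / 2))) S := by
  -- With `s = (1 - α) / 2` and `v = x^{-s}`, the momentum `x^{-α} v'` is `-s x^{-(α+3)/2}` and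
  -- `(x^{-α} v')' = (1 - ((α+1)/2)²) x^{-α-2} v`. In the derivative of the Wronskian the products
  -- of the two first derivatives cancel.
  have hd : ∀ x ∈ S, HasDerivAt (fun x => U x * (x ^ (-((1 - α) / 2)) + B)
      - u x * (-((1 - α) / 2) * x ^ (-(α + 3) / 2)))
      (u x * (x ^ (-α) * (1 + κ * x ^ (2 * α)) * (x ^ (-((1 - α) / 2)) + B)
        - (1 - ((α + 1) / 2) ^ 2) * x ^ (-(α + 5) / 2))) x := by
    intro x hx
    have hx0 : 0 < x := hS hx
    have h1 := ((Real.hasDerivAt_rpow_const (p := -((1 - α) / 2)) (Or.inl hx0.ne')).add_const B)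
    have h2 := (Real.hasDerivAt_rpow_const (p := -(α + 3) / 2) (Or.inl hx0.ne')).const_mul
      (-((1 - α) / 2))
    refine (((hU x hx0).mul h1).sub ((hu x hx0).mul h2)).congr_deriv ?_
    have e1 : x ^ (-((1 - α) / 2) - 1) = x ^ α * x ^ (-(α + 3) / 2) := by
      rw [← Real.rpow_add hx0]; congr 1; ring
    have e2 : x ^ (-(α + 3) / 2 - 1) = x ^ (-(α + 5) / 2) := by
      congr 1; ring
    rw [e1, e2]
    ring
  refine monotoneOn_of_hasDerivWithinAt_nonneg hSc
    (fun x hx => (hd x hx).continuousAt.continuousWithinAt)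
    (fun x hx => (hd x (interior_subset hx)).hasDerivWithinAt) ?_
  intro x hx
  replace hx := interior_subset hx
  have hx0 : 0 < x := hS hx
  refine mul_nonneg (hpos x hx).le (sub_nonneg.2 ?_)
  have e3 : x ^ (-α) * x ^ (-((1 - α) / 2)) = x ^ (2 : ℕ) * x ^ (-(α + 5) / 2) := by
    rw [← Real.rpow_natCast, ← Real.rpow_add hx0, ← Real.rpow_add hx0]; congr 1; push_cast; ring
  have p1 : 0 < x ^ (-(α + 5) / 2) := Real.rpow_pos_of_pos hx0 _
  have p2 : 0 < x ^ (-α) := Real.rpow_pos_of_pos hx0 _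
  have p3 : 0 < x ^ (2 * α) := Real.rpow_pos_of_pos hx0 _
  -- The hypothesis `hc` handles `B = 0`; the extra term is nonnegative because `B` and the
  -- potential are.
  have h4 := mul_le_mul_of_nonneg_right (hc x hx) p1.le
  have h5 : 0 ≤ x ^ (-α) * (1 + κ * x ^ (2 * α)) * B := by positivity
  calc (1 - ((α + 1) / 2) ^ 2) * x ^ (-(α + 5) / 2)
      ≤ x ^ 2 * (1 + κ * x ^ (2 * α)) * x ^ (-(α + 5) / 2) := h4
    _ = (1 + κ * x ^ (2 * α)) * (x ^ (-α) * x ^ (-((1 - α) / 2))) := by rw [e3]; ring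
    _ ≤ _ := by linarith

/-- The numerator is `x^α` times the Wronskian above, so the sign of the Wronskian decides whether
the quotient increases or decreases. -/
theorem hasDerivAt_div_comparison {B x : ℝ} (hB : 0 ≤ B) (hx : 0 < x)
    (hu : HasDerivAt u (x ^ α * U x) x) :
    HasDerivAt (fun x => u x / (x ^ (-((1 - α) / 2)) + B))
      (x ^ α * (U x * (x ^ (-((1 - α) / 2)) + B) - u x * (-((1 - α) / 2) * x ^ (-(α + 3) / 2)))
        / (x ^ (-((1 - α) / 2)) + B) ^ 2) x := by
  have hv : 0 < x ^ (-((1 - α) / 2)) := Real.rpow_pos_of_pos hx _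
  have h1 := ((Real.hasDerivAt_rpow_const (p := -((1 - α) / 2)) (Or.inl hx.ne')).add_const B)
  refine (hu.div h1 (by positivity)).congr_deriv ?_
  have e1 : x ^ (-((1 - α) / 2) - 1) = x ^ α * x ^ (-(α + 3) / 2) := by
    rw [← Real.rpow_add hx]; congr 1; ring
  rw [e1]
  congr 1
  ring

/-- A solution which is positive and increasing is not square integrable at infinity. -/
theorem not_integrableOn_Ici_of_pos {a : ℝ} (ha : 1 ≤ a) (hκ : 0 ≤ κ)
    (hu : ∀ x > 0, HasDerivAt u (x ^ α * U x) x)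
    (hU : ∀ x > 0, HasDerivAt U (x ^ (-α) * (1 + κ * x ^ (2 * α)) * u x) x)
    (hpos : ∀ x ∈ Ici a, 0 < u x) (hUa : 0 < U a) :
    ¬ IntegrableOn (fun x => x ^ (-α) * u x ^ 2) (Ici a) := by
  have ha0 : 0 < a := by linarith
  have hS : Ici a ⊆ Ioi 0 := fun x hx => lt_of_lt_of_le ha0 hx
  set s := (1 - α) / 2 with hs
  set V := -s * a ^ (-(α + 3) / 2) with hV
  -- `B` is taken so large that the Wronskian is nonnegative at `a`; this is possible because `U a >
  -- 0`. By monotonicity it stays nonnegative on `[a, ∞)`.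
  obtain ⟨B, hB0, hB⟩ : ∃ B : ℝ, 0 ≤ B ∧ u a * V ≤ U a * B := by
    refine ⟨max 0 (u a * V / U a), le_max_left _ _, ?_⟩
    have := le_max_right 0 (u a * V / U a)
    rw [div_le_iff₀ hUa] at this
    linarith
  have hv : ∀ x ∈ Ici a, 0 < x ^ (-s) := fun x hx => Real.rpow_pos_of_pos (hS hx) _
  have hc : ∀ x ∈ Ici a, 1 - ((α + 1) / 2) ^ 2 ≤ x ^ 2 * (1 + κ * x ^ (2 * α)) := by
    intro x hx
    have h1 : 1 ≤ x := ha.trans hx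
    -- For `x ≥ 1` the term `x²` alone already dominates `1 - ((α+1)/2)²`.
    have h2 : 0 ≤ κ * x ^ (2 * α) := mul_nonneg hκ (Real.rpow_nonneg (by linarith) _)
    nlinarith [sq_nonneg ((α + 1) / 2)]
  have hW := wronskian_monotoneOn hS (convex_Ici a) B hB0 hu hU hpos hκ hc
  have hmono : MonotoneOn (fun x => u x / (x ^ (-s) + B)) (Ici a) := by
    refine monotoneOn_of_hasDerivWithinAt_nonneg (convex_Ici a)
      (fun x hx => (hasDerivAt_div_comparison hB0 (hS hx)
        (hu x (hS hx))).continuousAt.continuousWithinAt)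
      (fun x hx => (hasDerivAt_div_comparison hB0 (hS (interior_subset hx))
        (hu x (hS (interior_subset hx)))).hasDerivWithinAt) ?_
    intro x hx
    replace hx := interior_subset hx
    have h1 := hW (self_mem_Ici) hx hx
    have h2 : 0 < x ^ α := Real.rpow_pos_of_pos (hS hx) _
    have h3 : 0 < a ^ (-s) := hv a self_mem_Ici
    simp only at h1
    refine div_nonneg (mul_nonneg h2.le (le_trans ?_ h1)) (sq_nonneg _)
    rw [← hs, ← hV]
    linarith [mul_pos hUa h3]
  refine not_integrableOn_of_lower_bound (c := u a / (a ^ (-s) + B)) hS measurableSet_Ici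
    (div_pos (hpos a self_mem_Ici) (by linarith [hv a self_mem_Ici])) ?_ ?_
  · intro x hx
    have h1 := hmono self_mem_Ici hx hx
    have h2 := hv x hx
    simp only at h1
    rw [le_div_iff₀ (by linarith)] at h1
    have h3 : 0 < u a / (a ^ (-s) + B) :=
      div_pos (hpos a self_mem_Ici) (by linarith [hv a self_mem_Ici])
    nlinarith
  · rw [integrableOn_Ici_iff_integrableOn_Ioi]
    exact not_integrableOn_Ioi_inv

/-- A solution which is positive and decreasing near `0` is not square integrable at `0`. -/
theorem not_integrableOn_Ioc_of_pos {a : ℝ} (ha0 : 0 < a) (ha : a ≤ 1) (hκ : 0 ≤ κ)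
    (hα : α ≤ -3 ∨ 1 ≤ α ∨ (α ≤ -1 ∧ 1 ≤ κ))
    (hu : ∀ x > 0, HasDerivAt u (x ^ α * U x) x)
    (hU : ∀ x > 0, HasDerivAt U (x ^ (-α) * (1 + κ * x ^ (2 * α)) * u x) x)
    (hpos : ∀ x ∈ Ioc 0 a, 0 < u x) (hUa : U a < 0) :
    ¬ IntegrableOn (fun x => x ^ (-α) * u x ^ 2) (Ioc 0 a) := by
  have hS : Ioc 0 a ⊆ Ioi 0 := fun x hx => hx.1
  have haS : a ∈ Ioc 0 a := ⟨ha0, le_rfl⟩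
  set s := (1 - α) / 2 with hs
  set V := -s * a ^ (-(α + 3) / 2) with hV
  -- Mirror choice: since `U a < 0`, a large `B` makes the Wronskian nonpositive at `a`, hence on
  -- all of `(0, a]`.
  obtain ⟨B, hB0, hB⟩ : ∃ B : ℝ, 0 ≤ B ∧ U a * B ≤ u a * V := by
    refine ⟨max 0 (u a * V / U a), le_max_left _ _, ?_⟩
    have := le_max_right 0 (u a * V / U a)
    rw [div_le_iff_of_neg hUa] at this
    linarith
  have hv : ∀ x ∈ Ioc 0 a, 0 < x ^ (-s) := fun x hx => Real.rpow_pos_of_pos (hS hx) _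
  have hc : ∀ x ∈ Ioc 0 a, 1 - ((α + 1) / 2) ^ 2 ≤ x ^ 2 * (1 + κ * x ^ (2 * α)) := by
    intro x hx
    have hx0 : 0 < x := hx.1
    have hp : 0 < x ^ (2 * α) := Real.rpow_pos_of_pos hx0 _
    -- For `α ≤ -3` or `α ≥ 1` the left side is nonpositive, since `((α+1)/2)² ≥ 1`. For `α ≤ -1 ≤ 1
    -- ≤ κ` the potential term is `κ x^{2+2α} ≥ 1` on `(0, 1]`.
    rcases hα with h | h | ⟨h, hk⟩
    · have : 0 ≤ x ^ 2 * (1 + κ * x ^ (2 * α)) := by positivity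
      nlinarith
    · have : 0 ≤ x ^ 2 * (1 + κ * x ^ (2 * α)) := by positivity
      nlinarith
    · have h1 : 1 ≤ x ^ 2 * x ^ (2 * α) := by
        rw [← Real.rpow_natCast, ← Real.rpow_add hx0]
        exact Real.one_le_rpow_of_pos_of_le_one_of_nonpos hx0 (hx.2.trans ha)
          (by push_cast; linarith)
      have h2 : x ^ 2 * x ^ (2 * α) ≤ κ * (x ^ 2 * x ^ (2 * α)) :=
        le_mul_of_one_le_left (by positivity) hk
      nlinarith [sq_nonneg ((α + 1) / 2), sq_nonneg x]
  have hW := wronskian_monotoneOn hS (convex_Ioc 0 a) B hB0 hu hU hpos hκ hc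
  have hanti : AntitoneOn (fun x => u x / (x ^ (-s) + B)) (Ioc 0 a) := by
    refine antitoneOn_of_hasDerivWithinAt_nonpos (convex_Ioc 0 a)
      (fun x hx => (hasDerivAt_div_comparison hB0 (hS hx)
        (hu x (hS hx))).continuousAt.continuousWithinAt)
      (fun x hx => (hasDerivAt_div_comparison hB0 (hS (interior_subset hx))
        (hu x (hS (interior_subset hx)))).hasDerivWithinAt) ?_
    intro x hx
    replace hx := interior_subset hx
    have h1 := hW hx haS hx.2
    have h2 : 0 < x ^ α := Real.rpow_pos_of_pos (hS hx) _
    have h3 : 0 < a ^ (-s) := hv a haS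
    simp only at h1
    refine div_nonpos_of_nonpos_of_nonneg
      (mul_nonpos_of_nonneg_of_nonpos h2.le (le_trans h1 ?_)) (sq_nonneg _)
    rw [← hs, ← hV]
    linarith [mul_neg_of_neg_of_pos hUa h3]
  refine not_integrableOn_of_lower_bound (c := u a / (a ^ (-s) + B)) hS measurableSet_Ioc
    (div_pos (hpos a haS) (by linarith [hv a haS])) ?_ ?_
  · intro x hx
    have h1 := hanti hx haS hx.2
    have h2 := hv x hx
    simp only at h1
    rw [le_div_iff₀ (by linarith)] at h1
    have h3 : 0 < u a / (a ^ (-s) + B) :=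
      div_pos (hpos a haS) (by linarith [hv a haS])
    nlinarith
  · intro h
    have h1 : IntervalIntegrable (fun x : ℝ => x⁻¹) volume 0 a :=
      (intervalIntegrable_iff_integrableOn_Ioc_of_le ha0.le).2 h
    rw [intervalIntegrable_inv_iff] at h1
    rcases h1 with h1 | h1
    · exact ha0.ne h1
    · exact h1 left_mem_uIcc

theorem pos_of_ne_zero_of_preconnected {S : Set ℝ} {w : ℝ → ℝ} (hS : IsPreconnected S)
    (hw : ContinuousOn w S) (h0 : ∀ x ∈ S, w x ≠ 0) {a : ℝ} (ha : a ∈ S) (hpos : 0 < w a) :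
    ∀ x ∈ S, 0 < w x := by
  intro x hx
  by_contra! h
  obtain ⟨y, hy, hy0⟩ := hS.intermediate_value hx ha hw ⟨h, hpos.le⟩
  exact h0 y hy hy0

/-- The limit-point criterion: `(x^{-α} u')' = x^{-α} (1 + κ x^{2α}) u` has no nontrivial solution
in `L²((0, ∞), x^{-α} dx)`. -/
theorem ode_eq_zero (hκ : 0 ≤ κ) (hα : α ≤ -3 ∨ 1 ≤ α ∨ (α ≤ -1 ∧ 1 ≤ κ))
    (hu : ∀ x > 0, HasDerivAt u (x ^ α * U x) x)
    (hU : ∀ x > 0, HasDerivAt U (x ^ (-α) * (1 + κ * x ^ (2 * α)) * u x) x)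
    (hint : IntegrableOn (fun x => x ^ (-α) * u x ^ 2) (Ioi 0)) : ∀ x > 0, u x = 0 := by
  -- `(u U)'` is a sum of two nonnegative terms, so `u U` is increasing. If it is positive
  -- somewhere, it stays so to the right; if negative, it stays so to the left. Both are excluded
  -- below.
  have hm : ∀ x > 0, HasDerivAt (fun x => u x * U x)
      (x ^ α * U x ^ 2 + x ^ (-α) * (1 + κ * x ^ (2 * α)) * u x ^ 2) x := fun x hx =>
    ((hu x hx).mul (hU x hx)).congr_deriv (by ring)
  have hmono : MonotoneOn (fun x => u x * U x) (Ioi 0) := by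
    refine monotoneOn_of_hasDerivWithinAt_nonneg (convex_Ioi 0)
      (fun x hx => (hm x hx).continuousAt.continuousWithinAt)
      (fun x hx => (hm x (interior_subset hx)).hasDerivWithinAt) fun x hx => ?_
    have hx0 : 0 < x := interior_subset hx
    positivity
  have hnonpos : ∀ x > 0, u x * U x ≤ 0 := by
    intro a ha
    by_contra! hpos
    set b := max a 1
    have hb : 1 ≤ b := le_max_right _ _
    have hS : Ici b ⊆ Ioi 0 := fun x (hx : b ≤ x) => show 0 < x by linarith
    have h0 : ∀ x ∈ Ici b, 0 < u x * U x := fun x hx =>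
      hpos.trans_le (hmono ha (hS hx) ((le_max_left a 1).trans hx))
    have hne : ∀ x ∈ Ici b, u x ≠ 0 := fun x hx h => by have := h0 x hx; simp [h] at this
    have hcont : ContinuousOn u (Ici b) := fun x hx =>
      (hu x (hS hx)).continuousAt.continuousWithinAt
    have hi := hint.mono_set hS
    -- The equation is linear: a negative solution is replaced by its opposite.
    rcases lt_or_gt_of_ne (hne b self_mem_Ici) with h | h
    · have h1 := pos_of_ne_zero_of_preconnected (w := fun x => -u x) isPreconnected_Ici hcont.neg
        (fun x hx => neg_ne_zero.2 (hne x hx)) self_mem_Ici (by simpa using h)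
      refine not_integrableOn_Ici_of_pos (u := fun x => -u x) (U := fun x => -U x) hb hκ
        (fun x hx => (hu x hx).neg.congr_deriv (by ring))
        (fun x hx => (hU x hx).neg.congr_deriv (by ring)) h1 ?_ (by simpa using hi)
      have := h0 b self_mem_Ici
      nlinarith
    · have h1 := pos_of_ne_zero_of_preconnected isPreconnected_Ici hcont hne self_mem_Ici h
      refine not_integrableOn_Ici_of_pos hb hκ hu hU h1 ?_ hi
      exact pos_of_mul_pos_right (h0 b self_mem_Ici) h.le
  have hnonneg : ∀ x > 0, 0 ≤ u x * U x := by
    intro a ha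
    by_contra! hneg
    set b := min a 1
    have hb : b ≤ 1 := min_le_right _ _
    have hb0 : 0 < b := lt_min ha one_pos
    have hS : Ioc 0 b ⊆ Ioi 0 := fun x hx => hx.1
    have hbS : b ∈ Ioc 0 b := ⟨hb0, le_rfl⟩
    have h0 : ∀ x ∈ Ioc 0 b, u x * U x < 0 := fun x hx =>
      (hmono (hS hx) ha (hx.2.trans (min_le_left a 1))).trans_lt hneg
    have hne : ∀ x ∈ Ioc 0 b, u x ≠ 0 := fun x hx h => by have := h0 x hx; simp [h] at this
    have hcont : ContinuousOn u (Ioc 0 b) := fun x hx =>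
      (hu x (hS hx)).continuousAt.continuousWithinAt
    have hi := hint.mono_set hS
    have hbm := h0 b hbS
    rcases lt_or_gt_of_ne (hne b hbS) with h | h
    · have h1 := pos_of_ne_zero_of_preconnected (w := fun x => -u x) isPreconnected_Ioc hcont.neg
        (fun x hx => neg_ne_zero.2 (hne x hx)) hbS (by simpa using h)
      refine not_integrableOn_Ioc_of_pos (u := fun x => -u x) (U := fun x => -U x) hb0 hb hκ hα
        (fun x hx => (hu x hx).neg.congr_deriv (by ring))
        (fun x hx => (hU x hx).neg.congr_deriv (by ring)) h1 ?_ (by simpa using hi)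
      nlinarith
    · have h1 := pos_of_ne_zero_of_preconnected isPreconnected_Ioc hcont hne hbS h
      refine not_integrableOn_Ioc_of_pos hb0 hb hκ hα hu hU h1 ?_ hi
      nlinarith
  intro x hx
  -- With `u U = 0` identically, its derivative vanishes too, and so does the term in `u²`, whose
  -- coefficient is positive.
  have hzero : ∀ y > 0, u y * U y = 0 := fun y hy => le_antisymm (hnonpos y hy) (hnonneg y hy)
  have h1 : HasDerivAt (fun x => u x * U x) 0 x :=
    (hasDerivAt_const x (0 : ℝ)).congr_of_eventuallyEq
      ((eventually_gt_nhds hx).mono fun y hy => hzero y hy)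
  have h2 := (hm x hx).unique h1
  have p1 : 0 < x ^ α := Real.rpow_pos_of_pos hx _
  have p2 : 0 < x ^ (-α) * (1 + κ * x ^ (2 * α)) := by
    have := Real.rpow_pos_of_pos hx (2 * α)
    have := Real.rpow_pos_of_pos hx (-α)
    positivity
  have h3 : x ^ (-α) * (1 + κ * x ^ (2 * α)) * u x ^ 2 = 0 := by
    have a1 : 0 ≤ x ^ α * U x ^ 2 := by positivity
    have a2 : 0 ≤ x ^ (-α) * (1 + κ * x ^ (2 * α)) * u x ^ 2 := by positivity
    linarith
  have := (mul_eq_zero.1 h3).resolve_left p2.ne'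
  exact pow_eq_zero_iff (two_ne_zero) |>.1 this

end ODE

/-! ### Weak solutions on the half-line are classical -/

section Regularity

/-- Real test functions on the open half-line `(0, ∞)`, extended by zero. -/
structure HalfLineTest (φ : ℝ → ℝ) : Prop where
  contDiff : ContDiff ℝ ∞ φ
  hasCompactSupport : HasCompactSupport φ
  tsupport_subset : tsupport φ ⊆ Ioi 0

/-- The interval is made to contain `1` because the primitives below start from the base point `1`.
-/
theorem exists_Icc_of_isCompact_subset_Ioi {K : Set ℝ} (hK : IsCompact K) (h0 : K ⊆ Ioi 0) :
    ∃ a b : ℝ, 0 < a ∧ a < 1 ∧ 1 < b ∧ K ⊆ Ioo a b := by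
  rcases K.eq_empty_or_nonempty with rfl | hne
  · exact ⟨1 / 2, 2, by norm_num, by norm_num, by norm_num, empty_subset _⟩
  · have hI := hK.sInf_mem hne
    refine ⟨min (sInf K) 1 / 2, max (sSup K) 1 + 1, ?_, ?_, ?_, fun x hx => ⟨?_, ?_⟩⟩
    · have : 0 < sInf K := h0 hI
      positivity
    · have := min_le_right (sInf K) 1
      linarith
    · have := le_max_right (sSup K) 1
      linarith
    · have h1 : sInf K ≤ x := csInf_le hK.bddBelow hx
      have h2 : 0 < sInf K := h0 hI
      have h3 : 0 < min (sInf K) 1 := by positivity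
      linarith [min_le_left (sInf K) 1]
    · have h1 : x ≤ sSup K := le_csSup hK.bddAbove hx
      linarith [le_max_left (sSup K) 1]

namespace HalfLineTest

variable {φ ψ : ℝ → ℝ}

theorem exists_Icc (hφ : HalfLineTest φ) :
    ∃ a b : ℝ, 0 < a ∧ a < 1 ∧ 1 < b ∧ tsupport φ ⊆ Ioo a b :=
  exists_Icc_of_isCompact_subset_Ioi hφ.hasCompactSupport hφ.tsupport_subset

theorem deriv (hφ : HalfLineTest φ) : HalfLineTest (deriv φ) :=
  ⟨(contDiff_infty_iff_deriv.1 hφ.contDiff).2, hφ.hasCompactSupport.deriv,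
    tsupport_deriv_subset.trans hφ.tsupport_subset⟩

theorem hasDerivAt (hφ : HalfLineTest φ) (x : ℝ) : HasDerivAt φ (_root_.deriv φ x) x :=
  (hφ.contDiff.differentiable (by simp) x).hasDerivAt

/-- The factor need only be smooth on `(0, ∞)`, as powers of `x` are: elsewhere the product vanishes
locally. -/
theorem mul (hφ : HalfLineTest φ) {f : ℝ → ℝ} (hf : ContDiffOn ℝ ∞ f (Ioi 0)) :
    HalfLineTest (fun x => f x * φ x) := by
  have hs : tsupport (fun x => f x * φ x) ⊆ tsupport φ := tsupport_mul_subset_right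
  refine ⟨?_, hφ.hasCompactSupport.mul_left, hs.trans hφ.tsupport_subset⟩
  rw [contDiff_iff_contDiffAt]
  intro x
  by_cases hx : x ∈ tsupport φ
  · exact (hf.contDiffAt (Ioi_mem_nhds (hφ.tsupport_subset hx))).mul hφ.contDiff.contDiffAt
  · have : (fun x => f x * φ x) =ᶠ[𝓝 x] fun _ => 0 :=
      notMem_tsupport_iff_eventuallyEq.1 fun h => hx (hs h)
    exact contDiffAt_const.congr_of_eventuallyEq this

theorem sub_const_mul (hφ : HalfLineTest φ) (hψ : HalfLineTest ψ) (c : ℝ) :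
    HalfLineTest (fun x => φ x - c * ψ x) := by
  have hs : tsupport (fun x => φ x - c * ψ x) ⊆ tsupport φ ∪ tsupport ψ := by
    refine closure_minimal (fun x hx => ?_) ((isClosed_tsupport _).union (isClosed_tsupport _))
    by_contra h
    rw [mem_union, not_or] at h
    exact hx (by simp [image_eq_zero_of_notMem_tsupport h.1, image_eq_zero_of_notMem_tsupport h.2])
  refine ⟨hφ.contDiff.sub (contDiff_const.mul hψ.contDiff), ?_,
    hs.trans (union_subset hφ.tsupport_subset hψ.tsupport_subset)⟩
  exact (hφ.hasCompactSupport.isCompact.union hψ.hasCompactSupport.isCompact).of_isClosed_subset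
    (isClosed_tsupport _) hs

theorem exists_integral_eq_one : ∃ φ : ℝ → ℝ, HalfLineTest φ ∧ ∫ x, φ x = 1 := by
  let f : ContDiffBump (1 : ℝ) := ⟨1 / 4, 1 / 2, by norm_num, by norm_num⟩
  refine ⟨f.normed volume, ⟨f.contDiff_normed, f.hasCompactSupport_normed, ?_⟩, f.integral_normed⟩
  rw [f.tsupport_normed_eq]
  intro x hx
  rw [Real.closedBall_eq_Icc] at hx
  have h1 : (1 : ℝ) - 1 / 2 ≤ x := hx.1
  exact lt_of_lt_of_le (by norm_num) h1

theorem integrable_mul (hφ : HalfLineTest φ) {w : ℝ → ℝ} (hw : LocallyIntegrableOn w (Ioi 0)) :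
    Integrable (fun x => w x * φ x) := by
  have h1 : IntegrableOn (fun x => w x * φ x) (tsupport φ) :=
    (hw.integrableOn_compact_subset hφ.tsupport_subset
      hφ.hasCompactSupport).mul_continuousOn hφ.contDiff.continuous.continuousOn
      hφ.hasCompactSupport
  refine (integrableOn_iff_integrable_of_support_subset ?_).1 h1
  exact (Function.support_mul_subset_right _ _).trans (subset_tsupport φ)

theorem intervalIntegral_eq {f : ℝ → ℝ} {a b : ℝ} (hf : ∀ x, x ∉ Ioo a b → f x = 0) :
    ∫ x in a..b, f x = ∫ x, f x := by
  refine intervalIntegral.integral_eq_integral_of_support_subset fun x hx => ?_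
  by_contra h
  exact hx (hf x fun h' => h ⟨h'.1, h'.2.le⟩)

/-- A test function of integral zero is the derivative of a test function. -/
theorem exists_deriv_eq (hφ : HalfLineTest φ) (h0 : ∫ x, φ x = 0) :
    ∃ Φ : ℝ → ℝ, HalfLineTest Φ ∧ _root_.deriv Φ = φ := by
  have hc := hφ.contDiff.continuous
  have hd : ∀ x, HasDerivAt (fun x => ∫ t in (0 : ℝ)..x, φ t) (φ x) x := fun x =>
    intervalIntegral.integral_hasDerivAt_right (hc.intervalIntegrable _ _)
      (hc.stronglyMeasurableAtFilter _ _) hc.continuousAt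
  have hderiv : _root_.deriv (fun x => ∫ t in (0 : ℝ)..x, φ t) = φ := funext fun x => (hd x).deriv
  obtain ⟨a, b, ha, ha1, hb1, hab⟩ := hφ.exists_Icc
  have hz : ∀ x, x ∉ Ioo a b → φ x = 0 := fun x hx =>
    image_eq_zero_of_notMem_tsupport fun h => hx (hab h)
  have hs : Function.support (fun x => ∫ t in (0 : ℝ)..x, φ t) ⊆ Icc a b := by
    intro x hx
    by_contra h
    rw [mem_Icc, not_and_or, not_le, not_le] at h
    apply hx
    -- To the left of the support the integrand is zero; to the right the primitive is the total
    -- integral, zero by `h0`.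
    rcases h with h | h
    · refine (intervalIntegral.integral_congr (g := fun _ => (0 : ℝ)) fun t ht => ?_).trans (by simp)
      refine hz t fun h' => ?_
      have : t ≤ max 0 x := ht.2
      have : max 0 x < a := max_lt ha h
      linarith [h'.1]
    · refine Eq.trans ?_ h0
      refine intervalIntegral_eq fun t ht => hz t fun h' => ht ⟨ha.trans h'.1, h'.2.trans h⟩
  have hts : tsupport (fun x => ∫ t in (0 : ℝ)..x, φ t) ⊆ Icc a b :=
    closure_minimal hs isClosed_Icc
  refine ⟨_, ⟨?_, isCompact_Icc.of_isClosed_subset (isClosed_tsupport _) hts,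
    hts.trans fun x hx => lt_of_lt_of_le ha hx.1⟩, hderiv⟩
  rw [contDiff_infty_iff_deriv, hderiv]
  exact ⟨fun x => (hd x).differentiableAt, hφ.contDiff⟩

end HalfLineTest

/-- The lemma of du Bois-Reymond on the half-line. -/
theorem ae_eq_const_of_integral_mul_deriv_eq_zero {w : ℝ → ℝ} (hw : LocallyIntegrableOn w (Ioi 0))
    (h : ∀ φ, HalfLineTest φ → ∫ x, w x * deriv φ x = 0) :
    ∃ c : ℝ, ∀ᵐ x, x ∈ Ioi (0 : ℝ) → w x = c := by
  obtain ⟨η, hη, hη1⟩ := HalfLineTest.exists_integral_eq_one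
  set c := ∫ x, w x * η x
  refine ⟨c, ?_⟩
  have hwc : LocallyIntegrableOn (fun x => w x - c) (Ioi 0) :=
    hw.sub ((locallyIntegrable_const c).locallyIntegrableOn _)
  have := isOpen_Ioi.ae_eq_zero_of_integral_contDiff_smul_eq_zero hwc fun g hg1 hg2 hg3 => by
    have hg : HalfLineTest g := ⟨hg1, hg2, hg3⟩
    have hgi : Integrable g := hg1.continuous.integrable_of_hasCompactSupport hg2
    have hηi : Integrable η := hη.contDiff.continuous.integrable_of_hasCompactSupport
      hη.hasCompactSupport
    -- Subtracting the right multiple of `η` gives integral zero, so the difference is the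
    -- derivative of a test function and `h` applies.
    have h1 := hg.sub_const_mul hη (∫ x, g x)
    have h2 : ∫ x, (g x - (∫ x, g x) * η x) = 0 := by
      rw [integral_sub hgi (hηi.const_mul _), integral_const_mul, hη1, mul_one, sub_self]
    obtain ⟨Φ, hΦ, hΦ'⟩ := h1.exists_deriv_eq h2
    have h3 := h Φ hΦ
    rw [hΦ'] at h3
    have h4 : (fun x => w x * (g x - (∫ x, g x) * η x))
        = fun x => w x * g x - (∫ x, g x) * (w x * η x) := by funext x; ring
    rw [h4, integral_sub (hg.integrable_mul hw) ((hη.integrable_mul hw).const_mul _),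
      integral_const_mul] at h3
    have h5 : (fun x => g x • (w x - c)) = fun x => w x * g x - c * g x := by
      funext x; rw [smul_eq_mul]; ring
    rw [h5, integral_sub (hg.integrable_mul hw) (hgi.const_mul _), integral_const_mul]
    linarith
  filter_upwards [this] with x hx hx0
  exact sub_eq_zero.1 (hx hx0)

theorem contDiffOn_rpow_Ioi (α : ℝ) : ContDiffOn ℝ ∞ (fun x : ℝ => x ^ α) (Ioi 0) := fun _ hx =>
  (Real.contDiffAt_rpow_const_of_ne (ne_of_gt hx)).contDiffWithinAt

theorem intervalIntegrable_of_locallyIntegrableOn_Ioi {g : ℝ → ℝ}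
    (hg : LocallyIntegrableOn g (Ioi 0)) {a b : ℝ} (ha : 0 < a) (hb : 0 < b) :
    IntervalIntegrable g volume a b :=
  (hg.integrableOn_compact_subset (fun _ hx => lt_of_lt_of_le (lt_min ha hb) hx.1)
    isCompact_uIcc).intervalIntegrable

theorem hasDerivAt_integral_of_continuousOn_Ioi {g : ℝ → ℝ} (hg : ContinuousOn g (Ioi 0)) {x : ℝ}
    (hx : 0 < x) : HasDerivAt (fun x => ∫ t in (1 : ℝ)..x, g t) (g x) x :=
  intervalIntegral.integral_hasDerivAt_right
    (intervalIntegrable_of_locallyIntegrableOn_Ioi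
      (hg.locallyIntegrableOn measurableSet_Ioi) one_pos hx)
    (hg.stronglyMeasurableAtFilter isOpen_Ioi x hx) (hg.continuousAt (Ioi_mem_nhds hx))

/-- Integration by parts against a test function, for the primitive of a locally integrable
function. -/
theorem integral_mul_test_eq_neg {g φ : ℝ → ℝ} (hg : LocallyIntegrableOn g (Ioi 0))
    (hφ : HalfLineTest φ) :
    ∫ x, g x * φ x = - ∫ x, (∫ t in (1 : ℝ)..x, g t) * deriv φ x := by
  obtain ⟨a, b, ha, ha1, hb1, hab⟩ := hφ.exists_Icc
  have hz : ∀ x, x ∉ Ioo a b → φ x = 0 := fun x hx =>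
    image_eq_zero_of_notMem_tsupport fun h => hx (hab h)
  have hz' : ∀ x, x ∉ Ioo a b → deriv φ x = 0 := fun x hx =>
    image_eq_zero_of_notMem_tsupport fun h => hx (hab (tsupport_deriv_subset h))
  have hgi := intervalIntegrable_of_locallyIntegrableOn_Ioi hg ha (by linarith : 0 < b)
  have h1 : (1 : ℝ) ∈ uIcc a b := by rw [uIcc_of_le (by linarith)]; exact ⟨ha1.le, hb1.le⟩
  -- `g` is only locally integrable, so its primitive is merely absolutely continuous; integration
  -- by parts is used in that class.
  have hG := hgi.absolutelyContinuousOnInterval_intervalIntegral h1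
  have hφa : AbsolutelyContinuousOnInterval φ a b :=
    (hφ.contDiff.of_le (by simp)).contDiffOn.absolutelyContinuousOnInterval
  have key := hG.integral_mul_deriv_eq_deriv_mul hφa
  rw [hz a (by simp), hz b (by simp), mul_zero, mul_zero, sub_zero, zero_sub] at key
  rw [HalfLineTest.intervalIntegral_eq (fun x hx => by rw [hz' x hx, mul_zero])] at key
  rw [key, neg_neg, ← HalfLineTest.intervalIntegral_eq (f := fun x => g x * φ x)
    (fun x hx => by rw [hz x hx, mul_zero])]
  refine intervalIntegral.integral_congr_ae ?_
  filter_upwards [hgi.ae_hasDerivAt_integral] with x hx hxm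
  rw [(hx (uIoc_subset_uIcc hxm) 1 h1).deriv]

/-- A weak solution of `(x^{-α} u')' = q u` on `(0, ∞)` is almost everywhere equal to a classical
solution. -/
theorem exists_classical_solution {α : ℝ} {q u : ℝ → ℝ} (hq : ContinuousOn q (Ioi 0))
    (hu : LocallyIntegrableOn u (Ioi 0))
    (hweak : ∀ φ, HalfLineTest φ →
      ∫ x, u x * deriv (fun x => x ^ (-α) * deriv φ x) x = ∫ x, q x * u x * φ x) :
    ∃ v V : ℝ → ℝ, (∀ᵐ x, x ∈ Ioi (0 : ℝ) → u x = v x) ∧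
      (∀ x > 0, HasDerivAt v (x ^ α * V x) x) ∧ (∀ x > 0, HasDerivAt V (q x * v x) x) := by
  have hqu : LocallyIntegrableOn (fun x => q x * u x) (Ioi 0) :=
    hu.continuousOn_mul hq isOpen_Ioi.isLocallyClosed
  -- After moving `q u` onto its primitive `G`, the weak equation says that `u'` and `x^α G` differ
  -- by a constant multiple of `x^α`, in the sense of distributions.
  set G : ℝ → ℝ := fun x => ∫ t in (1 : ℝ)..x, q t * u t with hGdef
  have hGc : ContinuousOn G (Ioi 0) := by
    intro x hx
    have hx0 : 0 < x := hx
    have hm : 0 < min x 1 / 2 := by positivity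
    have h1 := intervalIntegrable_of_locallyIntegrableOn_Ioi hqu hm (by positivity : 0 < x + 2)
    have hle : min x 1 / 2 ≤ x + 2 := by linarith [min_le_left x 1]
    have h1m : (1 : ℝ) ∈ uIcc (min x 1 / 2) (x + 2) := by
      rw [uIcc_of_le hle]
      exact ⟨by linarith [min_le_right x 1], by linarith⟩
    have h2 := (h1.absolutelyContinuousOnInterval_intervalIntegral h1m).continuousOn
    refine (h2.continuousAt ?_).continuousWithinAt
    rw [uIcc_of_le hle]
    exact Icc_mem_nhds (by linarith [min_le_left x 1]) (by linarith)
  have hbc : ∀ β : ℝ, ContinuousOn (fun x : ℝ => x ^ β) (Ioi 0) := fun β =>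
    (contDiffOn_rpow_Ioi β).continuousOn
  have hGb : LocallyIntegrableOn (fun x => G x * x ^ α) (Ioi 0) :=
    (hGc.mul (hbc α)).locallyIntegrableOn measurableSet_Ioi
  have hrr : ∀ x > (0 : ℝ), x ^ (-α) * x ^ α = 1 := fun x hx => by
    rw [← Real.rpow_add hx, neg_add_cancel, Real.rpow_zero]
  -- test functions orthogonal to `x ^ α`
  have hstep : ∀ ψ, HalfLineTest ψ → ∫ x, x ^ α * ψ x = 0 →
      (∫ x, u x * deriv ψ x) + ∫ x, G x * x ^ α * ψ x = 0 := by
    intro ψ hψ h0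
    obtain ⟨φ, hφ, hφ'⟩ := (hψ.mul (contDiffOn_rpow_Ioi α)).exists_deriv_eq h0
    have hψe : (fun x => x ^ (-α) * deriv φ x) = ψ := by
      funext x
      rw [hφ']
      by_cases hx : x ∈ tsupport ψ
      · rw [← mul_assoc, hrr x (hψ.tsupport_subset hx), one_mul]
      · simp [image_eq_zero_of_notMem_tsupport hx]
    have h1 := hweak φ hφ
    rw [hψe, integral_mul_test_eq_neg hqu hφ, hφ'] at h1
    rw [h1]
    simp only [mul_assoc]
    exact neg_add_cancel _
  obtain ⟨η, hη, hη1⟩ := HalfLineTest.exists_integral_eq_one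
  have hψ1 := hη.mul (contDiffOn_rpow_Ioi (-α))
  -- A test function normalised by `∫ x^α ψ₁ = 1`, used to project a general test function onto
  -- those orthogonal to `x^α`.
  set ψ₁ : ℝ → ℝ := fun x => x ^ (-α) * η x with hψ₁
  have hψ11 : ∫ x, x ^ α * ψ₁ x = 1 := by
    rw [← hη1]
    congr 1
    funext x
    by_cases hx : x ∈ tsupport η
    · rw [hψ₁, ← mul_assoc, mul_comm (x ^ α), hrr x (hη.tsupport_subset hx), one_mul]
    · simp [hψ₁, image_eq_zero_of_notMem_tsupport hx]
  set C : ℝ := (∫ x, u x * deriv ψ₁ x) + ∫ x, G x * x ^ α * ψ₁ x with hC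
  have hα : LocallyIntegrableOn (fun x : ℝ => x ^ α) (Ioi 0) :=
    (hbc α).locallyIntegrableOn measurableSet_Ioi
  -- This is `u' = x^α (G - C)` in the weak sense; the du Bois-Reymond lemma then identifies `u`
  -- with a primitive of the right side, up to a constant.
  have hgen : ∀ ψ, HalfLineTest ψ →
      (∫ x, u x * deriv ψ x) = - ∫ x, (x ^ α * (G x - C)) * ψ x := by
    intro ψ hψ
    set I := ∫ x, x ^ α * ψ x with hI
    have h1 := hψ.sub_const_mul hψ1 I
    have e1 : (fun x => x ^ α * (ψ x - I * ψ₁ x))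
        = fun x => x ^ α * ψ x - I * (x ^ α * ψ₁ x) := by funext x; ring
    have h2 := hstep _ h1 (by
      rw [e1, integral_sub (hψ.integrable_mul hα) ((hψ1.integrable_mul hα).const_mul _),
        integral_const_mul, hψ11, mul_one, sub_self])
    have e2 : (fun x => u x * deriv (fun x => ψ x - I * ψ₁ x) x)
        = fun x => u x * deriv ψ x - I * (u x * deriv ψ₁ x) := by
      funext x
      rw [((hψ.hasDerivAt x).fun_sub ((hψ1.hasDerivAt x).const_mul I)).deriv]
      ring
    have e3 : (fun x => G x * x ^ α * (ψ x - I * ψ₁ x))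
        = fun x => G x * x ^ α * ψ x - I * (G x * x ^ α * ψ₁ x) := by funext x; ring
    have e4 : (fun x => (x ^ α * (G x - C)) * ψ x)
        = fun x => G x * x ^ α * ψ x - C * (x ^ α * ψ x) := by funext x; ring
    rw [e2, e3, integral_sub (hψ.deriv.integrable_mul hu)
      ((hψ1.deriv.integrable_mul hu).const_mul _), integral_const_mul,
      integral_sub (hψ.integrable_mul hGb) ((hψ1.integrable_mul hGb).const_mul _),
      integral_const_mul] at h2
    rw [e4, integral_sub (hψ.integrable_mul hGb) ((hψ.integrable_mul hα).const_mul _),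
      integral_const_mul, ← hI, hC]
    linarith
  have hFc : ContinuousOn (fun x => x ^ α * (G x - C)) (Ioi 0) :=
    (hbc α).mul (hGc.sub continuousOn_const)
  set F : ℝ → ℝ := fun x => ∫ t in (1 : ℝ)..x, t ^ α * (G t - C) with hF
  have hFd : ∀ x > 0, HasDerivAt F (x ^ α * (G x - C)) x := fun x hx =>
    hasDerivAt_integral_of_continuousOn_Ioi hFc hx
  have hFl : LocallyIntegrableOn F (Ioi 0) :=
    ContinuousOn.locallyIntegrableOn (fun x hx => (hFd x hx).continuousAt.continuousWithinAt)
      measurableSet_Ioi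
  obtain ⟨c, hc⟩ := ae_eq_const_of_integral_mul_deriv_eq_zero (hu.sub hFl) fun ψ hψ => by
    have h1 := integral_mul_test_eq_neg (hFc.locallyIntegrableOn measurableSet_Ioi) hψ
    have e : (fun x => (u - F) x * deriv ψ x) = fun x => u x * deriv ψ x - F x * deriv ψ x := by
      funext x; rw [Pi.sub_apply]; ring
    rw [e, integral_sub (hψ.deriv.integrable_mul hu) (hψ.deriv.integrable_mul hFl), hgen ψ hψ, h1]
    ring
  have hae : ∀ᵐ x, x ∈ Ioi (0 : ℝ) → u x = F x + c := by
    filter_upwards [hc] with x hx hx0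
    have := hx hx0
    rw [Pi.sub_apply] at this
    linarith
  refine ⟨fun x => F x + c, fun x => G x - C, hae, fun x hx => (hFd x hx).add_const c, ?_⟩
  intro x hx
  refine HasDerivAt.sub_const C ?_
  -- `G` is an integral of `q u`, and `u` may be replaced there by its continuous version. The
  -- integrand becomes continuous, so `G` is differentiable at every point.
  have hvc : ContinuousOn (fun x => q x * (F x + c)) (Ioi 0) :=
    hq.mul (ContinuousOn.add (fun x hx => (hFd x hx).continuousAt.continuousWithinAt)
      continuousOn_const)
  refine (hasDerivAt_integral_of_continuousOn_Ioi hvc hx).congr_of_eventuallyEq ?_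
  filter_upwards [Ioi_mem_nhds hx] with y hy
  refine intervalIntegral.integral_congr_ae ?_
  filter_upwards [hae] with t ht htm
  rw [ht]
  rw [uIoc, mem_Ioc] at htm
  exact (lt_min one_pos hy).trans htm.1

/-- On compact subsets of `(0, ∞)` the weight can be divided out, and `|u| ≤ 1 + u²`. -/
theorem locallyIntegrableOn_of_sq {α : ℝ} {u : ℝ → ℝ} (hm : AEStronglyMeasurable u volume)
    (hint : IntegrableOn (fun x => x ^ (-α) * u x ^ 2) (Ioi 0)) :
    LocallyIntegrableOn u (Ioi 0) := by
  have h1 : LocallyIntegrableOn (fun x => x ^ α * (x ^ (-α) * u x ^ 2)) (Ioi 0) :=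
    hint.locallyIntegrableOn.continuousOn_mul (contDiffOn_rpow_Ioi α).continuousOn
      isOpen_Ioi.isLocallyClosed
  rw [locallyIntegrableOn_iff isOpen_Ioi.isLocallyClosed] at h1 ⊢
  intro K hK hKc
  have h2 : IntegrableOn (fun x => 1 + x ^ α * (x ^ (-α) * u x ^ 2)) K :=
    (integrableOn_const (hs := hKc.measure_lt_top.ne)).add (h1 K hK hKc)
  refine h2.mono' hm.restrict ?_
  filter_upwards [ae_restrict_mem hKc.measurableSet] with x hx
  have hx0 : 0 < x := hK hx
  rw [← mul_assoc, ← Real.rpow_add hx0, add_neg_cancel, Real.rpow_zero, one_mul, Real.norm_eq_abs,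
    abs_le]
  constructor <;> nlinarith

/-- The `L²` kernel of the adjoint of `A - 1` on the half-line is trivial in the limit-point
case. -/
theorem halfLine_kernel {α κ : ℝ} (hκ : 0 ≤ κ) (hα : α ≤ -3 ∨ 1 ≤ α ∨ (α ≤ -1 ∧ 1 ≤ κ))
    {u : ℝ → ℝ} (hm : AEStronglyMeasurable u volume)
    (hint : IntegrableOn (fun x => x ^ (-α) * u x ^ 2) (Ioi 0))
    (hweak : ∀ φ, HalfLineTest φ → ∫ x, u x * deriv (fun x => x ^ (-α) * deriv φ x) x
      = ∫ x, x ^ (-α) * (1 + κ * x ^ (2 * α)) * u x * φ x) :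
    ∀ᵐ x, x ∈ Ioi (0 : ℝ) → u x = 0 := by
  have hq : ContinuousOn (fun x : ℝ => x ^ (-α) * (1 + κ * x ^ (2 * α))) (Ioi 0) :=
    (contDiffOn_rpow_Ioi _).continuousOn.mul
      (continuousOn_const.add (continuousOn_const.mul (contDiffOn_rpow_Ioi _).continuousOn))
  obtain ⟨v, V, huv, hv, hV⟩ :=
    exists_classical_solution hq (locallyIntegrableOn_of_sq hm hint) hweak
  have hvi : IntegrableOn (fun x => x ^ (-α) * v x ^ 2) (Ioi 0) := by
    refine hint.congr_fun_ae ?_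
    filter_upwards [(ae_restrict_iff' measurableSet_Ioi).2 huv] with x hx
    rw [hx]
  have h0 := ode_eq_zero hκ hα hv hV hvi
  filter_upwards [huv] with x hx hx0
  rw [hx hx0, h0 x hx0]

end Regularity

/-! ### Essential self-adjointness of operators on spaces of test functions -/

section Interface

variable {𝕜 X : Type*} [RCLike 𝕜] [MeasurableSpace X] {μ : Measure X}

theorem integrable_inner_of_memLp {f g : X → 𝕜} (hf : MemLp f 2 μ) (hg : MemLp g 2 μ) :
    Integrable (fun x => inner 𝕜 (f x) (g x)) μ := by
  refine (L2.integrable_inner (𝕜 := 𝕜) (hf.toLp f) (hg.toLp g)).congr ?_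
  filter_upwards [hf.coeFn_toLp, hg.coeFn_toLp] with x h1 h2
  rw [h1, h2]

theorem inner_toLp {f g : X → 𝕜} (hf : MemLp f 2 μ) (hg : MemLp g 2 μ) :
    inner 𝕜 (hf.toLp f) (hg.toLp g) = ∫ x, inner 𝕜 (f x) (g x) ∂μ := by
  rw [L2.inner_def]
  refine integral_congr_ae ?_
  filter_upwards [hf.coeFn_toLp, hg.coeFn_toLp] with x h1 h2
  rw [h1, h2]

/-- If `u` is orthogonal to a real function, so are its real and imaginary parts. -/
theorem integral_re_im_mul_eq_zero {u : X → 𝕜} {g : X → ℝ} (hu : MemLp u 2 μ) (hg : MemLp g 2 μ)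
    (h : ∫ x, inner 𝕜 (u x) ((g x : ℝ) : 𝕜) ∂μ = 0) :
    ∫ x, RCLike.re (u x) * g x ∂μ = 0 ∧ ∫ x, RCLike.im (u x) * g x ∂μ = 0 := by
  have hi := integrable_inner_of_memLp hu (hg.ofReal (K := 𝕜))
  have h1 := integral_re hi
  have h2 := integral_im hi
  rw [h] at h1 h2
  constructor
  · rw [map_zero] at h1
    rw [← h1]
    refine integral_congr_ae (Eventually.of_forall fun x => ?_)
    simp [RCLike.inner_apply, mul_comm]
  · rw [map_zero] at h2
    rw [← neg_eq_zero, ← integral_neg, ← h2]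
    refine integral_congr_ae (Eventually.of_forall fun x => ?_)
    simp [RCLike.inner_apply, mul_comm]

variable {D : Submodule 𝕜 (X → 𝕜)} {L : D →ₗ[𝕜] (X → 𝕜)}
  {hD : ∀ u, MemLp (D.subtype u) 2 μ} {hL : ∀ u, MemLp (L u) 2 μ}
  {hinj : ∀ u ∈ D, u =ᵐ[μ] 0 → u = 0}

theorem exists_of_mem_domain_operatorOn (x : (operatorOn μ D L hD hL hinj).domain) :
    ∃ u : D, (x : Lp 𝕜 2 μ) = (hD u).toLp _ ∧
      operatorOn μ D L hD hL hinj x = (hL u).toLp _ := by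
  obtain ⟨u, h1, h2⟩ := (mem_graph_operatorOn μ D L hD hL hinj _).1
    (LinearPMap.mem_graph (operatorOn μ D L hD hL hinj) x)
  exact ⟨u, Lp.ext (h1.trans (hD u).coeFn_toLp.symm), Lp.ext (h2.trans (hL u).coeFn_toLp.symm)⟩

theorem exists_domain_operatorOn_eq (u : D) :
    ∃ x : (operatorOn μ D L hD hL hinj).domain, (x : Lp 𝕜 2 μ) = (hD u).toLp _ ∧
      operatorOn μ D L hD hL hinj x = (hL u).toLp _ := by
  have := (mem_graph_operatorOn μ D L hD hL hinj ((hD u).toLp _, (hL u).toLp _)).2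
    ⟨u, (hD u).coeFn_toLp, (hL u).coeFn_toLp⟩
  exact (LinearPMap.mem_graph_iff _).1 this

/-- Criterion for essential self-adjointness in terms of functions: the operator comes from minus a
nonnegative hermitian form `Q`, its domain is dense, and `A - 1` has dense range. -/
theorem essentiallySelfAdjoint_operatorOn (Q : D → D → 𝕜)
    (hQ : ∀ u v : D, ∫ x, inner 𝕜 (L u x) ((v : X → 𝕜) x) ∂μ = - Q u v)
    (hQs : ∀ u v : D, Q v u = (starRingEnd 𝕜) (Q u v)) (hQn : ∀ u : D, 0 ≤ RCLike.re (Q u u))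
    (hdense : ∀ w : X → 𝕜, MemLp w 2 μ →
      (∀ u : D, ∫ x, inner 𝕜 (w x) ((u : X → 𝕜) x) ∂μ = 0) → w =ᵐ[μ] 0)
    (hker : ∀ w : X → 𝕜, MemLp w 2 μ →
      (∀ u : D, ∫ x, inner 𝕜 (w x) (L u x - (u : X → 𝕜) x) ∂μ = 0) → w =ᵐ[μ] 0) :
    EssentiallySelfAdjoint (operatorOn μ D L hD hL hinj) := by
  have hform : ∀ u v : D, inner 𝕜 ((hL u).toLp _) ((hD v).toLp _) = - Q u v := fun u v => by
    rw [inner_toLp]; exact hQ u v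
  refine essentiallySelfAdjoint_of_nonpos ?_ ?_ ?_ ?_
  · rw [Submodule.dense_iff_topologicalClosure_eq_top, Submodule.topologicalClosure_eq_top_iff,
      Submodule.eq_bot_iff]
    intro w hw
    have h0 : (w : X → 𝕜) =ᵐ[μ] 0 := hdense w (Lp.memLp w) fun u => by
      obtain ⟨x, hx, -⟩ := exists_domain_operatorOn_eq (hL := hL) (hinj := hinj) (L := L)
        (hD := hD) u
      have h1 := Submodule.inner_left_of_mem_orthogonal x.2 hw
      rw [hx, ← Lp.toLp_coeFn w (Lp.memLp w), inner_toLp] at h1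
      exact h1
    exact Lp.ext (h0.trans (Lp.coeFn_zero _ _ _).symm)
  · intro x y
    obtain ⟨u, hu1, hu2⟩ := exists_of_mem_domain_operatorOn x
    obtain ⟨v, hv1, hv2⟩ := exists_of_mem_domain_operatorOn y
    rw [hu1, hu2, hv1, hv2, ← inner_conj_symm ((hD u).toLp _), hform, hform, hQs v u, map_neg]
  · intro x
    obtain ⟨u, hu1, hu2⟩ := exists_of_mem_domain_operatorOn x
    rw [hu1, hu2, hform, map_neg]
    exact neg_nonpos.2 (hQn u)
  · intro w hw
    have h0 : (w : X → 𝕜) =ᵐ[μ] 0 := hker w (Lp.memLp w) fun u => by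
      obtain ⟨x, hx, hx'⟩ := exists_domain_operatorOn_eq (hL := hL) (hinj := hinj) (L := L)
        (hD := hD) u
      have h1 := hw x
      rw [hx, hx', ← MemLp.toLp_sub, ← Lp.toLp_coeFn w (Lp.memLp w), inner_toLp] at h1
      exact h1
    exact Lp.ext (h0.trans (Lp.coeFn_zero _ _ _).symm)

/-- If `A` is essentially self-adjoint, its weak extension is symmetric. -/
theorem integral_inner_eq_of_essentiallySelfAdjoint
    (hA : EssentiallySelfAdjoint (operatorOn μ D L hD hL hinj)) {u f v g : X → 𝕜}
    (hu : MemLp u 2 μ) (hf : MemLp f 2 μ) (hv : MemLp v 2 μ) (hg : MemLp g 2 μ)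
    (huf : ∀ φ : D, ∫ x, inner 𝕜 (f x) ((φ : X → 𝕜) x) ∂μ = ∫ x, inner 𝕜 (u x) (L φ x) ∂μ)
    (hvg : ∀ φ : D, ∫ x, inner 𝕜 (g x) ((φ : X → 𝕜) x) ∂μ = ∫ x, inner 𝕜 (v x) (L φ x) ∂μ) :
    ∫ x, inner 𝕜 (f x) (v x) ∂μ = ∫ x, inner 𝕜 (u x) (g x) ∂μ := by
  rw [← inner_toLp hf hv, ← inner_toLp hu hg]
  refine hA.inner_eq (fun x => ?_) (fun x => ?_)
  all_goals
    obtain ⟨φ, h1, h2⟩ := exists_of_mem_domain_operatorOn x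
    rw [h1, h2, inner_toLp, inner_toLp]
  · exact huf φ
  · exact hvg φ

end Interface

/-! ### Essential self-adjointness of the Fourier components -/

section Line

variable {𝕜 : Type*} [RCLike 𝕜]

/-- The sign of `x` combines with `1 / |x|` to give `1 / x`, so one formula covers both half-lines.
-/
theorem hasDerivAt_abs_rpow (β : ℝ) {x : ℝ} (hx : x ≠ 0) :
    HasDerivAt (fun y : ℝ => |y| ^ β) (β / x * |x| ^ β) x := by
  have hx' : |x| ≠ 0 := abs_ne_zero.2 hx
  refine ((hasDerivAt_abs hx).rpow_const (p := β) (Or.inl hx')).congr_deriv ?_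
  rw [Real.rpow_sub_one hx']
  rcases lt_or_gt_of_ne hx with h | h
  · rw [abs_of_neg h, sign_neg h]
    simp only [SignType.coe_neg, SignType.coe_one]
    field_simp
  · rw [abs_of_pos h, sign_pos h]
    simp only [SignType.coe_one]
    field_simp

/-- Applied to `f = u'`, this is the divergence form of `∂_x² - (α / x) ∂_x`, the source of Green's
identities. -/
theorem hasDerivAt_weight_smul (α : ℝ) {f : ℝ → 𝕜} {f' : 𝕜} {x : ℝ} (hx : x ≠ 0)
    (hf : HasDerivAt f f' x) :
    HasDerivAt (fun y => |y| ^ (-α) • f y) (|x| ^ (-α) • (f' - (α / x) • f x)) x := by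
  refine ((hasDerivAt_abs_rpow (-α) hx).smul hf).congr_deriv ?_
  rw [smul_sub, smul_smul, sub_eq_add_neg, ← neg_smul]
  congr 2
  ring

theorem measurable_weight (α : ℝ) : Measurable fun x : ℝ => ENNReal.ofReal (|x| ^ (-α)) := by
  fun_prop

theorem integral_lineMeasure {E : Type*} [NormedAddCommGroup E] [NormedSpace ℝ E] (α : ℝ)
    (f : ℝ → E) : ∫ x, f x ∂(lineMeasure α) = ∫ x, |x| ^ (-α) • f x := by
  rw [integral_withDensity_eq_integral_toReal_smul (measurable_weight α)
    (Eventually.of_forall fun x => ENNReal.ofReal_lt_top)]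
  refine integral_congr_ae (Eventually.of_forall fun x => ?_)
  simp only
  rw [ENNReal.toReal_ofReal (Real.rpow_nonneg (abs_nonneg x) _)]

theorem integrable_lineMeasure_iff {E : Type*} [NormedAddCommGroup E] [NormedSpace ℝ E] (α : ℝ)
    (f : ℝ → E) : Integrable f (lineMeasure α) ↔ Integrable (fun x => |x| ^ (-α) • f x) := by
  rw [integrable_withDensity_iff_integrable_smul' (measurable_weight α)
    (Eventually.of_forall fun x => ENNReal.ofReal_lt_top)]
  simp only [ENNReal.toReal_ofReal (Real.rpow_nonneg (abs_nonneg _) _)]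

theorem lineMeasure_ac_volume (α : ℝ) : lineMeasure α ≪ (volume : Measure ℝ) :=
  withDensity_absolutelyContinuous _ _

theorem deriv_mem_testLine {f : ℝ → 𝕜} (hf : f ∈ testLine 𝕜) : deriv f ∈ testLine 𝕜 :=
  ⟨(contDiff_infty_iff_deriv.1 hf.1).2, hf.2.1.deriv, tsupport_deriv_subset.trans hf.2.2⟩

theorem memLp_of_mem_testLine (α : ℝ) {f : ℝ → 𝕜} (hf : f ∈ testLine 𝕜) :
    MemLp f 2 (lineMeasure α) :=
  testLine_memLp 𝕜 α ⟨f, hf⟩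

theorem memLp_fourierExpr (α : ℝ) (k : ℤ) {f : ℝ → 𝕜} (hf : f ∈ testLine 𝕜) :
    MemLp (fourierExpr α k f) 2 (lineMeasure α) :=
  fourierMap_memLp 𝕜 α k ⟨f, hf⟩

theorem fourierExpr_eq_sub (α : ℝ) (k : ℤ) (f : ℝ → 𝕜) (x : ℝ) :
    fourierExpr α k f x = fourierExpr α 0 f x - ((k : ℝ) ^ 2 * |x| ^ (2 * α)) • f x := by
  simp [fourierExpr]

theorem memLp_potential_smul (α : ℝ) (k : ℤ) {f : ℝ → 𝕜} (hf : f ∈ testLine 𝕜) :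
    MemLp (fun x => ((k : ℝ) ^ 2 * |x| ^ (2 * α)) • f x) 2 (lineMeasure α) := by
  refine ((memLp_fourierExpr α 0 hf).sub (memLp_fourierExpr α k hf)).ae_eq
    (Eventually.of_forall fun x => ?_)
  rw [Pi.sub_apply, fourierExpr_eq_sub α k, sub_sub_cancel]

/-- Green's identity on `ℝ \ {0}` for the weight `|x|^{-α}`. -/
theorem integral_inner_fourierExpr_zero (α : ℝ) {f g : ℝ → 𝕜} (hf : f ∈ testLine 𝕜)
    (hg : g ∈ testLine 𝕜) :
    ∫ x, inner 𝕜 (fourierExpr α 0 f x) (g x) ∂(lineMeasure α)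
      = - ∫ x, inner 𝕜 (deriv f x) (deriv g x) ∂(lineMeasure α) := by
  have i1 := (integrable_lineMeasure_iff α _).1
    (integrable_inner_of_memLp (memLp_fourierExpr α 0 hf) (memLp_of_mem_testLine α hg))
  have i2 := (integrable_lineMeasure_iff α _).1
    (integrable_inner_of_memLp (memLp_of_mem_testLine α (deriv_mem_testLine hf))
      (memLp_of_mem_testLine α (deriv_mem_testLine hg)))
  have i3 := (integrable_lineMeasure_iff α _).1
    (integrable_inner_of_memLp (memLp_of_mem_testLine α (deriv_mem_testLine hf))
      (memLp_of_mem_testLine α hg))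
  have e : ∀ (x : ℝ) (a b : 𝕜), |x| ^ (-α) • inner 𝕜 a b
      = b * (starRingEnd 𝕜) (|x| ^ (-α) • a) := fun x a b => by
    rw [RCLike.inner_apply, RCLike.real_smul_eq_coe_mul, RCLike.real_smul_eq_coe_mul, map_mul,
      RCLike.conj_ofReal]
    ring
  rw [integral_lineMeasure, integral_lineMeasure]
  simp only [e] at i1 i2 i3 ⊢
  obtain ⟨g0, -, -⟩ := testLine_differentiable hg
  obtain ⟨-, f1, -⟩ := testLine_differentiable hf
  -- The derivative of the weighted factor is needed only on the support of `g`, which avoids `0`.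
  refine integral_mul_deriv_eq_deriv_mul_of_integrable (fun x _ => (g0 x).hasDerivAt)
    (fun x hx => ?_) i1 i2 i3
  have h1 := (hasDerivAt_weight_smul α (hg.2.2 hx) (f1 x).hasDerivAt).star
  have h2 : fourierExpr α 0 f x = deriv (deriv f) x - (α / x) • deriv f x := by simp [fourierExpr]
  rw [h2]
  exact h1

/-- The quadratic form of `-Δ̂_k`. -/
noncomputable def lineForm (α : ℝ) (k : ℤ) (f g : testLine 𝕜) : 𝕜 :=
  (∫ x, inner 𝕜 (deriv (f : ℝ → 𝕜) x) (deriv (g : ℝ → 𝕜) x) ∂(lineMeasure α)) +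
    ∫ x, inner 𝕜 (((k : ℝ) ^ 2 * |x| ^ (2 * α)) • (f : ℝ → 𝕜) x) ((g : ℝ → 𝕜) x) ∂(lineMeasure α)

theorem inner_real_smul_symm (c : ℝ) (a b : 𝕜) :
    inner 𝕜 (c • b) a = (starRingEnd 𝕜) (inner 𝕜 (c • a) b) := by
  simp only [RCLike.inner_apply, RCLike.real_smul_eq_coe_mul, map_mul, RCLike.conj_ofReal,
    RCLike.conj_conj]
  ring

theorem re_integral_inner_smul_self_nonneg {X : Type*} [MeasurableSpace X] {μ : Measure X}
    {c : X → ℝ} {f : X → 𝕜} (hc : ∀ x, 0 ≤ c x) (hcf : MemLp (fun x => c x • f x) 2 μ)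
    (hf : MemLp f 2 μ) : 0 ≤ RCLike.re (∫ x, inner 𝕜 (c x • f x) (f x) ∂μ) := by
  rw [← integral_re (integrable_inner_of_memLp hcf hf)]
  refine integral_nonneg fun x => ?_
  rw [RCLike.real_smul_eq_coe_smul (K := 𝕜), inner_smul_left, RCLike.conj_ofReal,
    RCLike.re_ofReal_mul]
  exact mul_nonneg (hc x) inner_self_nonneg

theorem re_integral_inner_self_nonneg {X : Type*} [MeasurableSpace X] {μ : Measure X} {f : X → 𝕜}
    (hf : MemLp f 2 μ) : 0 ≤ RCLike.re (∫ x, inner 𝕜 (f x) (f x) ∂μ) := by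
  rw [← integral_re (integrable_inner_of_memLp hf hf)]
  exact integral_nonneg fun _ => inner_self_nonneg

theorem integral_inner_fourierExpr (α : ℝ) (k : ℤ) (f g : testLine 𝕜) :
    ∫ x, inner 𝕜 (fourierMap 𝕜 α k f x) ((g : ℝ → 𝕜) x) ∂(lineMeasure α) = - lineForm α k f g := by
  have e : ∀ x, inner 𝕜 (fourierMap 𝕜 α k f x) ((g : ℝ → 𝕜) x)
      = inner 𝕜 (fourierExpr α 0 (f : ℝ → 𝕜) x) ((g : ℝ → 𝕜) x)
        - inner 𝕜 (((k : ℝ) ^ 2 * |x| ^ (2 * α)) • (f : ℝ → 𝕜) x) ((g : ℝ → 𝕜) x) := fun x => by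
    rw [← inner_sub_left, ← fourierExpr_eq_sub]
    rfl
  simp only [e]
  rw [integral_sub (integrable_inner_of_memLp (memLp_fourierExpr α 0 f.2)
    (memLp_of_mem_testLine α g.2)) (integrable_inner_of_memLp (memLp_potential_smul α k f.2)
    (memLp_of_mem_testLine α g.2)), integral_inner_fourierExpr_zero α f.2 g.2, lineForm]
  ring

theorem HalfLineTest.mem_testLine {φ : ℝ → ℝ} (hφ : HalfLineTest φ) : φ ∈ testLine ℝ :=
  ⟨hφ.contDiff, hφ.hasCompactSupport, fun _ hx => ne_of_gt (hφ.tsupport_subset hx)⟩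

/-- Passes from `Δ̂_k - 1` to the Sturm–Liouville form on the half-line; off the support of `φ` both
sides vanish, whatever the powers of a nonpositive `x` are. -/
theorem weight_mul_fourierExpr_sub {φ : ℝ → ℝ} (hφ : HalfLineTest φ) (α : ℝ) (k : ℤ) (x : ℝ) :
    |x| ^ (-α) * (fourierExpr α k φ x - φ x) = deriv (fun x => x ^ (-α) * deriv φ x) x
      - x ^ (-α) * (1 + (k : ℝ) ^ 2 * x ^ (2 * α)) * φ x := by
  by_cases hx : x ∈ tsupport φ
  · have hx0 : 0 < x := hφ.tsupport_subset hx
    have h1 := hasDerivAt_weight_smul α hx0.ne' (hφ.deriv.hasDerivAt x)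
    have h2 : (fun y => y ^ (-α) * deriv φ y) =ᶠ[𝓝 x] fun y => |y| ^ (-α) • deriv φ y := by
      filter_upwards [Ioi_mem_nhds hx0] with y hy
      rw [abs_of_pos hy, smul_eq_mul]
    rw [h2.deriv_eq, h1.deriv, fourierExpr, abs_of_pos hx0]
    simp only [smul_eq_mul]
    ring
  · have h1 : fourierExpr α k φ x = 0 :=
      image_eq_zero_of_notMem_tsupport fun h => hx (tsupport_fourierExpr α k φ h)
    have h2 := (hφ.deriv.mul (contDiffOn_rpow_Ioi (-α)))
    have h3 : tsupport (deriv fun x => x ^ (-α) * deriv φ x) ⊆ tsupport φ :=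
      tsupport_deriv_subset.trans (tsupport_mul_subset_right.trans tsupport_deriv_subset)
    rw [h1, image_eq_zero_of_notMem_tsupport hx,
      image_eq_zero_of_notMem_tsupport fun h => hx (h3 h)]
    ring

/-- The condition on `α` and `k` under which `Δ̂_k` is in the limit-point case at `0`. -/
def LimitPoint (α : ℝ) (k : ℤ) : Prop := α ≤ -3 ∨ 1 ≤ α ∨ (α ≤ -1 ∧ k ≠ 0)

theorem line_kernel_Ioi {α : ℝ} {k : ℤ} (hα : LimitPoint α k) {u : ℝ → ℝ}
    (hm : AEStronglyMeasurable u volume) (hint : Integrable fun x => |x| ^ (-α) * u x ^ 2)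
    (hweak : ∀ φ ∈ testLine ℝ, ∫ x, |x| ^ (-α) * (u x * (fourierExpr α k φ x - φ x)) = 0) :
    ∀ᵐ x, x ∈ Ioi (0 : ℝ) → u x = 0 := by
  have hi : IntegrableOn (fun x => x ^ (-α) * u x ^ 2) (Ioi 0) :=
    hint.integrableOn.congr_fun (fun x hx => by simp only [abs_of_pos (mem_Ioi.1 hx)])
      measurableSet_Ioi
  have hloc := locallyIntegrableOn_of_sq hm hi
  have hcond : α ≤ -3 ∨ 1 ≤ α ∨ (α ≤ -1 ∧ 1 ≤ (k : ℝ) ^ 2) := by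
    rcases hα with h | h | ⟨h, hk⟩
    · exact Or.inl h
    · exact Or.inr (Or.inl h)
    · refine Or.inr (Or.inr ⟨h, ?_⟩)
      have : 1 ≤ k ^ 2 := Int.add_one_le_iff.2 (sq_pos_iff.2 hk)
      exact_mod_cast this
  refine halfLine_kernel (sq_nonneg (k : ℝ)) hcond hm hi fun φ hφ => ?_
  have h1 := hweak φ hφ.mem_testLine
  have e : ∀ x, |x| ^ (-α) * (u x * (fourierExpr α k φ x - φ x))
      = u x * deriv (fun x => x ^ (-α) * deriv φ x) x
        - x ^ (-α) * (1 + (k : ℝ) ^ 2 * x ^ (2 * α)) * u x * φ x := fun x => by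
    linear_combination u x * weight_mul_fourierExpr_sub hφ α k x
  have hq : ContinuousOn (fun x : ℝ => x ^ (-α) * (1 + (k : ℝ) ^ 2 * x ^ (2 * α))) (Ioi 0) :=
    (contDiffOn_rpow_Ioi _).continuousOn.mul
      (continuousOn_const.add (continuousOn_const.mul (contDiffOn_rpow_Ioi _).continuousOn))
  simp only [e] at h1
  rw [integral_sub ((hφ.deriv.mul (contDiffOn_rpow_Ioi (-α))).deriv.integrable_mul hloc)
    (hφ.integrable_mul (hloc.continuousOn_mul hq isOpen_Ioi.isLocallyClosed))] at h1
  exact sub_eq_zero.1 h1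

theorem comp_neg_mem_testLine {φ : ℝ → 𝕜} (hφ : φ ∈ testLine 𝕜) :
    (fun x => φ (-x)) ∈ testLine 𝕜 := by
  have hs : tsupport (fun x => φ (-x)) ⊆ Neg.neg ⁻¹' tsupport φ :=
    tsupport_comp_subset_preimage φ continuous_neg
  refine ⟨hφ.1.comp contDiff_neg, hφ.2.1.comp_homeomorph (Homeomorph.neg ℝ), fun x hx h => ?_⟩
  have h1 := hφ.2.2 (hs hx)
  exact h1 (by simpa using h)

/-- Invariance under reflection reduces the negative half-line to the positive one. -/
theorem fourierExpr_comp_neg (α : ℝ) (k : ℤ) (φ : ℝ → 𝕜) (x : ℝ) :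
    fourierExpr α k (fun x => φ (-x)) x = fourierExpr α k φ (-x) := by
  have h1 : deriv (fun x => φ (-x)) = fun x => -deriv φ (-x) := funext fun x => deriv_comp_neg φ x
  have h2 : deriv (fun x => -deriv φ (-x)) x = deriv (deriv φ) (-x) := by
    rw [deriv.fun_neg, deriv_comp_neg, neg_neg]
  simp only [fourierExpr, h1, h2, abs_neg, smul_neg, div_neg, neg_smul]

/-- The limit-point case: the `L²` kernel of the adjoint of `Δ̂_k - 1` is trivial. -/
theorem line_kernel {α : ℝ} {k : ℤ} (hα : LimitPoint α k) {u : ℝ → ℝ}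
    (hu : MemLp u 2 (lineMeasure α))
    (hweak : ∀ φ ∈ testLine ℝ, ∫ x, u x * (fourierExpr α k φ x - φ x) ∂(lineMeasure α) = 0) :
    u =ᵐ[lineMeasure α] 0 := by
  have hm : AEStronglyMeasurable u volume := hu.1.mono_ac (volume_ac_lineMeasure α)
  have hint : Integrable fun x => |x| ^ (-α) * u x ^ 2 :=
    (integrable_lineMeasure_iff α _).1 hu.integrable_sq
  have hw : ∀ φ ∈ testLine ℝ, ∫ x, |x| ^ (-α) * (u x * (fourierExpr α k φ x - φ x)) = 0 :=
    fun φ hφ => by have := hweak φ hφ; rwa [integral_lineMeasure] at this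
  have h1 := line_kernel_Ioi hα hm hint hw
  have hq : Measure.QuasiMeasurePreserving (Neg.neg : ℝ → ℝ) volume volume :=
    (Measure.measurePreserving_neg volume).quasiMeasurePreserving
  have h2 := line_kernel_Ioi (u := fun x => u (-x)) hα (hm.comp_quasiMeasurePreserving hq)
    (hint.comp_neg.congr (Eventually.of_forall fun x => by simp only [abs_neg])) fun φ hφ => by
      have h := hw _ (comp_neg_mem_testLine hφ)
      rw [← integral_neg_eq_self] at h
      refine Eq.trans (integral_congr_ae (Eventually.of_forall fun x => ?_)) h
      simp only [fourierExpr_comp_neg, neg_neg, abs_neg]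
  have h3 := hq.ae h2
  have hne : ∀ᵐ x : ℝ, x ≠ 0 := by simp [ae_iff]
  refine (lineMeasure_ac_volume α).ae_eq ?_
  filter_upwards [h1, h3, hne] with x hx1 hx3 hx0
  rcases lt_or_gt_of_ne hx0 with h | h
  · have := hx3 (by simpa using h)
    rwa [neg_neg] at this
  · exact hx1 h

theorem line_dense {α : ℝ} {u : ℝ → ℝ} (hu : MemLp u 2 (lineMeasure α))
    (h : ∀ φ ∈ testLine ℝ, ∫ x, u x * φ x ∂(lineMeasure α) = 0) : u =ᵐ[lineMeasure α] 0 := by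
  have hm : AEStronglyMeasurable u volume := hu.1.mono_ac (volume_ac_lineMeasure α)
  have hint : Integrable fun x => |x| ^ (-α) * u x ^ 2 :=
    (integrable_lineMeasure_iff α _).1 hu.integrable_sq
  have hopen : IsOpen {x : ℝ | x ≠ 0} := isOpen_ne
  have hc : ∀ β : ℝ, ContinuousOn (fun x : ℝ => |x| ^ β) {x : ℝ | x ≠ 0} := fun β x hx =>
    (hasDerivAt_abs_rpow β hx).continuousAt.continuousWithinAt
  -- The weight is locally bounded off `0` and `|u| ≤ 1 + u²`, so the weighted function is locally
  -- integrable there and the fundamental lemma of the calculus of variations applies.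
  have hloc : LocallyIntegrableOn (fun x => |x| ^ (-α) * u x) {x : ℝ | x ≠ 0} := by
    have h1 : LocallyIntegrableOn (fun x : ℝ => |x| ^ (-α)) {x : ℝ | x ≠ 0} :=
      (hc (-α)).locallyIntegrableOn hopen.measurableSet
    refine (h1.add (hint.integrableOn.locallyIntegrableOn)).mono ?_ ?_
    · exact (Measurable.aestronglyMeasurable (by fun_prop)).mul hm
    · refine Eventually.of_forall fun x => ?_
      have hp : 0 ≤ |x| ^ (-α) := Real.rpow_nonneg (abs_nonneg x) _
      rw [Pi.add_apply, Real.norm_eq_abs, Real.norm_eq_abs, abs_mul, abs_of_nonneg hp,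
        abs_of_nonneg (a := _ + _) (by positivity)]
      have : |u x| ≤ 1 + u x ^ 2 := abs_le.2 ⟨by nlinarith, by nlinarith⟩
      nlinarith
  have h0 := hopen.ae_eq_zero_of_integral_contDiff_smul_eq_zero hloc fun g h1 h2 h3 => by
    have := h g ⟨h1, h2, h3⟩
    rw [integral_lineMeasure] at this
    refine Eq.trans (integral_congr_ae (Eventually.of_forall fun x => ?_)) this
    simp only [smul_eq_mul]
    ring
  have hne : ∀ᵐ x : ℝ, x ≠ 0 := by simp [ae_iff]
  refine (lineMeasure_ac_volume α).ae_eq ?_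
  filter_upwards [h0, hne] with x hx hx0
  exact (mul_eq_zero.1 (hx hx0)).resolve_left
    (Real.rpow_pos_of_pos (abs_pos.2 hx0) _).ne'

theorem hasDerivAt_ofReal {f : ℝ → ℝ} {f' x : ℝ} (hf : HasDerivAt f f' x) :
    HasDerivAt (fun y => ((f y : ℝ) : 𝕜)) (f' : 𝕜) x :=
  (RCLike.ofRealCLM (K := 𝕜)).hasFDerivAt.comp_hasDerivAt x hf

theorem ofReal_mem_testLine {φ : ℝ → ℝ} (hφ : φ ∈ testLine ℝ) :
    (fun x => ((φ x : ℝ) : 𝕜)) ∈ testLine 𝕜 := by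
  have hs : tsupport (fun x => ((φ x : ℝ) : 𝕜)) ⊆ tsupport φ :=
    closure_mono fun x hx h => hx (by simp [h])
  exact ⟨(RCLike.ofRealCLM (K := 𝕜)).contDiff.comp hφ.1,
    hφ.2.1.of_isClosed_subset (isClosed_tsupport _) hs, hs.trans hφ.2.2⟩

theorem fourierExpr_ofReal (α : ℝ) (k : ℤ) {φ : ℝ → ℝ} (hφ : φ ∈ testLine ℝ) (x : ℝ) :
    fourierExpr α k (fun x => ((φ x : ℝ) : 𝕜)) x = ((fourierExpr α k φ x : ℝ) : 𝕜) := by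
  obtain ⟨h0, h1, -⟩ := testLine_differentiable hφ
  have e1 : deriv (fun x => ((φ x : ℝ) : 𝕜)) = fun x => ((deriv φ x : ℝ) : 𝕜) :=
    funext fun x => (hasDerivAt_ofReal (h0 x).hasDerivAt).deriv
  have e2 : deriv (fun x => ((deriv φ x : ℝ) : 𝕜)) x = ((deriv (deriv φ) x : ℝ) : 𝕜) :=
    (hasDerivAt_ofReal (h1 x).hasDerivAt).deriv
  simp only [fourierExpr, e1, e2, RCLike.real_smul_eq_coe_mul, smul_eq_mul]
  push_cast
  ring

theorem ae_eq_zero_of_re_im {X : Type*} [MeasurableSpace X] {μ : Measure X} {w : X → 𝕜}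
    (hre : (fun x => RCLike.re (w x)) =ᵐ[μ] 0) (him : (fun x => RCLike.im (w x)) =ᵐ[μ] 0) :
    w =ᵐ[μ] 0 := by
  filter_upwards [hre, him] with x h1 h2
  exact RCLike.ext (by simpa using h1) (by simpa using h2)

/-- The coefficients of `Δ̂_k` are real. Real test functions therefore suffice, and the real and
imaginary parts of an orthogonal vector are handled separately by the real results. -/
theorem fourierComponent_essentiallySelfAdjoint {α : ℝ} {k : ℤ} (hα : LimitPoint α k) :
    EssentiallySelfAdjoint (fourierComponent 𝕜 α k) := by
  refine essentiallySelfAdjoint_operatorOn (lineForm α k) (integral_inner_fourierExpr α k)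
    (fun u v => ?_) (fun u => ?_) (fun w hw h => ?_) (fun w hw h => ?_)
  · rw [lineForm, lineForm, map_add, ← integral_conj, ← integral_conj]
    congr 1
    · simp only [inner_conj_symm]
    · exact integral_congr_ae (Eventually.of_forall fun x => inner_real_smul_symm _ _ _)
  · rw [lineForm, map_add]
    exact add_nonneg
      (re_integral_inner_self_nonneg (memLp_of_mem_testLine α (deriv_mem_testLine u.2)))
      (re_integral_inner_smul_self_nonneg (fun x => by positivity) (memLp_potential_smul α k u.2)
        (memLp_of_mem_testLine α u.2))
  · have key : ∀ φ ∈ testLine ℝ, _ := fun φ hφ =>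
      integral_re_im_mul_eq_zero hw (memLp_of_mem_testLine α hφ) (h ⟨_, ofReal_mem_testLine hφ⟩)
    exact ae_eq_zero_of_re_im (line_dense hw.re fun φ hφ => (key φ hφ).1)
      (line_dense hw.im fun φ hφ => (key φ hφ).2)
  · have key : ∀ φ ∈ testLine ℝ, _ := fun φ hφ =>
      integral_re_im_mul_eq_zero (g := fun x => fourierExpr α k φ x - φ x) hw
        ((memLp_fourierExpr α k hφ).sub (memLp_of_mem_testLine α hφ)) (by
          refine Eq.trans (integral_congr_ae (Eventually.of_forall fun x => ?_))
            (h ⟨_, ofReal_mem_testLine hφ⟩)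
          change _ = inner 𝕜 (w x) (fourierExpr α k (fun x => ((φ x : ℝ) : 𝕜)) x - ((φ x : ℝ) : 𝕜))
          simp only [fourierExpr_ofReal α k hφ, RCLike.ofReal_sub])
    exact ae_eq_zero_of_re_im (line_kernel hα hw.re fun φ hφ => (key φ hφ).1)
      (line_kernel hα hw.im fun φ hφ => (key φ hφ).2)

end Line

/-! ### The limit-circle case -/

section LimitCircle

variable {𝕜 : Type*} [RCLike 𝕜]

theorem inner_ofReal_left (c : ℝ) (z : 𝕜) : inner 𝕜 ((c : ℝ) : 𝕜) z = c • z := by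
  rw [RCLike.inner_apply, RCLike.conj_ofReal, RCLike.real_smul_eq_coe_mul, mul_comm]

/-- A square integrable function `u`, differentiable off `0`, for which `f = Δ̂_k u` is square
integrable, is in the domain of the adjoint of `Δ̂_k`. Here `U = |x|^{-α} u'`. -/
theorem integral_inner_fourierExpr_of_classical {α : ℝ} {k : ℤ} {u U f : ℝ → ℝ}
    (hu : MemLp u 2 (lineMeasure α)) (hf : MemLp f 2 (lineMeasure α))
    (hdu : ∀ x, x ≠ 0 → HasDerivAt u (|x| ^ α * U x) x)
    (hdU : ∀ x, x ≠ 0 → HasDerivAt U (|x| ^ (-α) * f x + (k : ℝ) ^ 2 * |x| ^ α * u x) x)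
    {φ : ℝ → 𝕜} (hφ : φ ∈ testLine 𝕜) :
    ∫ x, inner 𝕜 ((f x : ℝ) : 𝕜) (φ x) ∂(lineMeasure α)
      = ∫ x, inner 𝕜 ((u x : ℝ) : 𝕜) (fourierExpr α k φ x) ∂(lineMeasure α) := by
  have i1 := integrable_inner_of_memLp (hu.ofReal (K := 𝕜)) (memLp_fourierExpr α k hφ)
  have i2 := integrable_inner_of_memLp (hf.ofReal (K := 𝕜)) (memLp_of_mem_testLine α hφ)
  rw [eq_comm, ← sub_eq_zero, ← integral_sub i1 i2, integral_lineMeasure]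
  have i3 := (integrable_lineMeasure_iff α _).1 (i1.sub i2)
  -- The Lagrange bracket of `u` and `φ`: its derivative is the weighted difference of the two
  -- integrands. It vanishes near `0` with `φ`, so no regularity of `u` at `0` is required, and its
  -- compact support makes the integral zero.
  set W : ℝ → 𝕜 := fun x => u x • (|x| ^ (-α) • deriv φ x) - U x • φ x with hW
  have hWs : ∀ x, x ∉ tsupport φ → W x = 0 := fun x hx => by
    have h' : x ∉ tsupport (deriv φ) := fun h => hx (tsupport_deriv_subset h)
    simp [hW, image_eq_zero_of_notMem_tsupport hx, image_eq_zero_of_notMem_tsupport h']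
  obtain ⟨d0, d1, -⟩ := testLine_differentiable hφ
  have hd : ∀ x, HasDerivAt W (|x| ^ (-α) • (inner 𝕜 ((u x : ℝ) : 𝕜) (fourierExpr α k φ x)
      - inner 𝕜 ((f x : ℝ) : 𝕜) (φ x))) x := by
    intro x
    by_cases hx : x ∈ tsupport φ
    · have hx0 : x ≠ 0 := hφ.2.2 hx
      have hxp : 0 < |x| := abs_pos.2 hx0
      have h1 := (hdu x hx0).smul (hasDerivAt_weight_smul α hx0 (d1 x).hasDerivAt)
      have h2 := (hdU x hx0).smul (d0 x).hasDerivAt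
      refine (h1.sub h2).congr_deriv ?_
      have e1 : |x| ^ α * |x| ^ (-α) = 1 := by
        rw [← Real.rpow_add hxp, add_neg_cancel, Real.rpow_zero]
      have e2 : |x| ^ (-α) * |x| ^ (2 * α) = |x| ^ α := by
        rw [← Real.rpow_add hxp]; congr 1; ring
      have e1' : ((|x| ^ α : ℝ) : 𝕜) * ((|x| ^ (-α) : ℝ) : 𝕜) = 1 := by
        rw [← RCLike.ofReal_mul, e1, RCLike.ofReal_one]
      have e2' : ((|x| ^ (-α) : ℝ) : 𝕜) * ((|x| ^ (2 * α) : ℝ) : 𝕜) = ((|x| ^ α : ℝ) : 𝕜) := by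
        rw [← RCLike.ofReal_mul, e2]
      rw [inner_ofReal_left, inner_ofReal_left, fourierExpr]
      simp only [RCLike.real_smul_eq_coe_mul]
      push_cast
      linear_combination (U x : 𝕜) * deriv φ x * e1' + (u x : 𝕜) * (k : 𝕜) ^ 2 * φ x * e2'
    · have h1 : W =ᶠ[𝓝 x] fun _ => 0 := by
        filter_upwards [(isClosed_tsupport φ).isOpen_compl.mem_nhds hx] with y hy
        exact hWs y hy
      have h2 : fourierExpr α k φ x = 0 :=
        image_eq_zero_of_notMem_tsupport fun h => hx (tsupport_fourierExpr α k φ h)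
      rw [h2, image_eq_zero_of_notMem_tsupport hx, inner_zero_right, inner_zero_right, sub_zero,
        smul_zero]
      exact (hasDerivAt_const x (0 : 𝕜)).congr_of_eventuallyEq h1
  have hWc : HasCompactSupport W := HasCompactSupport.intro hφ.2.1 hWs
  have ht : Tendsto W (cocompact ℝ) (𝓝 0) := hWc.is_zero_at_infty
  have hle := cocompact_eq_atBot_atTop (α := ℝ)
  have := integral_of_hasDerivAt_of_tendsto hd i3
    (ht.mono_left (hle ▸ le_sup_left)) (ht.mono_left (hle ▸ le_sup_right))
  rw [sub_zero] at this
  exact this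

/-! ### Cutting off local solutions. -/

/-- A smooth cutoff, equal to `1` for `x ≤ 1` and to `0` for `x ≥ 2`. -/
noncomputable def cutoff (x : ℝ) : ℝ := Real.smoothTransition (2 - x)

theorem contDiff_cutoff : ContDiff ℝ ∞ cutoff :=
  Real.smoothTransition.contDiff.comp (contDiff_const.sub contDiff_id)

theorem cutoff_eq_one {x : ℝ} (hx : x ≤ 1) : cutoff x = 1 :=
  Real.smoothTransition.one_of_one_le (by linarith)

theorem cutoff_eq_zero {x : ℝ} (hx : 2 ≤ x) : cutoff x = 0 :=
  Real.smoothTransition.zero_of_nonpos (by linarith)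

theorem cutoff_mem_Icc (x : ℝ) : 0 ≤ cutoff x ∧ cutoff x ≤ 1 :=
  ⟨Real.smoothTransition.nonneg _, Real.smoothTransition.le_one _⟩

theorem hasDerivAt_cutoff (x : ℝ) : HasDerivAt cutoff (deriv cutoff x) x :=
  (contDiff_cutoff.differentiable (by simp) x).hasDerivAt

theorem contDiff_deriv_cutoff : ContDiff ℝ ∞ (deriv cutoff) :=
  (contDiff_infty_iff_deriv.1 contDiff_cutoff).2

theorem hasDerivAt_deriv_cutoff (x : ℝ) :
    HasDerivAt (deriv cutoff) (deriv (deriv cutoff) x) x :=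
  (contDiff_deriv_cutoff.differentiable (by simp) x).hasDerivAt

theorem deriv_cutoff_eq_zero {x : ℝ} (hx : x ∉ Icc (1 : ℝ) 2) : deriv cutoff x = 0 := by
  rw [mem_Icc, not_and_or, not_le, not_le] at hx
  rcases hx with h | h
  · have : cutoff =ᶠ[𝓝 x] fun _ => 1 := by
      filter_upwards [Iio_mem_nhds h] with y hy using cutoff_eq_one (le_of_lt hy)
    rw [this.deriv_eq, deriv_const]
  · have : cutoff =ᶠ[𝓝 x] fun _ => 0 := by
      filter_upwards [Ioi_mem_nhds h] with y hy using cutoff_eq_zero (le_of_lt hy)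
    rw [this.deriv_eq, deriv_const]

theorem deriv_deriv_cutoff_eq_zero {x : ℝ} (hx : x ∉ Icc (1 : ℝ) 2) :
    deriv (deriv cutoff) x = 0 := by
  have : deriv cutoff =ᶠ[𝓝 x] fun _ => 0 := by
    filter_upwards [isClosed_Icc.isOpen_compl.mem_nhds hx] with y hy using deriv_cutoff_eq_zero hy
  rw [this.deriv_eq, deriv_const]

/-- The integrand is the derivative of `cutoff²`, which drops from `1` to `0`. -/
theorem integral_cutoff_mul_deriv : ∫ x, 2 * cutoff x * deriv cutoff x = -1 := by
  rw [← HalfLineTest.intervalIntegral_eq (a := 0) (b := 3) fun x hx => by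
    rw [deriv_cutoff_eq_zero fun h => hx ⟨by linarith [h.1], by linarith [h.2]⟩, mul_zero]]
  rw [intervalIntegral.integral_eq_sub_of_hasDerivAt (f := fun x => cutoff x ^ 2)]
  · rw [cutoff_eq_zero (by norm_num), cutoff_eq_one (by norm_num)]
    norm_num
  · intro x _
    exact ((hasDerivAt_cutoff x).pow 2).congr_deriv (by simp)
  · exact ((continuous_const.mul contDiff_cutoff.continuous).mul
      contDiff_deriv_cutoff.continuous).intervalIntegrable _ _

/-- A local solution `h` near `0+`, cut off and extended by zero to `ℝ`. -/
noncomputable def cutSolution (h : ℝ → ℝ) : ℝ → ℝ := (Ioi 0).indicator fun x => cutoff x * h x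

/-- The function `|x|^{-α} ∂_x` applied to `cutSolution h`, where `H = |x|^{-α} h'`. -/
noncomputable def cutMomentum (α : ℝ) (h H : ℝ → ℝ) : ℝ → ℝ :=
  (Ioi 0).indicator fun x => x ^ (-α) * deriv cutoff x * h x + cutoff x * H x

/-- The image of `cutSolution h` under `Δ̂_k`. -/
noncomputable def cutImage (α : ℝ) (h H : ℝ → ℝ) : ℝ → ℝ :=
  (Ioi 0).indicator fun x => (deriv (deriv cutoff) x - α / x * deriv cutoff x) * h x
    + 2 * x ^ α * deriv cutoff x * H x

theorem hasDerivAt_indicator_Ioi {g : ℝ → ℝ} {d : ℝ → ℝ} (hg : ∀ x > 0, HasDerivAt g (d x) x)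
    {x : ℝ} (hx : x ≠ 0) :
    HasDerivAt ((Ioi 0).indicator g) ((Ioi 0).indicator d x) x := by
  rcases lt_or_gt_of_ne hx with h | h
  · have e : (Ioi 0).indicator g =ᶠ[𝓝 x] fun _ => 0 := by
      filter_upwards [Iio_mem_nhds h] with y hy
      exact indicator_of_notMem (notMem_Ioi.2 (le_of_lt hy)) g
    rw [indicator_of_notMem (notMem_Ioi.2 h.le)]
    exact (hasDerivAt_const x (0 : ℝ)).congr_of_eventuallyEq e
  · have e : (Ioi 0).indicator g =ᶠ[𝓝 x] g := by
      filter_upwards [Ioi_mem_nhds h] with y hy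
      exact indicator_of_mem hy g
    rw [indicator_of_mem (mem_Ioi.2 h)]
    exact (hg x h).congr_of_eventuallyEq e

variable {α : ℝ} {h H : ℝ → ℝ}

theorem hasDerivAt_cutSolution (hh : ∀ x > 0, HasDerivAt h (x ^ α * H x) x) {x : ℝ} (hx : x ≠ 0) :
    HasDerivAt (cutSolution h) (|x| ^ α * cutMomentum α h H x) x := by
  refine (hasDerivAt_indicator_Ioi (fun x hx => (hasDerivAt_cutoff x).mul (hh x hx))
    hx).congr_deriv ?_
  rcases lt_or_gt_of_ne hx with h0 | h0
  · simp [cutMomentum, h0.le]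
  · have e : x ^ α * x ^ (-α) = 1 := by rw [← Real.rpow_add h0, add_neg_cancel, Real.rpow_zero]
    rw [cutMomentum, indicator_of_mem (mem_Ioi.2 h0), indicator_of_mem (mem_Ioi.2 h0),
      abs_of_pos h0]
    linear_combination -(deriv cutoff x * h x) * e

/-- Where the cutoff is not differentiated, the equation for `h` produces the potential term. The
remaining commutator terms, with one or two derivatives on the cutoff, make up `cutImage`. -/
theorem hasDerivAt_cutMomentum {κ : ℝ} (hh : ∀ x > 0, HasDerivAt h (x ^ α * H x) x)
    (hH : ∀ x > 0, HasDerivAt H (κ * x ^ α * h x) x) {x : ℝ} (hx : x ≠ 0) :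
    HasDerivAt (cutMomentum α h H)
      (|x| ^ (-α) * cutImage α h H x + κ * |x| ^ α * cutSolution h x) x := by
  have hd : ∀ y > 0, HasDerivAt (fun x => x ^ (-α) * deriv cutoff x * h x + cutoff x * H x)
      ((-α * y ^ (-α - 1) * deriv cutoff y + y ^ (-α) * deriv (deriv cutoff) y) * h y
        + y ^ (-α) * deriv cutoff y * (y ^ α * H y)
        + (deriv cutoff y * H y + cutoff y * (κ * y ^ α * h y))) y := fun y hy =>
    (((Real.hasDerivAt_rpow_const (Or.inl (ne_of_gt hy))).mul (hasDerivAt_deriv_cutoff y)).mul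
      (hh y hy)).add ((hasDerivAt_cutoff y).mul (hH y hy))
  refine (hasDerivAt_indicator_Ioi hd hx).congr_deriv ?_
  rcases lt_or_gt_of_ne hx with h0 | h0
  · simp [cutImage, cutSolution, h0.le]
  · have e : x ^ α * x ^ (-α) = 1 := by rw [← Real.rpow_add h0, add_neg_cancel, Real.rpow_zero]
    have e1 : x ^ (-α - 1) = x ^ (-α) / x := Real.rpow_sub_one h0.ne' _
    rw [cutImage, cutSolution, indicator_of_mem (mem_Ioi.2 h0), indicator_of_mem (mem_Ioi.2 h0),
      indicator_of_mem (mem_Ioi.2 h0), abs_of_pos h0, e1]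
    linear_combination -(deriv cutoff x * H x) * e

theorem memLp_cutSolution (hh : ContinuousOn h (Ioi 0))
    (hint : IntegrableOn (fun x => x ^ (-α) * h x ^ 2) (Ioc 0 2)) :
    MemLp (cutSolution h) 2 (lineMeasure α) := by
  have hm : AEStronglyMeasurable (cutSolution h) volume := by
    rw [cutSolution, aestronglyMeasurable_indicator_iff measurableSet_Ioi]
    exact (contDiff_cutoff.continuous.continuousOn.mul hh).aestronglyMeasurable measurableSet_Ioi
  rw [memLp_two_iff_integrable_sq (hm.mono_ac (lineMeasure_ac_volume α)),
    integrable_lineMeasure_iff]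
  refine ((integrable_indicator_iff measurableSet_Ioc).2 hint).mono ?_ ?_
  · have hw : Measurable fun x : ℝ => |x| ^ (-α) := by fun_prop
    exact hw.aestronglyMeasurable.smul (hm.pow 2)
  · refine Eventually.of_forall fun x => ?_
    by_cases hx : x ∈ Ioc (0 : ℝ) 2
    · have hx0 : 0 < x := hx.1
      have hp : 0 < x ^ (-α) := Real.rpow_pos_of_pos hx0 _
      rw [indicator_of_mem hx, cutSolution, indicator_of_mem (mem_Ioi.2 hx0), abs_of_pos hx0,
        smul_eq_mul, Real.norm_of_nonneg (by positivity), Real.norm_of_nonneg (by positivity)]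
      obtain ⟨c0, c1⟩ := cutoff_mem_Icc x
      have : cutoff x ^ 2 ≤ 1 := pow_le_one₀ c0 c1
      rw [mul_pow]
      exact mul_le_mul_of_nonneg_left (mul_le_of_le_one_left (sq_nonneg _) this) hp.le
    · have : cutSolution h x = 0 := by
        rw [cutSolution, indicator_apply_eq_zero]
        intro hx0
        have : 2 < x := by
          by_contra! h2
          exact hx ⟨hx0, h2⟩
        rw [cutoff_eq_zero this.le, zero_mul]
      rw [this, zero_pow two_ne_zero, smul_zero, norm_zero]
      exact norm_nonneg _

theorem cutImage_eq_zero {x : ℝ} (hx : x ∉ Icc (1 : ℝ) 2) : cutImage α h H x = 0 := by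
  rw [cutImage, indicator_apply_eq_zero]
  intro _
  rw [deriv_cutoff_eq_zero hx, deriv_deriv_cutoff_eq_zero hx]
  ring

/-- Only derivatives of the cutoff enter, so the image lives on `[1, 2]` and needs no integrability
at `0`. -/
theorem memLp_cutImage (hh : ContinuousOn h (Ioi 0)) (hH : ContinuousOn H (Ioi 0)) :
    MemLp (cutImage α h H) 2 (lineMeasure α) := by
  have hs : tsupport (cutImage α h H) ⊆ Icc 1 2 :=
    closure_minimal (fun x hx => by by_contra hx'; exact hx (cutImage_eq_zero hx')) isClosed_Icc
  have hc : HasCompactSupport (cutImage α h H) :=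
    isCompact_Icc.of_isClosed_subset (isClosed_tsupport _) hs
  refine memLp_of_compactSupport _ ?_ hc (lineMeasure_lt_top α hc fun x hx => ?_)
  · rw [continuous_iff_continuousAt]
    intro x
    rcases lt_or_ge x 1 with hx | hx
    · have : cutImage α h H =ᶠ[𝓝 x] fun _ => 0 := by
        filter_upwards [Iio_mem_nhds hx] with y hy
        exact cutImage_eq_zero fun h' => not_lt.2 h'.1 hy
      exact continuousAt_const.congr this.symm
    · have hx0 : 0 < x := by linarith
      have e : cutImage α h H =ᶠ[𝓝 x] fun x => (deriv (deriv cutoff) x - α / x * deriv cutoff x)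
          * h x + 2 * x ^ α * deriv cutoff x * H x := by
        filter_upwards [Ioi_mem_nhds hx0] with y hy
        exact indicator_of_mem hy _
      have n := Ioi_mem_nhds hx0
      have c1 := (hasDerivAt_deriv_cutoff x).continuousAt
      have c2 : ContinuousAt (deriv (deriv cutoff)) x :=
        (contDiff_infty_iff_deriv.1 contDiff_deriv_cutoff).2.continuous.continuousAt
      refine ContinuousAt.congr ?_ e.symm
      exact ((c2.sub ((continuousAt_const.div continuousAt_id hx0.ne').mul c1)).mul
        (hh.continuousAt n)).add (((continuousAt_const.mul
          (Real.continuousAt_rpow_const x α (Or.inl hx0.ne'))).mul c1).mul (hH.continuousAt n))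
  · have := (hs hx).1
    exact ne_of_gt (by linarith)

/-- The boundary form of two cut off solutions is their Wronskian, up to sign. -/
theorem integral_cutSolution_mul_sub {h₁ H₁ h₂ H₂ : ℝ → ℝ} {c : ℝ}
    (hc : ∀ x > 0, h₁ x * H₂ x - h₂ x * H₁ x = c) :
    ∫ x, (cutSolution h₁ x * cutImage α h₂ H₂ x - cutImage α h₁ H₁ x * cutSolution h₂ x)
      ∂(lineMeasure α) = -c := by
  have e : ∀ x, |x| ^ (-α) • (cutSolution h₁ x * cutImage α h₂ H₂ x
      - cutImage α h₁ H₁ x * cutSolution h₂ x) = c * (2 * cutoff x * deriv cutoff x) := by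
    intro x
    rcases le_or_gt x 0 with hx | hx
    · rw [deriv_cutoff_eq_zero fun h' => by linarith [h'.1]]
      simp [cutSolution, cutImage, hx]
    · have e1 : x ^ (-α) * x ^ α = 1 := by rw [← Real.rpow_add hx, neg_add_cancel, Real.rpow_zero]
      simp only [cutSolution, cutImage, indicator_of_mem (mem_Ioi.2 hx), abs_of_pos hx, smul_eq_mul]
      rw [← hc x hx]
      linear_combination (2 * cutoff x * deriv cutoff x * (h₁ x * H₂ x - h₂ x * H₁ x)) * e1
  rw [integral_lineMeasure]
  simp only [e]
  rw [integral_const_mul, integral_cutoff_mul_deriv, mul_neg_one]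

/-- Two elements of the domain of the adjoint of `Δ̂_k` on which the boundary form does not
vanish. -/
structure BoundaryPair (α : ℝ) (k : ℤ) (u₁ U₁ f₁ u₂ U₂ f₂ : ℝ → ℝ) : Prop where
  memLp₁ : MemLp u₁ 2 (lineMeasure α)
  memLp_image₁ : MemLp f₁ 2 (lineMeasure α)
  memLp₂ : MemLp u₂ 2 (lineMeasure α)
  memLp_image₂ : MemLp f₂ 2 (lineMeasure α)
  hasDerivAt₁ : ∀ x, x ≠ 0 → HasDerivAt u₁ (|x| ^ α * U₁ x) x
  hasDerivAt_momentum₁ : ∀ x, x ≠ 0 →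
    HasDerivAt U₁ (|x| ^ (-α) * f₁ x + (k : ℝ) ^ 2 * |x| ^ α * u₁ x) x
  hasDerivAt₂ : ∀ x, x ≠ 0 → HasDerivAt u₂ (|x| ^ α * U₂ x) x
  hasDerivAt_momentum₂ : ∀ x, x ≠ 0 →
    HasDerivAt U₂ (|x| ^ (-α) * f₂ x + (k : ℝ) ^ 2 * |x| ^ α * u₂ x) x
  integral_ne : ∫ x, f₁ x * u₂ x ∂(lineMeasure α) ≠ ∫ x, u₁ x * f₂ x ∂(lineMeasure α)

/-- The limit-circle mechanism: two solutions of `Δ̂_k h = 0`, both square integrable at `0`, have a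
constant Wronskian `c`, and the boundary form of their cut-offs differs from `c` only by sign. -/
theorem boundaryPair_of_solutions {k : ℤ} {h₁ H₁ h₂ H₂ : ℝ → ℝ} {c : ℝ} (hc0 : c ≠ 0)
    (hh₁ : ∀ x > 0, HasDerivAt h₁ (x ^ α * H₁ x) x)
    (hH₁ : ∀ x > 0, HasDerivAt H₁ ((k : ℝ) ^ 2 * x ^ α * h₁ x) x)
    (hh₂ : ∀ x > 0, HasDerivAt h₂ (x ^ α * H₂ x) x)
    (hH₂ : ∀ x > 0, HasDerivAt H₂ ((k : ℝ) ^ 2 * x ^ α * h₂ x) x)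
    (hi₁ : IntegrableOn (fun x => x ^ (-α) * h₁ x ^ 2) (Ioc 0 2))
    (hi₂ : IntegrableOn (fun x => x ^ (-α) * h₂ x ^ 2) (Ioc 0 2))
    (hc : ∀ x > 0, h₁ x * H₂ x - h₂ x * H₁ x = c) :
    BoundaryPair α k (cutSolution h₁) (cutMomentum α h₁ H₁) (cutImage α h₁ H₁)
      (cutSolution h₂) (cutMomentum α h₂ H₂) (cutImage α h₂ H₂) := by
  have ch₁ : ContinuousOn h₁ (Ioi 0) := fun x hx => (hh₁ x hx).continuousAt.continuousWithinAt
  have cH₁ : ContinuousOn H₁ (Ioi 0) := fun x hx => (hH₁ x hx).continuousAt.continuousWithinAt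
  have ch₂ : ContinuousOn h₂ (Ioi 0) := fun x hx => (hh₂ x hx).continuousAt.continuousWithinAt
  have cH₂ : ContinuousOn H₂ (Ioi 0) := fun x hx => (hH₂ x hx).continuousAt.continuousWithinAt
  have m₁ := memLp_cutSolution ch₁ hi₁
  have m₂ := memLp_cutSolution ch₂ hi₂
  have n₁ : MemLp (cutImage α h₁ H₁) 2 (lineMeasure α) := memLp_cutImage ch₁ cH₁
  have n₂ : MemLp (cutImage α h₂ H₂) 2 (lineMeasure α) := memLp_cutImage ch₂ cH₂
  refine ⟨m₁, n₁, m₂, n₂, fun x hx => hasDerivAt_cutSolution hh₁ hx,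
    fun x hx => hasDerivAt_cutMomentum hh₁ hH₁ hx, fun x hx => hasDerivAt_cutSolution hh₂ hx,
    fun x hx => hasDerivAt_cutMomentum hh₂ hH₂ hx, fun heq => ?_⟩
  have h1 := integral_cutSolution_mul_sub (α := α) hc
  have i₁ : Integrable (fun x => cutSolution h₁ x * cutImage α h₂ H₂ x) (lineMeasure α) :=
    m₁.integrable_mul n₂
  have i₂ : Integrable (fun x => cutImage α h₁ H₁ x * cutSolution h₂ x) (lineMeasure α) :=
    n₁.integrable_mul m₂
  rw [integral_sub i₁ i₂, heq, sub_self] at h1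
  exact hc0 (neg_eq_zero.1 h1.symm)

/-! ### Explicit solutions near the singularity. -/

/-- A primitive of `x ^ α` on `(0, ∞)`. -/
noncomputable def rpowPrimitive (α x : ℝ) : ℝ :=
  if α = -1 then Real.log x else x ^ (α + 1) / (α + 1)

theorem hasDerivAt_rpowPrimitive (α : ℝ) {x : ℝ} (hx : 0 < x) :
    HasDerivAt (rpowPrimitive α) (x ^ α) x := by
  by_cases h : α = -1
  · have e : rpowPrimitive α = Real.log := funext fun y => by simp [rpowPrimitive, h]
    rw [e, h, Real.rpow_neg_one]
    exact Real.hasDerivAt_log hx.ne'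
  · have e : rpowPrimitive α = fun y => y ^ (α + 1) / (α + 1) :=
      funext fun y => by simp [rpowPrimitive, h]
    have h' : α + 1 ≠ 0 := fun h0 => h (by linarith)
    rw [e]
    refine ((Real.hasDerivAt_rpow_const (p := α + 1) (Or.inl hx.ne')).div_const
      (α + 1)).congr_deriv ?_
    rw [add_sub_cancel_right]
    field_simp

theorem integrableOn_rpow_Ioc {β : ℝ} (hβ : -1 < β) :
    IntegrableOn (fun x : ℝ => x ^ β) (Ioc 0 2) :=
  (intervalIntegrable_iff_integrableOn_Ioc_of_le (by norm_num)).1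
    (intervalIntegral.intervalIntegrable_rpow' hβ)

/-- For `α < 1` the weight itself is integrable at `0`. -/
theorem integrableOn_of_bounded_on_Ioc {α C : ℝ} (hα : α < 1) {h : ℝ → ℝ}
    (hh : ContinuousOn h (Ioi 0)) (hC : ∀ x ∈ Ioc (0 : ℝ) 2, h x ^ 2 ≤ C) :
    IntegrableOn (fun x => x ^ (-α) * h x ^ 2) (Ioc 0 2) := by
  refine ((integrableOn_rpow_Ioc (β := -α) (by linarith)).const_mul C).mono' ?_ ?_
  · refine ContinuousOn.aestronglyMeasurable ?_ measurableSet_Ioc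
    exact ((contDiffOn_rpow_Ioi (-α)).continuousOn.mul (hh.pow 2)).mono fun x hx => hx.1
  · filter_upwards [ae_restrict_mem measurableSet_Ioc] with x hx
    have hp : 0 < x ^ (-α) := Real.rpow_pos_of_pos hx.1 _
    rw [Real.norm_of_nonneg (by positivity), mul_comm]
    exact mul_le_mul_of_nonneg_right (hC x hx) hp.le

theorem mul_log_sq_le {x : ℝ} (hx : x ∈ Ioc (0 : ℝ) 2) : x * Real.log x ^ 2 ≤ 4 := by
  have hx0 : 0 < x := hx.1
  rcases le_or_gt 1 x with h1 | h1
  · have h2 := Real.log_nonneg h1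
    have h3 := Real.log_le_sub_one_of_pos hx0
    have h4 : Real.log x ^ 2 ≤ 1 := pow_le_one₀ h2 (by linarith [hx.2])
    nlinarith [hx.2]
  · have hs := Real.sqrt_pos.2 hx0
    -- Applied to `√x`, the bound `1 - 1/y ≤ log y` gives `-log x ≤ 2/√x`, whose square is exactly
    -- cancelled by `x`.
    have h2 := Real.one_sub_inv_le_log_of_pos hs
    rw [Real.log_sqrt hx0.le] at h2
    have h3 := Real.log_neg hx0 h1
    have h4 : -Real.log x ≤ 2 * (√x)⁻¹ := by linarith
    have h5 : Real.log x ^ 2 ≤ (2 * (√x)⁻¹) ^ 2 := by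
      rw [← neg_sq (Real.log x)]
      exact pow_le_pow_left₀ (by linarith) h4 2
    calc x * Real.log x ^ 2 ≤ x * (2 * (√x)⁻¹) ^ 2 := mul_le_mul_of_nonneg_left h5 hx0.le
      _ = 4 * (x * (√x ^ 2)⁻¹) := by ring
      _ = 4 := by rw [Real.sq_sqrt hx0.le, mul_inv_cancel₀ hx0.ne', mul_one]

/-- For `α ≠ -1` the integrand is a multiple of `x^{α+2}`, which is where the threshold `-3` comes
from. At `α = -1` it is `x log² x`, which is bounded. -/
theorem integrableOn_rpowPrimitive (hα : -3 < α) :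
    IntegrableOn (fun x => x ^ (-α) * rpowPrimitive α x ^ 2) (Ioc 0 2) := by
  by_cases h : α = -1
  · refine Integrable.mono' (g := fun _ => 4) (integrable_const 4) ?_ ?_
    · refine ContinuousOn.aestronglyMeasurable (fun x hx => ?_) measurableSet_Ioc
      exact ((Real.continuousAt_rpow_const x (-α) (Or.inl hx.1.ne')).mul
        ((hasDerivAt_rpowPrimitive α hx.1).continuousAt.pow 2)).continuousWithinAt
    · filter_upwards [ae_restrict_mem measurableSet_Ioc] with x hx
      have hx0 : 0 < x := hx.1
      have e : x ^ (-α) * rpowPrimitive α x ^ 2 = x * Real.log x ^ 2 := by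
        simp [rpowPrimitive, h]
      rw [e, Real.norm_of_nonneg (by positivity)]
      exact mul_log_sq_le hx
  · have hi : IntegrableOn (fun x : ℝ => ((α + 1) ^ 2)⁻¹ * x ^ (α + 2)) (Ioc 0 2) :=
      (integrableOn_rpow_Ioc (β := α + 2) (by linarith)).const_mul _
    refine hi.congr_fun (fun x hx => ?_) measurableSet_Ioc
    have hx0 : 0 < x := hx.1
    have e : x ^ (-α) * (x ^ (α + 1)) ^ 2 = x ^ (α + 2) := by
      rw [← Real.rpow_natCast, ← Real.rpow_mul hx0.le, ← Real.rpow_add hx0]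
      congr 1
      push_cast
      ring
    simp only [rpowPrimitive, if_neg h, div_pow]
    rw [← e]
    ring

/-- The solutions are `1`, with momentum `0`, and the primitive of `x^α`, with momentum `1`; their
Wronskian is `1`. -/
theorem exists_boundaryPair_zero (hα : -3 < α) (hα' : α < 1) :
    ∃ u₁ U₁ f₁ u₂ U₂ f₂, BoundaryPair α 0 u₁ U₁ f₁ u₂ U₂ f₂ :=
  ⟨_, _, _, _, _, _, boundaryPair_of_solutions (h₁ := fun _ => 1) (H₁ := fun _ => 0)
    (h₂ := rpowPrimitive α) (H₂ := fun _ => 1) (c := 1) one_ne_zero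
    (fun x _ => (hasDerivAt_const x (1 : ℝ)).congr_deriv (by simp))
    (fun x _ => (hasDerivAt_const x (0 : ℝ)).congr_deriv (by simp))
    (fun x hx => (hasDerivAt_rpowPrimitive α hx).congr_deriv (by simp))
    (fun x _ => (hasDerivAt_const x (1 : ℝ)).congr_deriv (by simp))
    (integrableOn_of_bounded_on_Ioc (C := 1) hα' continuousOn_const (by simp))
    (integrableOn_rpowPrimitive hα) (by simp)⟩

/-- In the variable `P = x^{α+1} / (α+1)` the equation reads `h'' = k² h`, solved by `exp (± k P)`
with Wronskian `-2k`. For `α > -1` the variable `P` is bounded on `(0, 2]`, hence so are both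
solutions. -/
theorem exists_boundaryPair_of_ne_zero (hα : -1 < α) (hα' : α < 1) {k : ℤ} (hk : k ≠ 0) :
    ∃ u₁ U₁ f₁ u₂ U₂ f₂, BoundaryPair α k u₁ U₁ f₁ u₂ U₂ f₂ := by
  have hd : ∀ m : ℝ, ∀ x > 0, HasDerivAt (fun x => Real.exp (m * rpowPrimitive α x))
      (x ^ α * (m * Real.exp (m * rpowPrimitive α x))) x := fun m x hx =>
    (((hasDerivAt_rpowPrimitive α hx).const_mul m).exp).congr_deriv (by ring)
  have hd' : ∀ m : ℝ, m ^ 2 = (k : ℝ) ^ 2 → ∀ x > 0,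
      HasDerivAt (fun x => m * Real.exp (m * rpowPrimitive α x))
        ((k : ℝ) ^ 2 * x ^ α * Real.exp (m * rpowPrimitive α x)) x := fun m hm x hx =>
    ((hd m x hx).const_mul m).congr_deriv (by rw [← hm]; ring)
  have hb : ∀ x ∈ Ioc (0 : ℝ) 2, |rpowPrimitive α x| ≤ 2 ^ (α + 1) / (α + 1) := by
    intro x hx
    have h0 : 0 < α + 1 := by linarith
    have h1 : 0 ≤ x ^ (α + 1) := Real.rpow_nonneg hx.1.le _
    rw [rpowPrimitive, if_neg (by linarith), abs_of_nonneg (by positivity)]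
    have := Real.rpow_le_rpow hx.1.le hx.2 h0.le
    gcongr
  have hi : ∀ m : ℝ, IntegrableOn
      (fun x => x ^ (-α) * Real.exp (m * rpowPrimitive α x) ^ 2) (Ioc 0 2) := by
    intro m
    refine integrableOn_of_bounded_on_Ioc (C := Real.exp (|m| * (2 ^ (α + 1) / (α + 1))) ^ 2) hα'
      (fun x hx => (hd m x hx).continuousAt.continuousWithinAt) fun x hx => ?_
    refine pow_le_pow_left₀ (Real.exp_pos _).le (Real.exp_le_exp.2 ?_) 2
    refine (le_abs_self _).trans ?_
    rw [abs_mul]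
    exact mul_le_mul_of_nonneg_left (hb x hx) (abs_nonneg m)
  refine ⟨_, _, _, _, _, _, boundaryPair_of_solutions (c := -2 * k)
    (mul_ne_zero (by norm_num) (by exact_mod_cast hk))
    (hd k) (hd' k rfl) (hd (-k)) (hd' (-k) (by ring)) (hi k) (hi (-k)) fun x _ => ?_⟩
  have e : Real.exp (k * rpowPrimitive α x) * Real.exp (-k * rpowPrimitive α x) = 1 := by
    rw [← Real.exp_add, neg_mul, add_neg_cancel, Real.exp_zero]
  linear_combination (-2 * (k : ℝ)) * e

theorem inner_ofReal_ofReal (a b : ℝ) :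
    inner 𝕜 ((a : ℝ) : 𝕜) ((b : ℝ) : 𝕜) = ((a * b : ℝ) : 𝕜) := by
  rw [inner_ofReal_left, RCLike.real_smul_eq_coe_mul, RCLike.ofReal_mul]

theorem BoundaryPair.not_essentiallySelfAdjoint {k : ℤ} {u₁ U₁ f₁ u₂ U₂ f₂ : ℝ → ℝ}
    (hp : BoundaryPair α k u₁ U₁ f₁ u₂ U₂ f₂) :
    ¬ EssentiallySelfAdjoint (fourierComponent 𝕜 α k) := by
  intro hA
  have h1 := integral_inner_eq_of_essentiallySelfAdjoint hA (hp.memLp₁.ofReal (K := 𝕜))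
    (hp.memLp_image₁.ofReal (K := 𝕜)) (hp.memLp₂.ofReal (K := 𝕜)) (hp.memLp_image₂.ofReal (K := 𝕜))
    (fun φ => integral_inner_fourierExpr_of_classical hp.memLp₁ hp.memLp_image₁ hp.hasDerivAt₁
      hp.hasDerivAt_momentum₁ φ.2)
    (fun φ => integral_inner_fourierExpr_of_classical hp.memLp₂ hp.memLp_image₂ hp.hasDerivAt₂
      hp.hasDerivAt_momentum₂ φ.2)
  simp only [inner_ofReal_ofReal, integral_ofReal] at h1
  exact hp.integral_ne (RCLike.ofReal_injective h1)

end LimitCircle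

/-! ### Green's identities on the surface -/

section Surface

variable {𝕜 : Type*} [RCLike 𝕜]

theorem partialX_mem_testSurface {f : ℝ × Torus → 𝕜} (hf : f ∈ testSurface 𝕜) :
    partialX f ∈ testSurface 𝕜 :=
  ⟨contDiff_lift_partialX hf.1, hf.2.1.of_isClosed_subset (isClosed_tsupport _)
    (tsupport_partialX f), (tsupport_partialX f).trans hf.2.2⟩

theorem partialTheta_mem_testSurface {f : ℝ × Torus → 𝕜} (hf : f ∈ testSurface 𝕜) :
    partialTheta f ∈ testSurface 𝕜 :=
  ⟨contDiff_lift_partialTheta hf.1, hf.2.1.of_isClosed_subset (isClosed_tsupport _)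
    (tsupport_partialTheta f), (tsupport_partialTheta f).trans hf.2.2⟩

theorem slice_mem_testLine {f : ℝ × Torus → 𝕜} (hf : f ∈ testSurface 𝕜) (θ : Torus) :
    (fun x => f (x, θ)) ∈ testLine 𝕜 := by
  have hc : Continuous fun x : ℝ => (x, θ) := by fun_prop
  have hs : tsupport (fun x => f (x, θ)) ⊆ (fun x : ℝ => (x, θ)) ⁻¹' tsupport f :=
    tsupport_comp_subset_preimage f hc
  refine ⟨?_, ?_, fun x hx => hf.2.2 (hs hx)⟩
  · induction θ using QuotientAddGroup.induction_on with
    | H t => exact hf.1.comp (contDiff_id.prodMk contDiff_const)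
  · refine (hf.2.1.isCompact.image continuous_fst).of_isClosed_subset (isClosed_tsupport _) ?_
    exact fun x hx => ⟨(x, θ), hs hx, rfl⟩

theorem memLp_of_mem_testSurface (α : ℝ) {f : ℝ × Torus → 𝕜} (hf : f ∈ testSurface 𝕜) :
    MemLp f 2 (riemannianMeasure α) :=
  testSurface_memLp 𝕜 α ⟨f, hf⟩

theorem memLp_laplaceExpr (α : ℝ) {f : ℝ × Torus → 𝕜} (hf : f ∈ testSurface 𝕜) :
    MemLp (laplaceExpr α f) 2 (riemannianMeasure α) :=
  laplaceMap_memLp 𝕜 α ⟨f, hf⟩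

theorem memLp_rpow_smul (α : ℝ) {f : ℝ × Torus → 𝕜} (hf : f ∈ testSurface 𝕜) :
    MemLp (fun p => (|p.1| ^ (2 * α)) • f p) 2 (riemannianMeasure α) := by
  have hs : tsupport (fun p => (|p.1| ^ (2 * α)) • f p) ⊆ tsupport f :=
    tsupport_smul_subset_right _ _
  have hc : HasCompactSupport (fun p => (|p.1| ^ (2 * α)) • f p) :=
    hf.2.1.of_isClosed_subset (isClosed_tsupport _) hs
  refine memLp_of_compactSupport _ ?_ hc (riemannianMeasure_lt_top α hc (hs.trans hf.2.2))
  rw [continuous_iff_continuousAt]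
  intro p
  by_cases hp : p.1 = 0
  · exact continuousAt_const.congr
      (notMem_tsupport_iff_eventuallyEq.1 fun h => hf.2.2 (hs h) hp).symm
  · exact ((continuousAt_fst.abs).rpow_const (Or.inl (abs_ne_zero.2 hp))).smul
      (continuous_of_lift hf.1.continuous).continuousAt

/-- Splits `Δ` into the `k = 0` operator on each slice and an angular term, so that each can be
integrated by parts in its own variable. -/
theorem laplaceExpr_eq_add (α : ℝ) (f : ℝ × Torus → 𝕜) (p : ℝ × Torus) :
    laplaceExpr α f p = fourierExpr α 0 (fun x => f (x, p.2)) p.1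
      + (|p.1| ^ (2 * α)) • partialTheta (partialTheta f) p := by
  have h : fourierExpr α 0 (fun x => f (x, p.2)) p.1
      = partialX (partialX f) p - (α / p.1) • partialX f p := by
    simp only [fourierExpr, Int.cast_zero, ne_eq, OfNat.ofNat_ne_zero, not_false_eq_true, zero_pow,
      zero_mul, zero_smul, sub_zero]
    rfl
  rw [laplaceExpr, h]
  abel

theorem memLp_radial (α : ℝ) {f : ℝ × Torus → 𝕜} (hf : f ∈ testSurface 𝕜) :
    MemLp (fun p : ℝ × Torus => fourierExpr α 0 (fun x => f (x, p.2)) p.1) 2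
      (riemannianMeasure α) := by
  refine ((memLp_laplaceExpr α hf).sub (memLp_rpow_smul α (partialTheta_mem_testSurface
    (partialTheta_mem_testSurface hf)))).ae_eq (Eventually.of_forall fun p => ?_)
  rw [Pi.sub_apply, laplaceExpr_eq_add, add_sub_cancel_right]

theorem hasDerivAt_torus_coe {E : Type*} [NormedAddCommGroup E] [NormedSpace ℝ E]
    {F F' : Torus → E} (hF : ∀ θ : Torus, HasDerivAt (fun t : ℝ => F (θ + (t : Torus))) (F' θ) 0)
    (t : ℝ) : HasDerivAt (fun s : ℝ => F (s : Torus)) (F' (t : Torus)) t := by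
  have h : HasDerivAt (fun s : ℝ => F ((t : Torus) + (s : Torus))) (F' (t : Torus)) (t - t) := by
    rw [sub_self]; exact hF t
  refine (h.comp_sub_const t t).congr_of_eventuallyEq (Eventually.of_forall fun s => ?_)
  simp only
  rw [← AddCircle.coe_add, add_sub_cancel]

/-- The integral of a derivative over the circle vanishes. -/
theorem integral_torus_deriv_eq_zero {E : Type*} [NormedAddCommGroup E] [NormedSpace ℝ E]
    [CompleteSpace E] {F F' : Torus → E}
    (hF : ∀ θ : Torus, HasDerivAt (fun t : ℝ => F (θ + (t : Torus))) (F' θ) 0)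
    (hc : Continuous F') : ∫ θ, F' θ = 0 := by
  have hcoe : Continuous fun t : ℝ => (t : Torus) := AddCircle.continuous_mk' _
  rw [← AddCircle.intervalIntegral_preimage (2 * Real.pi) 0,
    intervalIntegral.integral_eq_sub_of_hasDerivAt (fun t _ => hasDerivAt_torus_coe hF t)
      ((hc.comp hcoe).intervalIntegrable _ _)]
  rw [zero_add, AddCircle.coe_period, AddCircle.coe_zero, sub_self]

theorem continuous_slice_torus {f : ℝ × Torus → 𝕜} (hf : f ∈ testSurface 𝕜) (x : ℝ) :
    Continuous fun θ : Torus => f (x, θ) :=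
  (continuous_of_lift hf.1.continuous).comp (by fun_prop)

/-- Integrating over the circle first, the weight `|x|^{2α}` is a constant and the sum of the two
integrands is a `θ`-derivative. -/
theorem integral_inner_rpow_smul_partialTheta (α : ℝ) {f g : ℝ × Torus → 𝕜}
    (hf : f ∈ testSurface 𝕜) (hg : g ∈ testSurface 𝕜) :
    ∫ p, inner 𝕜 ((|p.1| ^ (2 * α)) • partialTheta (partialTheta f) p) (g p) ∂(riemannianMeasure α)
      = - ∫ p, inner 𝕜 ((|p.1| ^ (2 * α)) • partialTheta f p) (partialTheta g p)
        ∂(riemannianMeasure α) := by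
  have hf1 := partialTheta_mem_testSurface hf
  have hf2 := partialTheta_mem_testSurface hf1
  have hg1 := partialTheta_mem_testSurface hg
  have i1 := integrable_inner_of_memLp (memLp_rpow_smul α hf2) (memLp_of_mem_testSurface α hg)
  have i2 := integrable_inner_of_memLp (memLp_rpow_smul α hf1) (memLp_of_mem_testSurface α hg1)
  rw [eq_neg_iff_add_eq_zero, add_comm, ← integral_add i2 i1]
  refine (integral_prod _ (i2.add i1)).trans ?_
  refine integral_eq_zero_of_ae (Eventually.of_forall fun x => ?_)
  refine integral_torus_deriv_eq_zero
    (F := fun θ => inner 𝕜 ((|x| ^ (2 * α)) • partialTheta f (x, θ)) (g (x, θ))) (fun θ => ?_) ?_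
  · have h1 := (hasDerivAt_partialTheta hf1.1 (x, θ)).const_smul (|x| ^ (2 * α))
    have h2 := hasDerivAt_partialTheta hg.1 (x, θ)
    have h3 := HasDerivAt.inner 𝕜 h1 h2
    simpa using h3
  · exact (((continuous_slice_torus hf1 x).const_smul (|x| ^ (2 * α))).inner
      (continuous_slice_torus hg1 x)).add (((continuous_slice_torus hf2 x).const_smul
      (|x| ^ (2 * α))).inner (continuous_slice_torus hg x))

/-- Integrating over the line first, this is the one-dimensional Green identity on each slice. -/
theorem integral_inner_radial (α : ℝ) {f g : ℝ × Torus → 𝕜} (hf : f ∈ testSurface 𝕜)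
    (hg : g ∈ testSurface 𝕜) :
    ∫ p : ℝ × Torus, inner 𝕜 (fourierExpr α 0 (fun x => f (x, p.2)) p.1) (g p)
        ∂(riemannianMeasure α)
      = - ∫ p, inner 𝕜 (partialX f p) (partialX g p) ∂(riemannianMeasure α) := by
  have i1 := integrable_inner_of_memLp (memLp_radial α hf) (memLp_of_mem_testSurface α hg)
  have i2 := integrable_inner_of_memLp (memLp_of_mem_testSurface α (partialX_mem_testSurface hf))
    (memLp_of_mem_testSurface α (partialX_mem_testSurface hg))
  rw [integral_prod_symm _ i1, integral_prod_symm _ i2, ← integral_neg]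
  exact integral_congr_ae (Eventually.of_forall fun θ =>
    integral_inner_fourierExpr_zero α (slice_mem_testLine hf θ) (slice_mem_testLine hg θ))

/-- The Dirichlet form of `-Δ`. -/
noncomputable def surfaceForm (α : ℝ) (f g : testSurface 𝕜) : 𝕜 :=
  (∫ p, inner 𝕜 (partialX (f : ℝ × Torus → 𝕜) p) (partialX (g : ℝ × Torus → 𝕜) p)
      ∂(riemannianMeasure α)) +
    ∫ p, inner 𝕜 ((|p.1| ^ (2 * α)) • partialTheta (f : ℝ × Torus → 𝕜) p)
      (partialTheta (g : ℝ × Torus → 𝕜) p) ∂(riemannianMeasure α)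

theorem integral_inner_laplaceMap (α : ℝ) (f g : testSurface 𝕜) :
    ∫ p, inner 𝕜 (laplaceMap 𝕜 α f p) ((g : ℝ × Torus → 𝕜) p) ∂(riemannianMeasure α)
      = - surfaceForm α f g := by
  have e : ∀ p, inner 𝕜 (laplaceMap 𝕜 α f p) ((g : ℝ × Torus → 𝕜) p)
      = inner 𝕜 (fourierExpr α 0 (fun x => (f : ℝ × Torus → 𝕜) (x, p.2)) p.1)
          ((g : ℝ × Torus → 𝕜) p)
        + inner 𝕜 ((|p.1| ^ (2 * α)) • partialTheta (partialTheta (f : ℝ × Torus → 𝕜)) p)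
          ((g : ℝ × Torus → 𝕜) p) := fun p => by
    rw [← inner_add_left, ← laplaceExpr_eq_add]
    rfl
  have hf2 := partialTheta_mem_testSurface (partialTheta_mem_testSurface f.2)
  simp only [e]
  rw [integral_add (integrable_inner_of_memLp (memLp_radial α f.2)
      (memLp_of_mem_testSurface α g.2)) (integrable_inner_of_memLp (memLp_rpow_smul α hf2)
      (memLp_of_mem_testSurface α g.2)), integral_inner_radial α f.2 g.2,
    integral_inner_rpow_smul_partialTheta α f.2 g.2, surfaceForm]
  ring

theorem surfaceForm_conj (α : ℝ) (f g : testSurface 𝕜) :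
    surfaceForm α g f = (starRingEnd 𝕜) (surfaceForm α f g) := by
  rw [surfaceForm, surfaceForm, map_add, ← integral_conj, ← integral_conj]
  congr 1
  · simp only [inner_conj_symm]
  · exact integral_congr_ae (Eventually.of_forall fun x => inner_real_smul_symm _ _ _)

theorem surfaceForm_nonneg (α : ℝ) (f : testSurface 𝕜) : 0 ≤ RCLike.re (surfaceForm α f f) := by
  rw [surfaceForm, map_add]
  have hf1 := partialTheta_mem_testSurface f.2
  exact add_nonneg
    (re_integral_inner_self_nonneg (memLp_of_mem_testSurface α (partialX_mem_testSurface f.2)))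
    (re_integral_inner_smul_self_nonneg (fun p => by positivity) (memLp_rpow_smul α hf1)
      (memLp_of_mem_testSurface α hf1))

/-- Rotationally invariant elements of the domain of the adjoint of `Δ`. -/
theorem integral_inner_laplaceExpr_of_classical {α : ℝ} {u U f : ℝ → ℝ}
    (hu : MemLp u 2 (lineMeasure α)) (hf : MemLp f 2 (lineMeasure α))
    (hdu : ∀ x, x ≠ 0 → HasDerivAt u (|x| ^ α * U x) x)
    (hdU : ∀ x, x ≠ 0 →
      HasDerivAt U (|x| ^ (-α) * f x + ((0 : ℤ) : ℝ) ^ 2 * |x| ^ α * u x) x)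
    {φ : ℝ × Torus → 𝕜} (hφ : φ ∈ testSurface 𝕜) :
    ∫ p, inner 𝕜 ((f p.1 : ℝ) : 𝕜) (φ p) ∂(riemannianMeasure α)
      = ∫ p, inner 𝕜 ((u p.1 : ℝ) : 𝕜) (laplaceExpr α φ p) ∂(riemannianMeasure α) := by
  have hu' := (hu.ofReal (K := 𝕜)).comp_fst (volume : Measure Torus)
  have hf' := (hf.ofReal (K := 𝕜)).comp_fst (volume : Measure Torus)
  have hφ1 := partialTheta_mem_testSurface hφ
  have hφ2 := partialTheta_mem_testSurface hφ1
  have i1 := integrable_inner_of_memLp hu' (memLp_radial α hφ)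
  have i2 := integrable_inner_of_memLp hu' (memLp_rpow_smul α hφ2)
  have i3 := integrable_inner_of_memLp hf' (memLp_of_mem_testSurface α hφ)
  simp only [laplaceExpr_eq_add, inner_add_right]
  rw [integral_add i1 i2, integral_prod_symm _ i1, integral_prod_symm _ i3, integral_prod _ i2]
  -- Since `u` does not depend on `θ`, the angular term is a `θ`-derivative and drops out; the rest
  -- is the line identity on each slice.
  have hz : ∫ x, ∫ θ : Torus, inner 𝕜 ((u x : ℝ) : 𝕜)
      ((|x| ^ (2 * α)) • partialTheta (partialTheta φ) (x, θ)) ∂volume ∂(lineMeasure α) = 0 := by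
    refine integral_eq_zero_of_ae (Eventually.of_forall fun x => ?_)
    refine integral_torus_deriv_eq_zero (F := fun θ => inner 𝕜 ((u x : ℝ) : 𝕜)
      ((|x| ^ (2 * α)) • partialTheta φ (x, θ))) (fun θ => ?_) ?_
    · have h1 := (hasDerivAt_partialTheta hφ1.1 (x, θ)).const_smul (|x| ^ (2 * α))
      have h3 := HasDerivAt.inner 𝕜 (hasDerivAt_const (0 : ℝ) ((u x : ℝ) : 𝕜)) h1
      simpa using h3
    · exact continuous_const.inner ((continuous_slice_torus hφ2 x).const_smul (|x| ^ (2 * α)))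
  rw [hz, add_zero]
  exact integral_congr_ae (Eventually.of_forall fun θ =>
    integral_inner_fourierExpr_of_classical hu hf hdu hdU (slice_mem_testLine hφ θ))

/-- For rotationally invariant functions every integral is the line integral times the length of the
circle, so the boundary form remains nonzero. -/
theorem BoundaryPair.not_essentiallySelfAdjoint_laplaceBeltrami {α : ℝ}
    {u₁ U₁ f₁ u₂ U₂ f₂ : ℝ → ℝ} (hp : BoundaryPair α 0 u₁ U₁ f₁ u₂ U₂ f₂) :
    ¬ EssentiallySelfAdjoint (laplaceBeltrami 𝕜 α) := by
  intro hA
  have hm : ∀ {u : ℝ → ℝ}, MemLp u 2 (lineMeasure α) →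
      MemLp (fun p : ℝ × Torus => ((u p.1 : ℝ) : 𝕜)) 2 (riemannianMeasure α) := fun hu =>
    (hu.ofReal (K := 𝕜)).comp_fst (volume : Measure Torus)
  have h1 := integral_inner_eq_of_essentiallySelfAdjoint hA (hm hp.memLp₁)
    (hm hp.memLp_image₁) (hm hp.memLp₂) (hm hp.memLp_image₂)
    (fun φ => integral_inner_laplaceExpr_of_classical hp.memLp₁ hp.memLp_image₁ hp.hasDerivAt₁
      hp.hasDerivAt_momentum₁ φ.2)
    (fun φ => integral_inner_laplaceExpr_of_classical hp.memLp₂ hp.memLp_image₂ hp.hasDerivAt₂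
      hp.hasDerivAt_momentum₂ φ.2)
  simp only [inner_ofReal_ofReal, integral_ofReal] at h1
  have h2 := RCLike.ofReal_injective h1
  rw [integral_fun_fst (fun x => f₁ x * u₂ x), integral_fun_fst (fun x => u₁ x * f₂ x)] at h2
  have hT : (volume : Measure Torus).real univ ≠ 0 := by
    rw [Measure.real, AddCircle.measure_univ, ENNReal.toReal_ofReal Real.two_pi_pos.le]
    exact Real.two_pi_pos.ne'
  exact hp.integral_ne (smul_right_injective ℝ hT h2)

end Surface

/-! ### Fourier decomposition on the surface -/

section Fourier

variable {𝕜 : Type*} [RCLike 𝕜]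

/-- `cos (k θ)` on the circle. -/
noncomputable def torusCos (k : ℤ) (θ : Torus) : ℝ := (fourier k θ).re

/-- `sin (k θ)` on the circle. -/
noncomputable def torusSin (k : ℤ) (θ : Torus) : ℝ := (fourier k θ).im

theorem fourier_torus_coe (k : ℤ) (t : ℝ) :
    fourier k (t : Torus) = Complex.exp (((k * t : ℝ) : ℂ) * Complex.I) := by
  rw [fourier_coe_apply]
  congr 1
  have : (Real.pi : ℂ) ≠ 0 := by exact_mod_cast Real.pi_ne_zero
  push_cast
  field_simp

theorem torusCos_coe (k : ℤ) (t : ℝ) : torusCos k (t : Torus) = Real.cos (k * t) := by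
  rw [torusCos, fourier_torus_coe, Complex.exp_ofReal_mul_I_re]

theorem torusSin_coe (k : ℤ) (t : ℝ) : torusSin k (t : Torus) = Real.sin (k * t) := by
  rw [torusSin, fourier_torus_coe, Complex.exp_ofReal_mul_I_im]

/-- A smooth real function `e` on the circle with `e'' = -k² e`; its derivative is `e'`. -/
structure TorusMode (k : ℤ) (e e' : Torus → ℝ) : Prop where
  contDiff : ContDiff ℝ ∞ fun t : ℝ => e (t : Torus)
  hasDerivAt : ∀ θ : Torus, HasDerivAt (fun t : ℝ => e (θ + (t : Torus))) (e' θ) 0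
  hasDerivAt_deriv : ∀ θ : Torus,
    HasDerivAt (fun t : ℝ => e' (θ + (t : Torus))) (-(k : ℝ) ^ 2 * e θ) 0
  abs_le : ∀ θ, |e θ| ≤ 1

theorem hasDerivAt_cos_mul (k t : ℝ) :
    HasDerivAt (fun s : ℝ => Real.cos (k * (t + s))) (-k * Real.sin (k * t)) 0 := by
  have h := (((hasDerivAt_id (0 : ℝ)).const_add t).const_mul k).cos
  refine h.congr_deriv ?_
  simp only [id, add_zero]
  ring

theorem hasDerivAt_sin_mul (k t : ℝ) :
    HasDerivAt (fun s : ℝ => Real.sin (k * (t + s))) (k * Real.cos (k * t)) 0 := by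
  have h := (((hasDerivAt_id (0 : ℝ)).const_add t).const_mul k).sin
  refine h.congr_deriv ?_
  simp only [id, add_zero]
  ring

theorem hasDerivAt_torusCos (k : ℤ) (θ : Torus) :
    HasDerivAt (fun t : ℝ => torusCos k (θ + (t : Torus))) (-k * torusSin k θ) 0 := by
  induction θ using QuotientAddGroup.induction_on with
  | H t =>
    rw [torusSin_coe]
    refine (hasDerivAt_cos_mul k t).congr_of_eventuallyEq (Eventually.of_forall fun s => ?_)
    exact torusCos_coe k (t + s)

theorem hasDerivAt_torusSin (k : ℤ) (θ : Torus) :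
    HasDerivAt (fun t : ℝ => torusSin k (θ + (t : Torus))) (k * torusCos k θ) 0 := by
  induction θ using QuotientAddGroup.induction_on with
  | H t =>
    rw [torusCos_coe]
    refine (hasDerivAt_sin_mul k t).congr_of_eventuallyEq (Eventually.of_forall fun s => ?_)
    exact torusSin_coe k (t + s)

theorem torusMode_cos (k : ℤ) : TorusMode k (torusCos k) (fun θ => -k * torusSin k θ) := by
  refine ⟨?_, hasDerivAt_torusCos k, fun θ => ?_, fun θ => ?_⟩
  · simp only [torusCos_coe]
    exact Real.contDiff_cos.comp (contDiff_const.mul contDiff_id)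
  · exact ((hasDerivAt_torusSin k θ).const_mul (-(k : ℝ))).congr_deriv (by ring)
  · induction θ using QuotientAddGroup.induction_on with
    | H t => rw [torusCos_coe]; exact Real.abs_cos_le_one _

theorem torusMode_sin (k : ℤ) : TorusMode k (torusSin k) (fun θ => k * torusCos k θ) := by
  refine ⟨?_, hasDerivAt_torusSin k, fun θ => ?_, fun θ => ?_⟩
  · simp only [torusSin_coe]
    exact Real.contDiff_sin.comp (contDiff_const.mul contDiff_id)
  · exact ((hasDerivAt_torusCos k θ).const_mul (k : ℝ)).congr_deriv (by ring)
  · induction θ using QuotientAddGroup.induction_on with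
    | H t => rw [torusSin_coe]; exact Real.abs_sin_le_one _

variable {k : ℤ} {e e' : Torus → ℝ}

theorem TorusMode.continuous (he : TorusMode k e e') : Continuous e :=
  QuotientAddGroup.isOpenQuotientMap_mk.isQuotientMap.continuous_iff.2 he.contDiff.continuous

theorem TorusMode.tensor_mem_testSurface (he : TorusMode k e e') {φ : ℝ → ℝ}
    (hφ : φ ∈ testLine ℝ) :
    (fun p : ℝ × Torus => ((φ p.1 * e p.2 : ℝ) : 𝕜)) ∈ testSurface 𝕜 := by
  have hs : tsupport (fun p : ℝ × Torus => ((φ p.1 * e p.2 : ℝ) : 𝕜)) ⊆ Prod.fst ⁻¹' tsupport φ :=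
    closure_minimal (fun p hp => subset_tsupport φ fun h => hp (by simp [h]))
      ((isClosed_tsupport φ).preimage continuous_fst)
  refine ⟨?_, ?_, fun p hp => hφ.2.2 (hs hp)⟩
  · exact (RCLike.ofRealCLM (K := 𝕜)).contDiff.comp
      ((hφ.1.comp contDiff_fst).mul (he.contDiff.comp contDiff_snd))
  · refine (hφ.2.1.isCompact.prod isCompact_univ).of_isClosed_subset (isClosed_tsupport _) ?_
    exact fun p hp => ⟨hs hp, mem_univ _⟩

/-- Separation of variables: `e'' = -k² e` turns the angular term into the potential of `Δ̂_k`. -/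
theorem TorusMode.laplaceExpr_tensor (he : TorusMode k e e') (α : ℝ) {φ : ℝ → ℝ}
    (hφ : φ ∈ testLine ℝ) (p : ℝ × Torus) :
    laplaceExpr α (fun p : ℝ × Torus => ((φ p.1 * e p.2 : ℝ) : 𝕜)) p
      = ((fourierExpr α k φ p.1 * e p.2 : ℝ) : 𝕜) := by
  obtain ⟨d0, d1, -⟩ := testLine_differentiable hφ
  have x1 : partialX (fun p : ℝ × Torus => ((φ p.1 * e p.2 : ℝ) : 𝕜))
      = fun p => ((deriv φ p.1 * e p.2 : ℝ) : 𝕜) := funext fun p =>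
    (hasDerivAt_ofReal ((d0 p.1).hasDerivAt.mul_const (e p.2))).deriv
  have x2 : partialX (fun p : ℝ × Torus => ((deriv φ p.1 * e p.2 : ℝ) : 𝕜)) p
      = ((deriv (deriv φ) p.1 * e p.2 : ℝ) : 𝕜) :=
    (hasDerivAt_ofReal ((d1 p.1).hasDerivAt.mul_const (e p.2))).deriv
  have t1 : partialTheta (fun p : ℝ × Torus => ((φ p.1 * e p.2 : ℝ) : 𝕜))
      = fun p => ((φ p.1 * e' p.2 : ℝ) : 𝕜) := funext fun p =>
    (hasDerivAt_ofReal ((he.hasDerivAt p.2).const_mul (φ p.1))).deriv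
  have t2 : partialTheta (fun p : ℝ × Torus => ((φ p.1 * e' p.2 : ℝ) : 𝕜)) p
      = ((φ p.1 * (-(k : ℝ) ^ 2 * e p.2) : ℝ) : 𝕜) :=
    (hasDerivAt_ofReal ((he.hasDerivAt_deriv p.2).const_mul (φ p.1))).deriv
  rw [laplaceExpr, x1, x2, t1, t2, fourierExpr]
  simp only [RCLike.real_smul_eq_coe_mul, smul_eq_mul]
  push_cast
  ring

/-! #### Fourier coefficients of square integrable functions -/

/-- Cauchy–Schwarz, obtained by expanding `∫ (T g - I)² ≥ 0` with `T` the total mass and `I = ∫ g`.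
The factor `T` is then divided out; if `T = 0`, the measure is zero. -/
theorem sq_integral_le_measure_mul_integral_sq {X : Type*} [MeasurableSpace X] {ν : Measure X}
    [IsFiniteMeasure ν] {g : X → ℝ} (hg : MemLp g 2 ν) :
    (∫ x, g x ∂ν) ^ 2 ≤ ν.real univ * ∫ x, g x ^ 2 ∂ν := by
  have h2 := hg.integrable_sq
  have h1 : Integrable g ν := hg.integrable (by norm_num)
  set T := ν.real univ
  set I := ∫ x, g x ∂ν
  have hT : 0 ≤ T := measureReal_nonneg
  have hnn : 0 ≤ ∫ x, (T * g x - I) ^ 2 ∂ν := integral_nonneg fun x => sq_nonneg _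
  have e : (fun x => (T * g x - I) ^ 2)
      = fun x => T ^ 2 * g x ^ 2 - 2 * T * I * g x + I ^ 2 := by funext x; ring
  have i1 : Integrable (fun x => T ^ 2 * g x ^ 2 - 2 * T * I * g x) ν :=
    (h2.const_mul _).sub (h1.const_mul _)
  rw [e, integral_add i1 (integrable_const _),
    integral_sub (h2.const_mul _) (h1.const_mul _), integral_const_mul, integral_const_mul,
    integral_const, smul_eq_mul] at hnn
  have h3 : 0 ≤ T * (T * (∫ x, g x ^ 2 ∂ν) - I ^ 2) := by
    change 0 ≤ T ^ 2 * (∫ x, g x ^ 2 ∂ν) - 2 * T * I * I + T * I ^ 2 at hnn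
    linarith
  rcases hT.eq_or_lt with h0 | h0
  · have hν : ν = 0 := by
      rw [← Measure.measure_univ_eq_zero]
      exact (measureReal_eq_zero_iff).1 h0.symm
    have hI : I = 0 := by simp [I, hν]
    rw [hI, ← h0]
    simp
  · have := nonneg_of_mul_nonneg_right h3 h0
    linarith

/-- Cauchy–Schwarz on the circle and `|e| ≤ 1` bound the squared coefficient by `T ∫ w(x, θ)² dθ`,
with `T` the mass of the circle; this is integrable in `x` by Fubini. -/
theorem TorusMode.memLp_coefficient (he : TorusMode k e e') {α : ℝ} {w : ℝ × Torus → ℝ}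
    (hw : MemLp w 2 (riemannianMeasure α)) :
    MemLp (fun x => ∫ θ : Torus, w (x, θ) * e θ) 2 (lineMeasure α) := by
  have hwe : AEStronglyMeasurable (fun p : ℝ × Torus => w p * e p.2) (riemannianMeasure α) :=
    hw.1.mul (he.continuous.comp continuous_snd).aestronglyMeasurable
  have hm : AEStronglyMeasurable (fun x => ∫ θ : Torus, w (x, θ) * e θ) (lineMeasure α) :=
    hwe.integral_prod_right'
  rw [memLp_two_iff_integrable_sq hm]
  have hi := hw.integrable_sq
  refine (hi.integral_prod_left.const_mul ((volume : Measure Torus).real univ)).mono (hm.pow 2) ?_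
  filter_upwards [hwe.prodMk_left, hi.prod_right_ae] with x h1 h2
  have hle : ∀ θ, (w (x, θ) * e θ) ^ 2 ≤ w (x, θ) ^ 2 := fun θ => by
    rw [mul_pow]
    have : e θ ^ 2 ≤ 1 := by rw [← sq_abs]; exact pow_le_one₀ (abs_nonneg _) (he.abs_le θ)
    exact mul_le_of_le_one_right (sq_nonneg _) this
  have h3 : Integrable (fun θ => (w (x, θ) * e θ) ^ 2) (volume : Measure Torus) :=
    h2.mono' (h1.pow 2) (Eventually.of_forall fun θ => by
      rw [Real.norm_of_nonneg (sq_nonneg _)]; exact hle θ)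
  have h4 := sq_integral_le_measure_mul_integral_sq ((memLp_two_iff_integrable_sq h1).2 h3)
  have h5 : ∫ θ : Torus, (w (x, θ) * e θ) ^ 2 ≤ ∫ θ : Torus, w (x, θ) ^ 2 :=
    integral_mono h3 h2 hle
  have h6 : 0 ≤ ∫ θ : Torus, w (x, θ) ^ 2 := integral_nonneg fun θ => sq_nonneg _
  rw [Real.norm_of_nonneg (sq_nonneg _), Real.norm_of_nonneg (mul_nonneg measureReal_nonneg h6)]
  exact h4.trans (mul_le_mul_of_nonneg_left h5 measureReal_nonneg)

theorem TorusMode.memLp_tensor (he : TorusMode k e e') {α : ℝ} {ψ : ℝ → ℝ}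
    (hψ : MemLp ψ 2 (lineMeasure α)) :
    MemLp (fun p : ℝ × Torus => ψ p.1 * e p.2) 2 (riemannianMeasure α) := by
  refine (hψ.comp_fst (volume : Measure Torus)).mono ((hψ.comp_fst _).1.mul
    (he.continuous.comp continuous_snd).aestronglyMeasurable) (Eventually.of_forall fun p => ?_)
  rw [norm_mul]
  exact mul_le_of_le_one_right (norm_nonneg _) (he.abs_le p.2)

theorem TorusMode.integral_mul_tensor (he : TorusMode k e e') {α : ℝ} {w : ℝ × Torus → ℝ}
    (hw : MemLp w 2 (riemannianMeasure α)) {ψ : ℝ → ℝ} (hψ : MemLp ψ 2 (lineMeasure α)) :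
    ∫ p, w p * (ψ p.1 * e p.2) ∂(riemannianMeasure α)
      = ∫ x, (∫ θ : Torus, w (x, θ) * e θ) * ψ x ∂(lineMeasure α) := by
  have hi : Integrable (fun p => w p * (ψ p.1 * e p.2)) (riemannianMeasure α) :=
    hw.integrable_mul (he.memLp_tensor hψ)
  rw [integral_prod _ hi]
  refine integral_congr_ae (Eventually.of_forall fun x => ?_)
  simp only
  rw [← integral_mul_const]
  exact integral_congr_ae (Eventually.of_forall fun θ => by ring)

/-- A square integrable function on the circle with vanishing Fourier coefficients is zero. -/
theorem ae_eq_zero_of_integral_fourier {g : Torus → ℝ} (hg : MemLp g 2 (volume : Measure Torus))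
    (hcos : ∀ k, ∫ θ, g θ * torusCos k θ = 0) (hsin : ∀ k, ∫ θ, g θ * torusSin k θ = 0) :
    g =ᵐ[volume] 0 := by
  have hvol := AddCircle.volume_eq_smul_haarAddCircle (T := 2 * Real.pi)
  have hG : MemLp (fun θ => ((g θ : ℝ) : ℂ)) 2 (volume : Measure Torus) := hg.ofReal
  -- The Fourier basis lives on the normalised Haar measure, which differs from `dθ` by the factor
  -- `2π`.
  have hG' : MemLp (fun θ => ((g θ : ℝ) : ℂ)) 2 (AddCircle.haarAddCircle : Measure Torus) := by
    have h := hG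
    rw [hvol] at h
    refine h.of_measure_le_smul (c := (ENNReal.ofReal (2 * Real.pi))⁻¹) ?_ ?_
    · simpa using Real.pi_pos
    · rw [smul_smul, ENNReal.inv_mul_cancel (by simpa using Real.pi_pos) ENNReal.ofReal_ne_top,
        one_smul]
  have hz : hG'.toLp _ = 0 := by
    refine (fourierBasis (T := 2 * Real.pi)).repr.injective ?_
    rw [map_zero]
    ext n
    rw [fourierBasis_repr, lp.coeFn_zero, Pi.zero_apply, fourierCoeff_congr_ae hG'.coeFn_toLp,
      fourierCoeff, AddCircle.integral_haarAddCircle]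
    have e : ∀ θ : Torus, fourier (-n) θ • ((g θ : ℝ) : ℂ)
        = ((g θ * torusCos (-n) θ : ℝ) : ℂ) + ((g θ * torusSin (-n) θ : ℝ) : ℂ) * Complex.I := by
      intro θ
      rw [torusCos, torusSin, smul_eq_mul]
      conv_lhs => rw [← Complex.re_add_im (fourier (-n) θ)]
      push_cast
      ring
    have hgi : Integrable g (volume : Measure Torus) := hg.integrable (by norm_num)
    have i1 : Integrable (fun θ => g θ * torusCos (-n) θ) (volume : Measure Torus) :=
      hgi.mul_bdd (c := 1) (torusMode_cos (-n)).continuous.aestronglyMeasurable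
        (Eventually.of_forall (torusMode_cos (-n)).abs_le)
    have i2 : Integrable (fun θ => g θ * torusSin (-n) θ) (volume : Measure Torus) :=
      hgi.mul_bdd (c := 1) (torusMode_sin (-n)).continuous.aestronglyMeasurable
        (Eventually.of_forall (torusMode_sin (-n)).abs_le)
    simp only [e]
    rw [integral_add i1.ofReal (i2.ofReal.mul_const _), integral_mul_const, integral_complex_ofReal,
      integral_complex_ofReal, hcos, hsin]
    simp
  have h1 := hG'.coeFn_toLp
  rw [hz] at h1
  have h2 : (fun θ => ((g θ : ℝ) : ℂ)) =ᵐ[AddCircle.haarAddCircle] 0 :=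
    h1.symm.trans (Lp.coeFn_zero _ _ _)
  have h3 : ∀ᵐ θ ∂(volume : Measure Torus), ((g θ : ℝ) : ℂ) = 0 := by
    rw [hvol]
    exact Measure.ae_smul_measure h2 _
  filter_upwards [h3] with θ hθ
  exact_mod_cast hθ

/-- A square integrable function on the surface all of whose Fourier coefficients vanish is zero. -/
theorem surface_ae_eq_zero {α : ℝ} {w : ℝ × Torus → ℝ} (hw : MemLp w 2 (riemannianMeasure α))
    (h : ∀ (k : ℤ) (e e' : Torus → ℝ), TorusMode k e e' →
      (fun x => ∫ θ : Torus, w (x, θ) * e θ) =ᵐ[lineMeasure α] 0) :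
    w =ᵐ[riemannianMeasure α] 0 := by
  -- There are countably many modes, so one null set of `x` serves for all of them.
  have hc := ae_all_iff.2 fun k => h k _ _ (torusMode_cos k)
  have hs := ae_all_iff.2 fun k => h k _ _ (torusMode_sin k)
  have hi := hw.integrable_sq
  have h0 : ∫ p, w p ^ 2 ∂(riemannianMeasure α) = 0 := by
    rw [integral_prod _ hi]
    refine integral_eq_zero_of_ae ?_
    filter_upwards [hc, hs, hi.prod_right_ae, hw.1.prodMk_left] with x h1 h2 h3 h4
    have := ae_eq_zero_of_integral_fourier ((memLp_two_iff_integrable_sq h4).2 h3) h1 h2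
    refine integral_eq_zero_of_ae ?_
    filter_upwards [this] with θ hθ
    have hθ' : w (x, θ) = 0 := hθ
    simp [hθ']
  have h1 := (integral_eq_zero_iff_of_nonneg (fun p => sq_nonneg (w p)) hi).1 h0
  filter_upwards [h1] with p hp
  exact pow_eq_zero_iff two_ne_zero |>.1 hp

/-- Testing against `φ ⊗ e` amounts to testing the Fourier coefficients. -/
theorem TorusMode.integral_coefficient_eq_zero (he : TorusMode k e e') {α : ℝ}
    {w : ℝ × Torus → 𝕜} (hw : MemLp w 2 (riemannianMeasure α)) {ψ : ℝ → ℝ}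
    (hψ : MemLp ψ 2 (lineMeasure α))
    (h : ∫ p, inner 𝕜 (w p) ((ψ p.1 * e p.2 : ℝ) : 𝕜) ∂(riemannianMeasure α) = 0) :
    (∫ x, (∫ θ : Torus, RCLike.re (w (x, θ)) * e θ) * ψ x ∂(lineMeasure α) = 0) ∧
      ∫ x, (∫ θ : Torus, RCLike.im (w (x, θ)) * e θ) * ψ x ∂(lineMeasure α) = 0 := by
  obtain ⟨h1, h2⟩ := integral_re_im_mul_eq_zero hw (he.memLp_tensor hψ) h
  exact ⟨(he.integral_mul_tensor hw.re hψ).symm.trans h1,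
    (he.integral_mul_tensor hw.im hψ).symm.trans h2⟩

/-- Tensors `φ ⊗ e` already suffice: testing against them annihilates every Fourier coefficient of
the real and imaginary parts. -/
theorem surface_dense {α : ℝ} {w : ℝ × Torus → 𝕜} (hw : MemLp w 2 (riemannianMeasure α))
    (h : ∀ f ∈ testSurface 𝕜, ∫ p, inner 𝕜 (w p) (f p) ∂(riemannianMeasure α) = 0) :
    w =ᵐ[riemannianMeasure α] 0 := by
  have key : ∀ {k : ℤ} {e e' : Torus → ℝ}, TorusMode k e e' → ∀ φ ∈ testLine ℝ,
      (∫ x, (∫ θ : Torus, RCLike.re (w (x, θ)) * e θ) * φ x ∂(lineMeasure α) = 0) ∧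
        ∫ x, (∫ θ : Torus, RCLike.im (w (x, θ)) * e θ) * φ x ∂(lineMeasure α) = 0 :=
    fun he φ hφ => he.integral_coefficient_eq_zero hw (memLp_of_mem_testLine α hφ)
      (h _ (he.tensor_mem_testSurface (𝕜 := 𝕜) hφ))
  have hre : ∀ (k : ℤ) (e e' : Torus → ℝ), TorusMode k e e' →
      (fun x => ∫ θ : Torus, RCLike.re (w (x, θ)) * e θ) =ᵐ[lineMeasure α] 0 := fun k e e' he =>
    line_dense
      (he.memLp_coefficient (w := fun p => RCLike.re (w p)) hw.re)
      fun φ hφ => (key he φ hφ).1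
  have him : ∀ (k : ℤ) (e e' : Torus → ℝ), TorusMode k e e' →
      (fun x => ∫ θ : Torus, RCLike.im (w (x, θ)) * e θ) =ᵐ[lineMeasure α] 0 := fun k e e' he =>
    line_dense
      (he.memLp_coefficient (w := fun p => RCLike.im (w p)) hw.im)
      fun φ hφ => (key he φ hφ).2
  exact ae_eq_zero_of_re_im (surface_ae_eq_zero (w := fun p => RCLike.re (w p)) hw.re hre)
    (surface_ae_eq_zero (w := fun p => RCLike.im (w p)) hw.im him)

/-- The limit-point case: the `L²` kernel of the adjoint of `Δ - 1` is trivial. -/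
theorem surface_kernel {α : ℝ} (hα : ∀ k, LimitPoint α k) {w : ℝ × Torus → 𝕜}
    (hw : MemLp w 2 (riemannianMeasure α))
    (h : ∀ f ∈ testSurface 𝕜,
      ∫ p, inner 𝕜 (w p) (laplaceExpr α f p - f p) ∂(riemannianMeasure α) = 0) :
    w =ᵐ[riemannianMeasure α] 0 := by
  have hψ : ∀ (k : ℤ), ∀ φ ∈ testLine ℝ,
      MemLp (fun x => fourierExpr α k φ x - φ x) 2 (lineMeasure α) := fun k φ hφ =>
    (memLp_fourierExpr α k hφ).sub (memLp_of_mem_testLine α hφ)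
  have key : ∀ {k : ℤ} {e e' : Torus → ℝ}, TorusMode k e e' → ∀ φ ∈ testLine ℝ,
      (∫ x, (∫ θ : Torus, RCLike.re (w (x, θ)) * e θ) * (fourierExpr α k φ x - φ x)
        ∂(lineMeasure α) = 0) ∧
      ∫ x, (∫ θ : Torus, RCLike.im (w (x, θ)) * e θ) * (fourierExpr α k φ x - φ x)
        ∂(lineMeasure α) = 0 := fun {k e e'} he φ hφ => by
    refine he.integral_coefficient_eq_zero (ψ := fun x => fourierExpr α k φ x - φ x) hw
      (hψ k φ hφ) ?_
    rw [← h _ (he.tensor_mem_testSurface (𝕜 := 𝕜) hφ)]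
    refine integral_congr_ae (Eventually.of_forall fun p => ?_)
    simp only
    rw [he.laplaceExpr_tensor α hφ, ← RCLike.ofReal_sub, sub_mul]
  have hre : ∀ (k : ℤ) (e e' : Torus → ℝ), TorusMode k e e' →
      (fun x => ∫ θ : Torus, RCLike.re (w (x, θ)) * e θ) =ᵐ[lineMeasure α] 0 := fun k e e' he =>
    line_kernel (hα k)
      (he.memLp_coefficient (w := fun p => RCLike.re (w p)) hw.re)
      fun φ hφ => (key he φ hφ).1
  have him : ∀ (k : ℤ) (e e' : Torus → ℝ), TorusMode k e e' →
      (fun x => ∫ θ : Torus, RCLike.im (w (x, θ)) * e θ) =ᵐ[lineMeasure α] 0 := fun k e e' he =>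
    line_kernel (hα k)
      (he.memLp_coefficient (w := fun p => RCLike.im (w p)) hw.im)
      fun φ hφ => (key he φ hφ).2
  exact ae_eq_zero_of_re_im (surface_ae_eq_zero (w := fun p => RCLike.re (w p)) hw.re hre)
    (surface_ae_eq_zero (w := fun p => RCLike.im (w p)) hw.im him)

/-- In these ranges of `α` every mode, including `k = 0`, is in the limit-point case, as the kernel
argument for `Δ` requires. -/
theorem laplaceBeltrami_essentiallySelfAdjoint {α : ℝ} (hα : α ≤ -3 ∨ 1 ≤ α) :
    EssentiallySelfAdjoint (laplaceBeltrami 𝕜 α) :=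
  essentiallySelfAdjoint_operatorOn (surfaceForm α) (integral_inner_laplaceMap α)
    (surfaceForm_conj α) (surfaceForm_nonneg α)
    (fun _ hw h => surface_dense hw fun f hf => h ⟨f, hf⟩)
    (fun _ hw h => surface_kernel (fun _ => hα.imp_right Or.inl) hw fun f hf => h ⟨f, hf⟩)

end Fourier

end GrushinLaplacian

/-- The classification of essential self-adjointness, for real-valued (`𝕜 = ℝ`) and for
complex-valued (`𝕜 = ℂ`) functions. -/
theorem theorem1p3 {𝕜 : Type*} [RCLike 𝕜] (α : ℝ) :
    (α ≤ -3 →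
      GrushinLaplacian.EssentiallySelfAdjoint (GrushinLaplacian.laplaceBeltrami 𝕜 α) ∧
      ∀ k : ℤ, GrushinLaplacian.EssentiallySelfAdjoint (GrushinLaplacian.fourierComponent 𝕜 α k)) ∧
    (-3 < α ∧ α ≤ -1 →
      ¬ GrushinLaplacian.EssentiallySelfAdjoint (GrushinLaplacian.laplaceBeltrami 𝕜 α) ∧
      ∀ k : ℤ,
        (¬ GrushinLaplacian.EssentiallySelfAdjoint (GrushinLaplacian.fourierComponent 𝕜 α k)) ↔
          k = 0) ∧
    (-1 < α ∧ α < 1 →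
      ¬ GrushinLaplacian.EssentiallySelfAdjoint (GrushinLaplacian.laplaceBeltrami 𝕜 α) ∧
      ∀ k : ℤ,
        ¬ GrushinLaplacian.EssentiallySelfAdjoint (GrushinLaplacian.fourierComponent 𝕜 α k)) ∧
    (1 ≤ α →
      GrushinLaplacian.EssentiallySelfAdjoint (GrushinLaplacian.laplaceBeltrami 𝕜 α) ∧
      ∀ k : ℤ, GrushinLaplacian.EssentiallySelfAdjoint (GrushinLaplacian.fourierComponent 𝕜 α k)) := by
  -- The zero mode alone defeats both `Δ` and `Δ̂_0` on the whole range `(-3, 1)`.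
  have hzero : -3 < α → α < 1 →
      ¬ GrushinLaplacian.EssentiallySelfAdjoint (GrushinLaplacian.laplaceBeltrami 𝕜 α) ∧
      ¬ GrushinLaplacian.EssentiallySelfAdjoint (GrushinLaplacian.fourierComponent 𝕜 α 0) :=
    fun h1 h2 => by
      obtain ⟨_, _, _, _, _, _, hp⟩ := GrushinLaplacian.exists_boundaryPair_zero h1 h2
      exact ⟨hp.not_essentiallySelfAdjoint_laplaceBeltrami, hp.not_essentiallySelfAdjoint⟩
  refine ⟨fun h => ⟨?_, fun k => ?_⟩, fun h => ⟨?_, fun k => ⟨fun hk => ?_, ?_⟩⟩,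
    fun h => ⟨?_, fun k => ?_⟩, fun h => ⟨?_, fun k => ?_⟩⟩
  · exact GrushinLaplacian.laplaceBeltrami_essentiallySelfAdjoint (Or.inl h)
  · exact GrushinLaplacian.fourierComponent_essentiallySelfAdjoint (Or.inl h)
  · exact (hzero h.1 (by linarith [h.2])).1
  · by_contra h0
    exact hk (GrushinLaplacian.fourierComponent_essentiallySelfAdjoint
      (Or.inr (Or.inr ⟨h.2, h0⟩)))
  · rintro rfl
    exact (hzero h.1 (by linarith [h.2])).2
  · exact (hzero (by linarith [h.1]) h.2).1
  · rcases eq_or_ne k 0 with rfl | hk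
    · exact (hzero (by linarith [h.1]) h.2).2
    · obtain ⟨_, _, _, _, _, _, hp⟩ :=
        GrushinLaplacian.exists_boundaryPair_of_ne_zero h.1 h.2 hk
      exact hp.not_essentiallySelfAdjoint
  · exact GrushinLaplacian.laplaceBeltrami_essentiallySelfAdjoint (Or.inr h)
  · exact GrushinLaplacian.fourierComponent_essentiallySelfAdjoint (Or.inr (Or.inl h))
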